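/- Let $V$ and $X$ be complex Banach spaces and let $C$ be a linear operator with domain $D(C)\subseteq X$ that generates a cosine operator function on $X$ with associated phase space $V\times X$. This means: $C$ generates a strongly continuous cosine operator function on $X$; there are continuous embeddings $[D(C)]\hookrightarrow V\hookrightarrow X$, where $[D(C)]$ is $D(C)$ with the graph norm; and the operator matrix $\begin{pmatrix}0&I_V\\ C&0\end{pmatrix}$ with domain $D(C)\times V$ generates a $C_0$-semigroup on $V\times X$. Let $A$ be a bounded linear operator from $V$ to $X$. Then the operator matrix $$\mathcal A=\begin{pmatrix}0& I_{D(C)}\\ A& C\end{pmatrix},\qquad D(\mathcal A)=V\times D(C),$$ generates an analytic semigroup of angle $\frac{\pi}{2}$ on $V\times X$. In particular, the complete second order problem $$\ddot u(t)=Au(t)+C\dot u(t),\qquad u(0)=f,\quad \dot u(0)=g,$$ is well-posed: $D(C)$ is dense in $X$; for all $f\in V$, $g\in D(C)$ there is a unique strict solution; and for every $\tau>0$ there is a constant $K$ such that $\|u(t)\|_V+\|\dot u(t)\|_X\le K(\|f\|_V+\|g\|_X)$ for all $t\in[0,\tau]$, for all $f\in V$, $g\in X$ and every classical solution $u$ with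 these initial data. Moreover, for all $f\in V$, $g\in X$ it has a unique classical solution. Here a classical (respectively, strict) solution is a function $u\in C([0,\infty);V)\cap C^1([0,\infty);X)$ that is twice continuously differentiable with values in $X$ on $(0,\infty)$ (respectively, on $[0,\infty)$), with $\dot u(t)\in D(C)$ and $\ddot u(t)=Au(t)+C\dot u(t)$ for all $t>0$ (respectively, all $t\ge 0$), $u(0)=f$ and $\dot u(0)=g$. -/

import Mathlib

open Set Filter Topology

noncomputable section

namespace CosineGeneration

section Families

variable {E : Type*} [NormedAddCommGroup E] [NormedSpace ℂ E]

/-- `T`, read on `[0, ∞)` only, is a strongly continuous one-parameter semigroup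
(`C₀`-semigroup) of bounded operators on `E`. -/
structure IsC0Semigroup (T : ℝ → E →L[ℂ] E) : Prop where
  map_zero : T 0 = 1
  map_add : ∀ s t : ℝ, 0 ≤ s → 0 ≤ t → T (s + t) = T s * T t
  strongCont : ∀ x : E, Tendsto (fun t : ℝ => T t x) (𝓝[>] 0) (𝓝 x)

/-- `B` is the (infinitesimal) generator of `T`: its graph consists of exactly the pairs `(x, y)`
such that `(T t x - x) / t → y` as `t → 0+`. -/
def IsSemigroupGenerator (B : E →ₗ.[ℂ] E) (T : ℝ → E →L[ℂ] E) : Prop :=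
  ∀ x y : E, (x, y) ∈ B.graph ↔
    Tendsto (fun t : ℝ => (t⁻¹ : ℝ) • (T t x - x)) (𝓝[>] 0) (𝓝 y)

/-- `B` generates a `C₀`-semigroup on `E`. -/
def GeneratesC0Semigroup (B : E →ₗ.[ℂ] E) : Prop :=
  ∃ T : ℝ → E →L[ℂ] E, IsC0Semigroup T ∧ IsSemigroupGenerator B T

/-- The open sector `{z ≠ 0 : |arg z| < δ}`. -/
def sector (δ : ℝ) : Set ℂ := {z | z ≠ 0 ∧ |z.arg| < δ}

/-- `T`, read on `sector δ ∪ {0}` only, is an analytic semigroup of angle `δ` (`0 < δ ≤ π / 2`). -/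
structure IsAnalyticSemigroup (T : ℂ → E →L[ℂ] E) (δ : ℝ) : Prop where
  map_zero : T 0 = 1
  map_add : ∀ z ∈ sector δ, ∀ w ∈ sector δ, T (z + w) = T z * T w
  analytic : DifferentiableOn ℂ T (sector δ)
  strongCont : ∀ δ' : ℝ, 0 < δ' → δ' < δ → ∀ x : E,
    Tendsto (fun z : ℂ => T z x) (𝓝[sector δ'] 0) (𝓝 x)

/-- `B` generates an analytic semigroup of angle `δ` on `E`. -/
def GeneratesAnalyticSemigroup (B : E →ₗ.[ℂ] E) (δ : ℝ) : Prop :=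
  ∃ T : ℂ → E →L[ℂ] E, IsAnalyticSemigroup T δ ∧
    IsSemigroupGenerator B (fun t : ℝ => T (t : ℂ))

/-- `c` is a (strongly continuous) cosine operator function on `E`. -/
structure IsCosineFunction (c : ℝ → E →L[ℂ] E) : Prop where
  map_zero : c 0 = 1
  dAlembert : ∀ s t : ℝ, (2 : ℂ) • (c s * c t) = c (s + t) + c (s - t)
  strongCont : ∀ x : E, Continuous (fun t : ℝ => c t x)

/-- `B` is the generator of the cosine operator function `c`: its graph consists of exactly the
pairs `(x, y)` such that `2 (c t x - x) / t ^ 2 → y` as `t → 0`. -/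
def IsCosineGenerator (B : E →ₗ.[ℂ] E) (c : ℝ → E →L[ℂ] E) : Prop :=
  ∀ x y : E, (x, y) ∈ B.graph ↔
    Tendsto (fun t : ℝ => (2 / t ^ 2 : ℝ) • (c t x - x)) (𝓝[≠] 0) (𝓝 y)

/-- `B` generates a cosine operator function on `E`. -/
def GeneratesCOF (B : E →ₗ.[ℂ] E) : Prop :=
  ∃ c : ℝ → E →L[ℂ] E, IsCosineFunction c ∧ IsCosineGenerator B c

end Families

section Matrices

variable {V X : Type*} [NormedAddCommGroup V] [NormedSpace ℂ V]
  [NormedAddCommGroup X] [NormedSpace ℂ X]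

/-- With `V` embedded in `X` by `ι`: the operator matrix `(0 I_V; B 0)` on `V × X` with domain
`D(B) × V`, that is, `(u, v) ↦ (v, B u)` for `u ∈ V` in `D(B)` and `v ∈ V`. Its domain is a
subspace of `V × X`, so the second coordinate of an element is `ι v`. -/
def waveMatrix (ι : V →L[ℂ] X) (hι : Function.Injective ι) (B : X →ₗ.[ℂ] X) :
    (V × X) →ₗ.[ℂ] (V × X) where
  domain := (B.domain.comap ι.toLinearMap).prod (LinearMap.range ι.toLinearMap)
  toFun :=
    { toFun := fun p =>
        ((LinearEquiv.ofInjective ι.toLinearMap hι).symm ⟨p.1.2, p.2.2⟩, B ⟨ι p.1.1, p.2.1⟩)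
      map_add' := by
        intro p q
        refine Prod.ext ?_ ?_
        · exact map_add (LinearEquiv.ofInjective ι.toLinearMap hι).symm
            ⟨p.1.2, p.2.2⟩ ⟨q.1.2, q.2.2⟩
        · have h := B.map_add ⟨ι p.1.1, p.2.1⟩ ⟨ι q.1.1, q.2.1⟩
          exact (congrArg (fun z => B z) (Subtype.ext (map_add ι p.1.1 q.1.1))).trans h
      map_smul' := by
        intro a p
        refine Prod.ext ?_ ?_
        · exact map_smul (LinearEquiv.ofInjective ι.toLinearMap hι).symm a ⟨p.1.2, p.2.2⟩
        · have h := B.map_smul a ⟨ι p.1.1, p.2.1⟩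
          exact (congrArg (fun z => B z) (Subtype.ext (map_smul ι a p.1.1))).trans h }

/-- With `[D(C)] ⊆ V ⊆ X`, `V` embedded in `X` by `ι`: the reduction matrix `(0 I; A C)` on
`V × X` with domain `V × D(C)`, that is, `(u, w) ↦ (w, A u + C w)`, where the first coordinate of
the value is `w ∈ D(C)` seen as an element of `V`. -/
def reductionMatrix (ι : V →L[ℂ] X) (hι : Function.Injective ι) (A : V →L[ℂ] X)
    (C : X →ₗ.[ℂ] X) (hC : C.domain ≤ LinearMap.range ι.toLinearMap) :
    (V × X) →ₗ.[ℂ] (V × X) where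
  domain := (⊤ : Submodule ℂ V).prod C.domain
  toFun :=
    { toFun := fun p =>
        ((LinearEquiv.ofInjective ι.toLinearMap hι).symm ⟨p.1.2, hC p.2.2⟩,
          A p.1.1 + C ⟨p.1.2, p.2.2⟩)
      map_add' := by
        intro p q
        refine Prod.ext ?_ ?_
        · exact map_add (LinearEquiv.ofInjective ι.toLinearMap hι).symm
            ⟨p.1.2, hC p.2.2⟩ ⟨q.1.2, hC q.2.2⟩
        · have h := C.map_add ⟨p.1.2, p.2.2⟩ ⟨q.1.2, q.2.2⟩
          have h' := map_add A p.1.1 q.1.1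
          exact (congrArg₂ (· + ·) h' h).trans (add_add_add_comm _ _ _ _)
      map_smul' := by
        intro a p
        refine Prod.ext ?_ ?_
        · exact map_smul (LinearEquiv.ofInjective ι.toLinearMap hι).symm a ⟨p.1.2, hC p.2.2⟩
        · have h := C.map_smul a ⟨p.1.2, p.2.2⟩
          have h' := map_smul A a p.1.1
          exact (congrArg₂ (· + ·) h' h).trans (smul_add _ _ _).symm }

theorem mem_graph_waveMatrix_iff (ι : V →L[ℂ] X) (hι : Function.Injective ι)
    (B : X →ₗ.[ℂ] X) (u v : V) (w x : X) :
    ((u, w), (v, x)) ∈ (waveMatrix ι hι B).graph ↔ w = ι v ∧ (ι u, x) ∈ B.graph := by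
  have hs : ∀ z : LinearMap.range ι.toLinearMap,
      ι ((LinearEquiv.ofInjective ι.toLinearMap hι).symm z) = z := fun z =>
    congrArg Subtype.val ((LinearEquiv.ofInjective ι.toLinearMap hι).apply_symm_apply z)
  simp only [LinearPMap.mem_graph_iff]
  constructor
  · rintro ⟨p, hp, hq⟩
    have hp1 : p.1.1 = u := congrArg Prod.fst hp
    have hp2 : p.1.2 = w := congrArg Prod.snd hp
    have hq1 : (LinearEquiv.ofInjective ι.toLinearMap hι).symm ⟨p.1.2, p.2.2⟩ = v :=
      congrArg Prod.fst hq
    have hq2 : B ⟨ι p.1.1, p.2.1⟩ = x := congrArg Prod.snd hq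
    exact ⟨by rw [← hq1, hs, ← hp2], ⟨ι p.1.1, p.2.1⟩, by simp [hp1], hq2⟩
  · rintro ⟨rfl, y, hy, rfl⟩
    refine ⟨⟨(u, ι v), ⟨by simp [← hy], v, rfl⟩⟩, rfl, Prod.ext (hι (hs _)) ?_⟩
    change B _ = B y
    congr 1
    exact Subtype.ext hy.symm

theorem mem_graph_reductionMatrix_iff (ι : V →L[ℂ] X) (hι : Function.Injective ι)
    (A : V →L[ℂ] X) (C : X →ₗ.[ℂ] X) (hC : C.domain ≤ LinearMap.range ι.toLinearMap)
    (u v : V) (w x : X) :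
    ((u, w), (v, x)) ∈ (reductionMatrix ι hι A C hC).graph ↔
      w = ι v ∧ ∃ hw : w ∈ C.domain, x = A u + C ⟨w, hw⟩ := by
  have hs : ∀ z : LinearMap.range ι.toLinearMap,
      ι ((LinearEquiv.ofInjective ι.toLinearMap hι).symm z) = z := fun z =>
    congrArg Subtype.val ((LinearEquiv.ofInjective ι.toLinearMap hι).apply_symm_apply z)
  simp only [LinearPMap.mem_graph_iff]
  constructor
  · rintro ⟨⟨⟨a, b⟩, hp'⟩, hp, hq⟩
    obtain ⟨rfl, rfl⟩ : a = u ∧ b = w := Prod.ext_iff.mp hp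
    obtain ⟨hq1, hq2⟩ := Prod.ext_iff.mp hq
    refine ⟨?_, hp'.2, hq2.symm⟩
    rw [← show _ = v from hq1]
    exact (hs ⟨b, hC hp'.2⟩).symm
  · rintro ⟨hwv, hw, rfl⟩
    exact ⟨⟨(u, w), ⟨trivial, hw⟩⟩, rfl, Prod.ext (hι ((hs _).trans hwv)) rfl⟩

/-- `B` generates a cosine operator function on `X` with associated phase space `V × X`, where the
Banach space `V` is embedded in `X` by `ι`: the continuous embeddings `[D(B)] ↪ V ↪ X` hold,
and `(0 I_V; B 0)` generates a `C₀`-semigroup on `V × X`, which says that `V` is the associated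
Kisyński space. -/
structure GeneratesCOFWithPhaseSpace (ι : V →L[ℂ] X) (B : X →ₗ.[ℂ] X) : Prop where
  cof : GeneratesCOF B
  injective : Function.Injective ι
  domain_le : B.domain ≤ LinearMap.range ι.toLinearMap
  /-- continuity of `[D(B)] ↪ V` for the graph norm -/
  embedding : ∃ K : ℝ, ∀ (v : V) (hv : ι v ∈ B.domain), ‖v‖ ≤ K * (‖ι v‖ + ‖B ⟨ι v, hv⟩‖)
  semigroup : GeneratesC0Semigroup (waveMatrix ι injective B)

/-- `u : [0, ∞) → V`, with velocity `u₁ : [0, ∞) → X`, solves `u'' = A u + C u'` at all times in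
`J`, with `u(0) = f` and `u'(0) = g`. Here `u` is continuous on `[0, ∞)` with values in `V`, it is
continuously differentiable on `[0, ∞)` with values in `X` and twice so on `J`. Values at
negative times are irrelevant. -/
def IsSolutionOn (ι : V →L[ℂ] X) (A : V →L[ℂ] X) (C : X →ₗ.[ℂ] X) (J : Set ℝ)
    (f : V) (g : X) (u : ℝ → V) (u₁ : ℝ → X) : Prop :=
  u 0 = f ∧ u₁ 0 = g ∧
  ContinuousOn u (Ici 0) ∧
  ContinuousOn u₁ (Ici 0) ∧
  (∀ t ∈ Ici (0 : ℝ), HasDerivWithinAt (fun s => ι (u s)) (u₁ t) (Ici 0) t) ∧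
  ∃ u₂ : ℝ → X, ContinuousOn u₂ J ∧
    ∀ t ∈ J, HasDerivWithinAt u₁ (u₂ t) (Ici 0) t ∧
      ∃ h : u₁ t ∈ C.domain, u₂ t = A (u t) + C ⟨u₁ t, h⟩

/-- Classical solution: the equation holds for `t > 0`. -/
def IsClassicalSolution (ι : V →L[ℂ] X) (A : V →L[ℂ] X) (C : X →ₗ.[ℂ] X)
    (f : V) (g : X) (u : ℝ → V) (u₁ : ℝ → X) : Prop :=
  IsSolutionOn ι A C (Ioi 0) f g u u₁

/-- Strict solution: the equation holds for `t ≥ 0`. -/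
def IsStrictSolution (ι : V →L[ℂ] X) (A : V →L[ℂ] X) (C : X →ₗ.[ℂ] X)
    (f : V) (g : X) (u : ℝ → V) (u₁ : ℝ → X) : Prop :=
  IsSolutionOn ι A C (Ici 0) f g u u₁

/-- Well-posedness of `u'' = A u + C u'`, `u(0) = f`, `u'(0) = g` in `V × X`: the initial data
`(f, g) ∈ V × D(C)` are dense, each of them has a unique strict solution, and solutions depend
continuously on the data in `V × X`, uniformly on bounded time intervals. -/
structure IsWellPosed (ι : V →L[ℂ] X) (A : V →L[ℂ] X) (C : X →ₗ.[ℂ] X) : Prop where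
  dense : Dense (C.domain : Set X)
  exists_unique : ∀ (f : V), ∀ g ∈ C.domain, ∃ (u : ℝ → V) (u₁ : ℝ → X),
    IsStrictSolution ι A C f g u u₁ ∧
    ∀ (v : ℝ → V) (v₁ : ℝ → X), IsStrictSolution ι A C f g v v₁ →
      EqOn v u (Ici 0) ∧ EqOn v₁ u₁ (Ici 0)
  dependence : ∀ τ : ℝ, 0 < τ → ∃ K : ℝ, ∀ (f : V) (g : X) (u : ℝ → V) (u₁ : ℝ → X),
    IsClassicalSolution ι A C f g u u₁ →
      ∀ t ∈ Icc (0 : ℝ) τ, ‖u t‖ + ‖u₁ t‖ ≤ K * (‖f‖ + ‖g‖)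

end Matrices

end CosineGeneration

end

/-! For `A = 0` the velocity `w = u'` solves the first order equation `w' = C w`, and `u` is the
initial value plus the primitive of `w`. An operator that generates a cosine function also generates
a holomorphic semigroup on the right half-plane. The Weierstrass formula writes this semigroup `E z`
as the integral over `s > 0` of `(π z)^(-1/2) exp (-s² / (4 z))` times the cosine function `c s`. So
the matrix with `A = 0` should generate `(f, g) ↦ (f + ∫₀ᶻ E g, E z g)`.

The difficulty is that the first coordinate lives in `V`, while the Weierstrass formula only yields
values in `X`. One integration by parts replaces `c s` by the sine family `S s`, which maps `X`
boundedly into `V`: `E z` factors through `Y z = (2 z)⁻¹ ∫ s k(z, s) S s ds`, where `k` is the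
kernel. The first moment of the kernel is of order `√‖z‖`, so `Y z` has norm of order `‖z‖^(-1/2)`
in each cone. This singularity is integrable, and the primitive of `Y` is bounded from `X` to `V`,
of order `√‖z‖` (`IsCosineSinePair.exists_heatPair`, `IsHeatPair.norm_liftPrimitive_le`). The cosine
and sine families are read off the wave semigroup on `V × X`, whose second column is `(S, c)`.

The operator `A` then enters through `(f, g) ↦ (0, A f)`, which is bounded on `V × X`. The
Dyson-Phillips series, taken along segments from `0` to `z`, shows that bounded perturbations keep
the semigroup holomorphic on the whole half-plane, with bounds in every cone
(`IsHolomorphicSemigroup.exists_perturbation`).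

For well-posedness, a classical solution has its velocity continuous into `D(C)` with the graph norm
for `t > 0`, hence continuous into `V`. It is therefore an orbit of the first order system, and
orbits are determined by their initial value because `T (t - s) (U s)` is constant in `s`. Existence
for all data comes from the smoothing effect of the semigroup. -/

namespace CosineGeneration

/-! ### Holomorphic parameter integrals and strong operator integrals -/

section Analysis

open MeasureTheory Metric

variable {G : Type*} [NormedAddCommGroup G] [NormedSpace ℂ G]

/-- Only the integrand has to be dominated, not its derivative: Cauchy's estimate on discs of radius
`ε / 4` turns a bound on the ball of radius `ε` into one for the derivative on the ball of radius `ε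
/ 2`. -/
theorem hasDerivAt_integral_of_differentiableOn {α : Type*} [MeasurableSpace α] {μ : Measure α}
    {F : ℂ → α → G} {z₀ : ℂ} {ε : ℝ} (hε : 0 < ε) {bound : α → ℝ}
    (hmeas : ∀ z ∈ ball z₀ ε, AEStronglyMeasurable (F z) μ)
    (hdiff : ∀ᵐ a ∂μ, DifferentiableOn ℂ (fun z => F z a) (ball z₀ ε))
    (hb : ∀ᵐ a ∂μ, ∀ z ∈ ball z₀ ε, ‖F z a‖ ≤ bound a) (hbi : Integrable bound μ) :
    HasDerivAt (fun z => ∫ a, F z a ∂μ) (∫ a, deriv (fun z => F z a) z₀ ∂μ) z₀ := by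
  have hz₀ : z₀ ∈ ball z₀ ε := mem_ball_self hε
  have hs : ball z₀ (ε / 2) ∈ 𝓝 z₀ := ball_mem_nhds _ (by positivity)
  have hsub : ball z₀ (ε / 2) ⊆ ball z₀ ε := ball_subset_ball (by linarith)
  refine (hasDerivAt_integral_of_dominated_loc_of_deriv_le (𝕜 := ℂ)
    (F' := fun z a => deriv (fun z => F z a) z) (bound := fun a => bound a / (ε / 4)) hs
    (eventually_of_mem (ball_mem_nhds _ hε) hmeas) ?_ ?_ ?_ ?_ ?_).2
  · exact hbi.mono' (hmeas _ hz₀) (hb.mono fun a ha => ha _ hz₀)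
  -- The derivative is measurable in the integration variable as a limit of difference quotients
  -- along a sequence; the step `ε / 2 / (n + 1)` keeps the sequence inside the ball.
  · have hu : Tendsto (fun n : ℕ => z₀ + ((ε / 2 / (n + 1) : ℝ) : ℂ)) atTop (𝓝[≠] z₀) := by
      refine tendsto_nhdsWithin_iff.2 ⟨?_, Eventually.of_forall fun n => ?_⟩
      · have h1 : Tendsto (fun n : ℕ => (ε / 2) * (1 / ((n : ℝ) + 1))) atTop (𝓝 (ε / 2 * 0)) :=
          tendsto_one_div_add_atTop_nhds_zero_nat.const_mul _
        have h2 := (Complex.continuous_ofReal.tendsto _).comp h1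
        have h3 := h2.const_add z₀
        simpa [Function.comp_def, div_eq_mul_inv] using h3
      · have : (0 : ℝ) < ε / 2 / (n + 1) := by positivity
        simp only [mem_compl_iff, mem_singleton_iff, add_eq_left]
        exact_mod_cast this.ne'
    refine aestronglyMeasurable_of_tendsto_ae atTop
      (f := fun (n : ℕ) a => slope (fun z => F z a) z₀ (z₀ + ((ε / 2 / (n + 1) : ℝ) : ℂ))) ?_ ?_
    · intro n
      simp only [slope_def_module]
      refine ((hmeas _ ?_).sub (hmeas _ hz₀)).const_smul _
      rw [mem_ball_iff_norm, add_sub_cancel_left, Complex.norm_real,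
        Real.norm_of_nonneg (by positivity)]
      have : ε / 2 / (n + 1) ≤ ε / 2 := div_le_self (by positivity) (by simp)
      linarith
    · filter_upwards [hdiff] with a ha
      have := (ha.differentiableAt (ball_mem_nhds _ hε)).hasDerivAt
      exact (hasDerivAt_iff_tendsto_slope.1 this).comp hu
  · filter_upwards [hdiff, hb] with a ha hba z hz
    have hcl : closedBall z (ε / 4) ⊆ ball z₀ ε := by
      intro w hw
      rw [mem_ball] at hz ⊢
      rw [mem_closedBall] at hw
      linarith [dist_triangle w z z₀]
    refine Complex.norm_deriv_le_of_forall_mem_sphere_norm_le (by positivity) ?_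
      fun w hw => hba w (hcl (sphere_subset_closedBall hw))
    exact (ha.mono hcl).diffContOnCl_ball subset_rfl
  · exact hbi.div_const _
  · filter_upwards [hdiff] with a ha z hz
    exact (ha.differentiableAt (isOpen_ball.mem_nhds (hsub hz))).hasDerivAt

/-- The quotient by a closed subspace is a Banach space and the projection onto it commutes with the
integral, so the integral projects to zero. With `p` the graph of a closed operator, this is Hille's
theorem. -/
theorem integral_mem_of_isClosed [CompleteSpace G] {α : Type*} [MeasurableSpace α]
    {μ : Measure α} (p : Submodule ℂ G) (hp : IsClosed (p : Set G)) {f : α → G}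
    (hf : Integrable f μ) (h : ∀ᵐ a ∂μ, f a ∈ p) : ∫ a, f a ∂μ ∈ p := by
  have : IsClosed (p : Set G) := hp
  have : CompleteSpace (G ⧸ p) := inferInstance
  have h1 := p.mkQL.integral_comp_comm hf
  have h2 : ∫ a, p.mkQL (f a) ∂μ = 0 := by
    rw [integral_congr_ae (g := fun _ => (0 : G ⧸ p))]
    · simp
    · filter_upwards [h] with a ha
      simpa using ha
  rw [h2] at h1
  simpa using h1.symm

/-- Banach-Steinhaus bounds the family on a closed disc, and Cauchy's estimates for the orbits are
then uniform over the unit ball of `X`. Hence `F` is Lipschitz in operator norm near the centre, so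
its Cauchy integral exists in norm and is holomorphic; testing on vectors identifies it with `F`. -/
theorem differentiableOn_clm_of_strong {X Y : Type*} [NormedAddCommGroup X] [NormedSpace ℂ X]
    [CompleteSpace X] [NormedAddCommGroup Y] [NormedSpace ℂ Y] [CompleteSpace Y]
    {U : Set ℂ} (hU : IsOpen U) {F : ℂ → X →L[ℂ] Y}
    (h : ∀ x, DifferentiableOn ℂ (fun z => F z x) U) : DifferentiableOn ℂ F U := by
  intro z₀ hz₀
  obtain ⟨R, hR, hRU⟩ := nhds_basis_closedBall.mem_iff.1 (hU.mem_nhds hz₀)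
  have hcpt := isCompact_closedBall z₀ R
  obtain ⟨M, hM⟩ : ∃ M, ∀ z : closedBall z₀ R, ‖F z‖ ≤ M := by
    refine banach_steinhaus fun x => ?_
    obtain ⟨B, hB⟩ := hcpt.exists_bound_of_continuousOn ((h x).continuousOn.mono hRU)
    exact ⟨B, fun z => hB z z.2⟩
  have hM0 : 0 ≤ M := (norm_nonneg _).trans (hM ⟨z₀, mem_closedBall_self hR.le⟩)
  have hlip : ∀ z ∈ ball z₀ (R / 2), ∀ w ∈ ball z₀ (R / 2),
      ‖F w - F z‖ ≤ M / (R / 2) * ‖w - z‖ := by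
    intro z hz w hw
    refine ContinuousLinearMap.opNorm_le_bound _ (by positivity) fun x => ?_
    have : ‖F w x - F z x‖ ≤ M * ‖x‖ / (R / 2) * ‖w - z‖ := by
      refine (convex_ball z₀ (R / 2)).norm_image_sub_le_of_norm_deriv_le (𝕜 := ℂ)
        (f := fun z => F z x) (fun y hy => ?_) (fun y hy => ?_) hz hw
      · refine (h x).differentiableAt (hU.mem_nhds (hRU ?_))
        exact ball_subset_closedBall (ball_subset_ball (by linarith) hy)
      · have hcl : closedBall y (R / 2) ⊆ closedBall z₀ R := by
          intro v hv
          rw [mem_ball] at hy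
          rw [mem_closedBall] at hv ⊢
          linarith [dist_triangle v y z₀]
        refine Complex.norm_deriv_le_of_forall_mem_sphere_norm_le (by positivity)
          (((h x).mono (hcl.trans hRU)).diffContOnCl_ball subset_rfl) fun v hv => ?_
        exact (F v).le_of_opNorm_le (hM ⟨v, hcl (sphere_subset_closedBall hv)⟩) x
    calc ‖(F w - F z) x‖ = ‖F w x - F z x‖ := rfl
      _ ≤ M * ‖x‖ / (R / 2) * ‖w - z‖ := this
      _ = M / (R / 2) * ‖w - z‖ * ‖x‖ := by ring
  have hcont : ContinuousOn F (ball z₀ (R / 2)) := by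
    have : LipschitzOnWith (M / (R / 2)).toNNReal F (ball z₀ (R / 2)) := by
      refine LipschitzOnWith.of_dist_le_mul fun w hw z hz => ?_
      rw [dist_eq_norm, dist_eq_norm, Real.coe_toNNReal _ (by positivity)]
      exact hlip z hz w hw
    exact this.continuousOn
  set r : NNReal := (R / 4).toNNReal with hr
  have hr0 : 0 < r := by simpa [hr] using hR
  have hrR : (r : ℝ) = R / 4 := Real.coe_toNNReal _ (by positivity)
  have hsub : closedBall z₀ r ⊆ ball z₀ (R / 2) := closedBall_subset_ball (by rw [hrR]; linarith)
  have hci : CircleIntegrable F z₀ r :=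
    (hcont.mono (sphere_subset_closedBall.trans hsub)).circleIntegrable r.2
  have hps := (hasFPowerSeriesOn_cauchy_integral hci hr0).differentiableOn
  have hz : z₀ ∈ ball z₀ (r : ℝ) := mem_ball_self hr0
  have hball : eball z₀ (r : ENNReal) = ball z₀ (r : ℝ) := eball_coe
  rw [hball] at hps
  have hd := hps.differentiableAt (isOpen_ball.mem_nhds hz)
  refine (hd.congr_of_eventuallyEq ?_).differentiableWithinAt
  filter_upwards [isOpen_ball.mem_nhds hz] with w hw
  have hint : CircleIntegrable (fun z => (z - w)⁻¹ • F z) z₀ r := by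
    refine ContinuousOn.circleIntegrable r.2 (ContinuousOn.fun_smul ?_
      (hcont.mono (sphere_subset_closedBall.trans hsub)))
    refine ContinuousOn.inv₀ (by fun_prop) fun v hv h0 => ?_
    rw [sub_eq_zero] at h0
    rw [mem_sphere, h0] at hv
    exact (mem_ball.1 hw).ne hv
  ext x
  have h1 := Complex.two_pi_I_inv_smul_circleIntegral_sub_inv_smul_of_differentiable_on_off_countable
    (f := fun z => F z x) (c := z₀) (R := r) (w := w) countable_empty hw
    (((h x).continuousOn).mono (hsub.trans (ball_subset_closedBall.trans
      ((closedBall_subset_closedBall (by linarith)).trans hRU))))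
    (fun v hv => (h x).differentiableAt (hU.mem_nhds (hRU (closedBall_subset_closedBall
      (by rw [hrR]; linarith) (ball_subset_closedBall hv.1)))))
  rw [← h1, _root_.smul_apply]
  congr 1
  simp only [circleIntegral]
  have hint' := hint.out
  rw [ContinuousLinearMap.intervalIntegral_apply hint']
  rfl

/-- The family is only strongly measurable, so the operator is defined through the integrals of its
orbits instead of a Bochner integral in operator norm. -/
theorem exists_clm_integral {X Y : Type*} [NormedAddCommGroup X] [NormedSpace ℂ X]
    [NormedAddCommGroup Y] [NormedSpace ℂ Y] {α : Type*} [MeasurableSpace α]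
    {μ : Measure α} {Φ : α → X →L[ℂ] Y} {b : α → ℝ} (hb : Integrable b μ)
    (hm : ∀ x, AEStronglyMeasurable (fun a => Φ a x) μ) (h : ∀ᵐ a ∂μ, ‖Φ a‖ ≤ b a) :
    ∃ L : X →L[ℂ] Y, (∀ x, L x = ∫ a, Φ a x ∂μ) ∧ ‖L‖ ≤ ∫ a, b a ∂μ := by
  have hle : ∀ x, ∀ᵐ a ∂μ, ‖Φ a x‖ ≤ b a * ‖x‖ := fun x =>
    h.mono fun a ha => (Φ a).le_of_opNorm_le ha x
  have hint : ∀ x, Integrable (fun a => Φ a x) μ := fun x =>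
    (hb.mul_const ‖x‖).mono' (hm x) (hle x)
  have hb0 : 0 ≤ ∫ a, b a ∂μ :=
    integral_nonneg_of_ae (h.mono fun a ha => (norm_nonneg _).trans ha)
  let L₀ : X →ₗ[ℂ] Y :=
    { toFun := fun x => ∫ a, Φ a x ∂μ
      map_add' := fun x y => by
        simp only [map_add]
        exact integral_add (hint x) (hint y)
      map_smul' := fun r x => by
        simp only [map_smul, RingHom.id_apply]
        exact integral_smul r _ }
  have hL₀ : ∀ x, ‖L₀ x‖ ≤ (∫ a, b a ∂μ) * ‖x‖ := fun x => by
    rw [← integral_mul_const]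
    exact norm_integral_le_of_norm_le (hb.mul_const _) (hle x)
  exact ⟨L₀.mkContinuous _ hL₀, fun x => rfl, L₀.mkContinuous_norm_le hb0 _⟩

end Analysis

/-! ### Basic theory of C₀-semigroups and their generators -/

section C0

open MeasureTheory

variable {E : Type*} [NormedAddCommGroup E] [NormedSpace ℂ E]
  {T : ℝ → E →L[ℂ] E} {B : E →ₗ.[ℂ] E}

theorem IsC0Semigroup.tendsto_zero (hT : IsC0Semigroup T) (x : E) :
    Tendsto (fun t : ℝ => T t x) (𝓝[≥] 0) (𝓝 x) := by
  have h : insert (0 : ℝ) (Ioi 0) = Ici 0 := Ioi_insert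
  rw [← h, nhdsWithin_insert, tendsto_sup]
  refine ⟨?_, hT.strongCont x⟩
  rw [tendsto_pure_left]
  intro s hs
  simpa [hT.map_zero] using mem_of_mem_nhds hs

/-- If the norms were unbounded near `0`, some sequence `t n → 0` would have unbounded norms
although every orbit converges along it, against Banach-Steinhaus. The semigroup law propagates the
bound on `[0, δ]` to exponential growth. -/
theorem IsC0Semigroup.exists_bound [CompleteSpace E] (hT : IsC0Semigroup T) :
    ∃ M ω : ℝ, 1 ≤ M ∧ 0 ≤ ω ∧ ∀ t, 0 ≤ t → ‖T t‖ ≤ M * Real.exp (ω * t) := by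
  obtain ⟨δ, hδ, M, hM1, hM⟩ : ∃ δ > 0, ∃ M : ℝ, 1 ≤ M ∧ ∀ t, 0 ≤ t → t ≤ δ → ‖T t‖ ≤ M := by
    by_contra! hcon
    have h1 : ∀ n : ℕ, ∃ t, 0 ≤ t ∧ t ≤ 1 / ((n : ℝ) + 1) ∧ (n : ℝ) + 1 < ‖T t‖ := fun n =>
      hcon _ (by positivity) _ (by simp)
    choose t ht0 ht hn using h1
    have hlim : Tendsto t atTop (𝓝[≥] 0) :=
      tendsto_nhdsWithin_iff.2 ⟨squeeze_zero ht0 ht tendsto_one_div_add_atTop_nhds_zero_nat,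
        Eventually.of_forall ht0⟩
    obtain ⟨K, hK⟩ := banach_steinhaus (g := fun n => T (t n)) fun x => by
      obtain ⟨c, hc⟩ := (((hT.tendsto_zero x).comp hlim).norm).bddAbove_range
      exact ⟨c, fun n => hc ⟨n, rfl⟩⟩
    obtain ⟨n, hnK⟩ := exists_nat_gt K
    linarith [hK n, hn n]
  have hpow : ∀ n : ℕ, ∀ t, 0 ≤ t → t ≤ (n + 1) * δ → ‖T t‖ ≤ M ^ (n + 1) := by
    intro n
    induction n with
    | zero => intro t h0 h1; simpa using hM t h0 (by simpa using h1)
    | succ n ih =>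
      intro t h0 h1
      by_cases htδ : t ≤ δ
      · exact (hM t h0 htδ).trans (le_self_pow₀ hM1 (by omega))
      · push Not at htδ
        have : T t = T δ * T (t - δ) := by
          rw [← hT.map_add _ _ hδ.le (by linarith), add_sub_cancel]
        rw [this, pow_succ']
        refine (norm_mul_le _ _).trans (mul_le_mul (hM δ hδ.le le_rfl)
          (ih _ (by linarith) ?_) (norm_nonneg _) (by linarith))
        push_cast at h1
        linarith
  -- With this rate, `exp (ω t) = M ^ (t / δ)`, which dominates `M` to the number of full steps of
  -- length `δ`; `1 ≤ M` makes the rate nonnegative.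
  refine ⟨M, Real.log M / δ, hM1, div_nonneg (Real.log_nonneg hM1) hδ.le, fun t ht => ?_⟩
  have hfl := Nat.lt_floor_add_one (t / δ)
  have hfl' := Nat.floor_le (div_nonneg ht hδ.le)
  refine (hpow ⌊t / δ⌋₊ t ht ?_).trans ?_
  · rw [div_lt_iff₀ hδ] at hfl
    exact hfl.le
  · rw [pow_succ']
    gcongr
    rw [← Real.rpow_natCast, Real.rpow_def_of_pos (by linarith)]
    refine Real.exp_le_exp.2 ?_
    rw [div_mul_eq_mul_div, mul_div_assoc]
    exact mul_le_mul_of_nonneg_left hfl' (Real.log_nonneg hM1)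

theorem IsSemigroupGenerator.hasDerivWithinAt (hT : IsC0Semigroup T)
    (hB : IsSemigroupGenerator B T) {x y : E} (h : (x, y) ∈ B.graph) {t : ℝ} (ht : 0 ≤ t) :
    HasDerivWithinAt (fun t => T t x) (T t y) (Ioi t) t := by
  rw [hasDerivWithinAt_iff_tendsto_slope' (by simp)]
  have hs : Tendsto (fun s : ℝ => s - t) (𝓝[>] t) (𝓝[>] 0) := by
    refine tendsto_nhdsWithin_iff.2 ⟨?_, ?_⟩
    · have : Continuous fun s : ℝ => s - t := by fun_prop
      simpa using (this.tendsto t).mono_left nhdsWithin_le_nhds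
    · filter_upwards [self_mem_nhdsWithin] with s hs
      simpa using hs
  refine (((T t).continuous.tendsto y).comp (((hB x y).1 h).comp hs)).congr' ?_
  filter_upwards [self_mem_nhdsWithin] with s hs
  rw [mem_Ioi] at hs
  simp only [Function.comp, slope_def_module]
  rw [ContinuousLinearMap.map_smul_of_tower, map_sub, ← mul_apply_eq_comp,
    ← hT.map_add _ _ ht (by linarith), add_sub_cancel]

theorem IsSemigroupGenerator.map_mem_graph (hT : IsC0Semigroup T)
    (hB : IsSemigroupGenerator B T) {x y : E} (h : (x, y) ∈ B.graph) {t : ℝ} (ht : 0 ≤ t) :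
    (T t x, T t y) ∈ B.graph := by
  rw [hB]
  refine (((T t).continuous.tendsto y).comp ((hB x y).1 h)).congr' ?_
  filter_upwards [self_mem_nhdsWithin] with s hs
  rw [mem_Ioi] at hs
  simp only [Function.comp]
  rw [ContinuousLinearMap.map_smul_of_tower, map_sub, ← mul_apply_eq_comp,
    ← mul_apply_eq_comp, ← hT.map_add _ _ ht hs.le, ← hT.map_add _ _ hs.le ht,
    add_comm]

variable [CompleteSpace E]

theorem IsC0Semigroup.exists_bound_Icc (hT : IsC0Semigroup T) (τ : ℝ) :
    ∃ K : ℝ, 0 ≤ K ∧ ∀ t, 0 ≤ t → t ≤ τ → ‖T t‖ ≤ K := by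
  obtain ⟨M, ω, hM, hω, h⟩ := hT.exists_bound
  refine ⟨M * Real.exp (ω * τ), by positivity, fun t h0 h1 => (h t h0).trans ?_⟩
  gcongr

theorem IsC0Semigroup.continuousOn (hT : IsC0Semigroup T) (x : E) :
    ContinuousOn (fun t : ℝ => T t x) (Ici 0) := by
  intro t ht
  obtain ⟨K, hK0, hK⟩ := hT.exists_bound_Icc (t + 1)
  have habs : Tendsto (fun s : ℝ => |s - t|) (𝓝[Ici 0] t) (𝓝[≥] 0) := by
    refine tendsto_nhdsWithin_iff.2 ⟨?_, Eventually.of_forall fun s => abs_nonneg (s - t)⟩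
    have : Continuous fun s : ℝ => |s - t| := by fun_prop
    simpa using (this.tendsto t).mono_left nhdsWithin_le_nhds
  have hlim := (((hT.tendsto_zero x).comp habs).sub_const x).norm.const_mul K
  simp only [sub_self, norm_zero, mul_zero] at hlim
  refine tendsto_iff_norm_sub_tendsto_zero.2 (squeeze_zero' (Eventually.of_forall fun _ =>
    norm_nonneg _) ?_ hlim)
  have hev : ∀ᶠ s in 𝓝[Ici 0] t, s < t + 1 :=
    eventually_of_mem (mem_nhdsWithin_of_mem_nhds (Iio_mem_nhds (by linarith))) fun s hs => hs
  filter_upwards [hev, self_mem_nhdsWithin] with s hs hs0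
  rw [mem_Ici] at ht hs0
  simp only [Function.comp]
  rcases le_total t s with hts | hts
  · have : T s x - T t x = T t (T |s - t| x - x) := by
      rw [map_sub, ← mul_apply_eq_comp, ← hT.map_add _ _ ht (abs_nonneg _),
        abs_of_nonneg (by linarith), add_sub_cancel]
    rw [this]
    exact (T t).le_of_opNorm_le (hK t ht (by linarith)) _
  · have : T s x - T t x = -(T s (T |s - t| x - x)) := by
      rw [map_sub, ← mul_apply_eq_comp, ← hT.map_add _ _ hs0 (abs_nonneg _),
        abs_of_nonpos (by linarith), neg_sub, neg_sub, add_sub_cancel]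
    rw [this, norm_neg]
    exact (T s).le_of_opNorm_le (hK s hs0 (by linarith)) _

theorem IsC0Semigroup.intervalIntegrable (hT : IsC0Semigroup T) (x : E) {a b : ℝ} (ha : 0 ≤ a)
    (hb : 0 ≤ b) : IntervalIntegrable (fun t => T t x) volume a b :=
  ((hT.continuousOn x).mono fun _ hs => (le_min ha hb).trans hs.1).intervalIntegrable

theorem tendsto_average_right {f : ℝ → E} (hf : ContinuousOn f (Ici 0)) :
    Tendsto (fun t : ℝ => (t⁻¹ : ℝ) • ∫ s in (0 : ℝ)..t, f s) (𝓝[>] 0) (𝓝 (f 0)) := by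
  have hmeas : StronglyMeasurableAtFilter f (𝓝[>] 0) volume :=
    ⟨Ioi 0, self_mem_nhdsWithin,
      (hf.mono Ioi_subset_Ici_self).aestronglyMeasurable measurableSet_Ioi⟩
  have h : HasDerivWithinAt (fun u => ∫ s in (0 : ℝ)..u, f s) (f 0) (Ici 0) 0 :=
    intervalIntegral.integral_hasDerivWithinAt_right (by simp) (s := Ici 0) (t := Ioi 0)
      hmeas ((hf 0 self_mem_Ici).mono Ioi_subset_Ici_self)
  have h2 := hasDerivWithinAt_iff_tendsto_slope.1 h
  rw [Ici_sdiff_left] at h2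
  refine h2.congr fun t => ?_
  simp [slope_def_module]

/-- The integrated form of the generator relation involves only bounded operators, so it passes to
limits. This is the source of closedness of the generator. -/
theorem IsSemigroupGenerator.mem_graph_iff (hT : IsC0Semigroup T)
    (hB : IsSemigroupGenerator B T) {x y : E} : (x, y) ∈ B.graph ↔
      ∀ t, 0 ≤ t → T t x - x = ∫ s in (0 : ℝ)..t, T s y := by
  constructor
  · intro h t ht
    have := intervalIntegral.integral_eq_sub_of_hasDeriv_right_of_le ht
      ((hT.continuousOn x).mono Icc_subset_Ici_self)
      (fun s hs => hB.hasDerivWithinAt hT h hs.1.le) (hT.intervalIntegrable y le_rfl ht)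
    rw [this, hT.map_zero]
    rfl
  · intro h
    rw [hB x y]
    have h1 := tendsto_average_right (hT.continuousOn y)
    rw [hT.map_zero] at h1
    refine h1.congr' ?_
    filter_upwards [self_mem_nhdsWithin] with t ht
    rw [h t (le_of_lt ht)]

/-- By the integrated criterion, the claim is that splitting `∫₀^(r+t)` at `r` or at `t` gives the
same value. -/
theorem IsSemigroupGenerator.integral_mem_graph (hT : IsC0Semigroup T)
    (hB : IsSemigroupGenerator B T) (x : E) {t : ℝ} (ht : 0 ≤ t) :
    (∫ s in (0 : ℝ)..t, T s x, T t x - x) ∈ B.graph := by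
  rw [hB.mem_graph_iff hT]
  intro r hr
  have hi := fun {a b : ℝ} (ha : 0 ≤ a) (hb : 0 ≤ b) => hT.intervalIntegrable x ha hb
  have shift : ∀ u v : ℝ, 0 ≤ u → 0 ≤ v →
      T u (∫ s in (0 : ℝ)..v, T s x) = ∫ s in u..(u + v), T s x := by
    intro u v hu hv
    rw [← ContinuousLinearMap.intervalIntegral_comp_comm _ (hi le_rfl hv)]
    have : ∫ s in u..(u + v), T s x = ∫ s in (0 : ℝ)..v, T (u + s) x := by
      rw [intervalIntegral.integral_comp_add_left (fun s => T s x)]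
      simp
    rw [this]
    refine intervalIntegral.integral_congr fun s hs => ?_
    rw [uIcc_of_le hv] at hs
    simp only [hT.map_add _ _ hu hs.1, mul_apply_eq_comp]
  have hcomm : ∫ s in (0 : ℝ)..r, T s (T t x - x) =
      T t (∫ s in (0 : ℝ)..r, T s x) - ∫ s in (0 : ℝ)..r, T s x := by
    rw [← ContinuousLinearMap.intervalIntegral_comp_comm _ (hi le_rfl hr),
      ← intervalIntegral.integral_sub _ (hi le_rfl hr)]
    · refine intervalIntegral.integral_congr fun s hs => ?_
      rw [uIcc_of_le hr] at hs
      simp only [map_sub]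
      rw [← mul_apply_eq_comp, ← mul_apply_eq_comp,
        ← hT.map_add _ _ hs.1 ht, ← hT.map_add _ _ ht hs.1, add_comm]
    · refine (((T t).continuous.comp_continuousOn (hT.continuousOn x)).mono
        fun s hs => ?_).intervalIntegrable
      rw [uIcc_of_le hr] at hs
      exact hs.1
  have h1 := intervalIntegral.integral_add_adjacent_intervals (hi le_rfl hr)
    (hi hr (add_nonneg hr ht))
  have h2 := intervalIntegral.integral_add_adjacent_intervals (hi le_rfl ht)
    (hi ht (add_nonneg ht hr))
  rw [hcomm, shift r t hr ht, shift t r ht hr, sub_eq_sub_iff_add_eq_add, add_comm,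
    h1, add_comm r t, ← h2, add_comm]

theorem IsSemigroupGenerator.isClosed_graph (hT : IsC0Semigroup T)
    (hB : IsSemigroupGenerator B T) : IsClosed (B.graph : Set (E × E)) := by
  have : (B.graph : Set (E × E)) =
      ⋂ t ∈ Ici (0 : ℝ), {p | T t p.1 - p.1 = ∫ s in (0 : ℝ)..t, T s p.2} := by
    ext ⟨x, y⟩
    simp only [SetLike.mem_coe, mem_iInter, mem_ofPred_eq, mem_Ici]
    exact hB.mem_graph_iff hT
  rw [this]
  refine isClosed_biInter fun t ht => ?_
  rw [mem_Ici] at ht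
  obtain ⟨K, hK0, hK⟩ := hT.exists_bound_Icc t
  obtain ⟨L, hL, -⟩ := exists_clm_integral (μ := volume.restrict (Ioc 0 t)) (Φ := T)
    (b := fun _ => K) (integrable_const K)
    (fun x => ((hT.continuousOn x).mono fun s hs => hs.1.le).aestronglyMeasurable
      measurableSet_Ioc)
    ((ae_restrict_iff' measurableSet_Ioc).2 (Eventually.of_forall fun s hs => hK s hs.1.le hs.2))
  have hL' : ∀ x, ∫ s in (0 : ℝ)..t, T s x = L x := fun x => by
    rw [hL, intervalIntegral.integral_of_le ht]
  simp only [hL']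
  exact isClosed_eq (by fun_prop) (by fun_prop)

end C0

/-! ### Scale-invariant cones exhausting the right half-plane -/

section Cone

open Metric

/-- The closed convex cone `c ‖z‖ ≤ Re z` without its vertex. -/
def cone (c : ℝ) : Set ℂ := {z | 0 < z.re ∧ c * ‖z‖ ≤ z.re}

theorem isOpen_re_pos : IsOpen {z : ℂ | 0 < z.re} :=
  isOpen_lt continuous_const Complex.continuous_re

theorem sector_pi_div_two : sector (Real.pi / 2) = {z : ℂ | 0 < z.re} := by
  ext z
  simp only [sector, mem_ofPred_eq, Complex.abs_arg_lt_pi_div_two_iff]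
  constructor
  · rintro ⟨h0, h | h⟩
    · exact h
    · exact absurd h h0
  · intro h
    exact ⟨fun h0 => by simp [h0] at h, Or.inl h⟩

theorem sector_subset_cone {δ : ℝ} (hδ : δ < Real.pi / 2) :
    sector δ ⊆ cone (Real.cos δ) := by
  rintro z ⟨h0, h⟩
  have h1 : Real.cos δ ≤ Real.cos z.arg := by
    rw [← Real.cos_abs z.arg]
    exact Real.cos_le_cos_of_nonneg_of_le_pi (abs_nonneg _) (by linarith [Real.pi_pos]) h.le
  refine ⟨?_, ?_⟩
  · have : |z.arg| < Real.pi / 2 := h.trans hδ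
    exact (Complex.abs_arg_lt_pi_div_two_iff.1 this).resolve_right h0
  · rw [← Complex.norm_mul_cos_arg, mul_comm]
    exact mul_le_mul_of_nonneg_left h1 (norm_nonneg _)

theorem mul_mem_cone {c r : ℝ} {z : ℂ} (hz : z ∈ cone c) (hr : 0 < r) : (r : ℂ) * z ∈ cone c := by
  obtain ⟨h1, h2⟩ := hz
  refine ⟨by simpa using mul_pos hr h1, ?_⟩
  rw [norm_mul, Complex.norm_real, Real.norm_of_nonneg hr.le, Complex.re_ofReal_mul]
  nlinarith

theorem ofReal_mem_cone {t : ℝ} (ht : 0 < t) : (t : ℂ) ∈ cone 1 := by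
  refine ⟨by simpa using ht, ?_⟩
  rw [Complex.norm_real, Real.norm_of_nonneg ht.le]
  simp

theorem norm_ofReal_mul_le {r : ℝ} (hr0 : 0 ≤ r) (hr1 : r ≤ 1) (z : ℂ) : ‖(r : ℂ) * z‖ ≤ ‖z‖ := by
  rw [norm_mul, Complex.norm_real, Real.norm_of_nonneg hr0]
  exact mul_le_of_le_one_left (norm_nonneg _) hr1

/-- Differentiability is local, and this places a neighbourhood of any point of the half-plane
inside one cone, away from `0` and `∞`, where the uniform bounds apply. -/
theorem exists_ball_subset_cone {z₀ : ℂ} (h : 0 < z₀.re) :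
    ∃ ε c R r : ℝ, 0 < ε ∧ 0 < c ∧ 0 < R ∧ 0 < r ∧
      ∀ z ∈ ball z₀ ε, z ∈ cone c ∧ ‖z‖ ≤ R ∧ r ≤ ‖z‖ := by
  have hz₀ : 0 < ‖z₀‖ := h.trans_le (Complex.re_le_norm z₀)
  -- On the ball of radius `z₀.re / 2` the real part is at least `z₀.re / 2` and the norm at most `2
  -- * ‖z₀‖`; their quotient is the aperture constant.
  refine ⟨z₀.re / 2, z₀.re / (4 * ‖z₀‖), 2 * ‖z₀‖, z₀.re / 2, by positivity, by positivity,
    by positivity, by positivity, fun z hz => ?_⟩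
  rw [mem_ball_iff_norm] at hz
  have h1 := (Complex.abs_re_le_norm (z - z₀)).trans hz.le
  rw [Complex.sub_re, abs_le] at h1
  have h2 : ‖z‖ ≤ ‖z₀‖ + ‖z - z₀‖ := norm_le_norm_add_norm_sub' z z₀
  have h3 : z₀.re ≤ ‖z₀‖ := Complex.re_le_norm z₀
  have h4 : z.re ≤ ‖z‖ := Complex.re_le_norm z
  refine ⟨⟨by linarith, ?_⟩, by linarith, by linarith⟩
  rw [div_mul_eq_mul_div, div_le_iff₀ (by positivity)]
  nlinarith

end Cone

/-! ### The Dyson-Phillips series along complex segments -/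

section Dyson

open MeasureTheory Metric Nat

variable {𝔸 : Type*} [NormedRing 𝔸] [NormedAlgebra ℂ 𝔸]

/-- The terms of the Dyson-Phillips series of the perturbation of `T₀` by `P`. -/
noncomputable def dyson (T₀ : ℂ → 𝔸) (P : 𝔸) : ℕ → ℂ → 𝔸
  | 0 => T₀
  | n + 1 => fun z => z • ∫ r in Ioo (0 : ℝ) 1,
      T₀ (((1 - r : ℝ) : ℂ) * z) * P * dyson T₀ P n ((r : ℂ) * z)

/-- The sum of the Dyson-Phillips series. -/
noncomputable def dysonSum (T₀ : ℂ → 𝔸) (P : 𝔸) (z : ℂ) : 𝔸 := ∑' n, dyson T₀ P n z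

variable {T₀ : ℂ → 𝔸} {P : 𝔸}

/-- The convolution runs along the segment from `0` to `z`, which stays in the cone, so the
classical induction works with `‖z‖` in place of time. The integral of `r ^ n` over the unit
interval supplies the factor `1 / (n + 1)` that builds the factorial. -/
theorem norm_dyson_le {c R M : ℝ} (hM0 : 0 ≤ M) (hM : ∀ z ∈ cone c, ‖z‖ ≤ R → ‖T₀ z‖ ≤ M) (n : ℕ) :
    ∀ z ∈ cone c, ‖z‖ ≤ R → ‖dyson T₀ P n z‖ ≤ M * ((M * ‖P‖ * ‖z‖) ^ n / n !) := by
  induction n with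
  | zero => intro z hz hR; simpa [dyson] using hM z hz hR
  | succ n ih =>
    intro z hz hR
    have hint : ∫ r in Ioo (0 : ℝ) 1, r ^ n = 1 / ((n : ℝ) + 1) := by
      rw [← integral_Ioc_eq_integral_Ioo, ← intervalIntegral.integral_of_le zero_le_one,
        integral_pow]
      simp
    have hle : ‖∫ r in Ioo (0 : ℝ) 1,
        T₀ (((1 - r : ℝ) : ℂ) * z) * P * dyson T₀ P n ((r : ℂ) * z)‖ ≤
        ∫ r in Ioo (0 : ℝ) 1, M * ‖P‖ * (M * ((M * ‖P‖ * ‖z‖) ^ n / n !)) * r ^ n := by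
      refine norm_integral_le_of_norm_le ?_ ?_
      · exact ((by fun_prop : Continuous fun r : ℝ =>
          M * ‖P‖ * (M * ((M * ‖P‖ * ‖z‖) ^ n / n !)) * r ^ n).integrableOn_Icc (a := 0)
          (b := 1)).mono_set Ioo_subset_Icc_self
      · refine (ae_restrict_iff' measurableSet_Ioo).2 (Eventually.of_forall fun r hr => ?_)
        have hr1 : 0 < 1 - r := by linarith [hr.2]
        have h1 := hM _ (mul_mem_cone hz hr1)
          ((norm_ofReal_mul_le hr1.le (by linarith [hr.1]) z).trans hR)
        have h2 := ih _ (mul_mem_cone hz hr.1) ((norm_ofReal_mul_le hr.1.le hr.2.le z).trans hR)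
        rw [norm_mul (r : ℂ), Complex.norm_real, Real.norm_of_nonneg hr.1.le] at h2
        calc _ ≤ ‖T₀ (((1 - r : ℝ) : ℂ) * z)‖ * ‖P‖ * ‖dyson T₀ P n ((r : ℂ) * z)‖ :=
              (norm_mul_le _ _).trans (mul_le_mul_of_nonneg_right (norm_mul_le _ _)
                (norm_nonneg _))
          _ ≤ M * ‖P‖ * (M * ((M * ‖P‖ * (r * ‖z‖)) ^ n / n !)) := by gcongr
          _ = _ := by ring
    rw [integral_const_mul, hint] at hle
    simp only [dyson, norm_smul]
    refine (mul_le_mul_of_nonneg_left hle (norm_nonneg z)).trans (le_of_eq ?_)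
    rw [Nat.factorial_succ]
    push_cast
    field_simp
    ring

theorem continuousOn_dyson_integrand {F : ℂ → 𝔸} (hT : DifferentiableOn ℂ T₀ {z | 0 < z.re})
    (hF : DifferentiableOn ℂ F {z | 0 < z.re}) {z : ℂ} (hz : 0 < z.re) :
    ContinuousOn (fun r : ℝ => T₀ (((1 - r : ℝ) : ℂ) * z) * P * F ((r : ℂ) * z)) (Ioo 0 1) := by
  refine ContinuousOn.mul (ContinuousOn.mul ?_ continuousOn_const) ?_
  · refine hT.continuousOn.comp (by fun_prop) fun r hr => ?_
    simp only [mem_ofPred_eq, Complex.re_ofReal_mul]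
    exact mul_pos (by linarith [hr.2]) hz
  · refine hF.continuousOn.comp (by fun_prop) fun r hr => ?_
    simp only [mem_ofPred_eq, Complex.re_ofReal_mul]
    exact mul_pos hr.1 hz

theorem norm_dyson_integrand_le {𝔸 : Type*} [NormedRing 𝔸] {T₀ F : ℂ → 𝔸} {P : 𝔸} {c R M N : ℝ}
    (hM : ∀ z ∈ cone c, ‖z‖ ≤ R → ‖T₀ z‖ ≤ M) (hN : ∀ z ∈ cone c, ‖z‖ ≤ R → ‖F z‖ ≤ N)
    {z : ℂ} (hz : z ∈ cone c) (hR : ‖z‖ ≤ R) {r : ℝ} (hr : r ∈ Ioo (0 : ℝ) 1) :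
    ‖T₀ (((1 - r : ℝ) : ℂ) * z) * P * F ((r : ℂ) * z)‖ ≤ M * ‖P‖ * N := by
  have hr1 : 0 < 1 - r := by linarith [hr.2]
  have h1 := hM _ (mul_mem_cone hz hr1)
    ((norm_ofReal_mul_le hr1.le (by linarith [hr.1]) z).trans hR)
  have h2 := hN _ (mul_mem_cone hz hr.1) ((norm_ofReal_mul_le hr.1.le hr.2.le z).trans hR)
  have hM0 := (norm_nonneg _).trans h1
  calc _ ≤ ‖T₀ (((1 - r : ℝ) : ℂ) * z)‖ * ‖P‖ * ‖F ((r : ℂ) * z)‖ :=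
        (norm_mul_le _ _).trans (mul_le_mul_of_nonneg_right (norm_mul_le _ _) (norm_nonneg _))
    _ ≤ _ := by gcongr

theorem norm_dyson_le' {c R M : ℝ} (hM0 : 0 ≤ M) (hM : ∀ z ∈ cone c, ‖z‖ ≤ R → ‖T₀ z‖ ≤ M) (n : ℕ) :
    ∀ z ∈ cone c, ‖z‖ ≤ R → ‖dyson T₀ P n z‖ ≤ M * ((M * ‖P‖ * R) ^ n / n !) := by
  intro z hz hR
  refine (norm_dyson_le hM0 hM n z hz hR).trans ?_
  gcongr

theorem summable_dyson_bound (M a : ℝ) : Summable fun n : ℕ => M * (a ^ n / n !) :=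
  (Real.summable_pow_div_factorial a).mul_left M

theorem norm_dysonSum_le {c R M : ℝ} (hM0 : 0 ≤ M) (hM : ∀ z ∈ cone c, ‖z‖ ≤ R → ‖T₀ z‖ ≤ M)
    {z : ℂ} (hz : z ∈ cone c) (hR : ‖z‖ ≤ R) :
    ‖dysonSum T₀ P z‖ ≤ ∑' n : ℕ, M * ((M * ‖P‖ * R) ^ n / n !) := by
  refine tsum_of_norm_bounded (summable_dyson_bound M (M * ‖P‖ * R)).hasSum fun n => ?_
  exact norm_dyson_le' hM0 hM n z hz hR

/-- After the segment is rescaled, the domain of integration no longer depends on `z`, and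
holomorphy passes through the integral. -/
theorem differentiableOn_dyson (hT : DifferentiableOn ℂ T₀ {z | 0 < z.re})
    (hb : ∀ c R : ℝ, 0 < c → ∃ M, 0 ≤ M ∧ ∀ z ∈ cone c, ‖z‖ ≤ R → ‖T₀ z‖ ≤ M) (n : ℕ) :
    DifferentiableOn ℂ (dyson T₀ P n) {z | 0 < z.re} := by
  induction n with
  | zero => exact hT
  | succ n ih =>
    intro z₀ hz₀
    obtain ⟨ε, c, R, r₀, hε, hc, hR, -, hball⟩ := exists_ball_subset_cone hz₀
    obtain ⟨M, hM0, hM⟩ := hb c R hc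
    have key := hasDerivAt_integral_of_differentiableOn (μ := volume.restrict (Ioo (0 : ℝ) 1))
      (F := fun z r => T₀ (((1 - r : ℝ) : ℂ) * z) * P * dyson T₀ P n ((r : ℂ) * z)) (z₀ := z₀) hε
      (bound := fun _ => M * ‖P‖ * (M * ((M * ‖P‖ * R) ^ n / n !))) (fun z hz => ?_) ?_ ?_
      (integrable_const _)
    · exact (differentiableAt_id.smul key.differentiableAt).differentiableWithinAt
    · exact (continuousOn_dyson_integrand hT ih (hball z hz).1.1).aestronglyMeasurable
        measurableSet_Ioo
    · refine (ae_restrict_iff' measurableSet_Ioo).2 (Eventually.of_forall fun r hr => ?_)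
      refine DifferentiableOn.mul (DifferentiableOn.mul ?_ (differentiableOn_const _)) ?_
      · refine hT.comp (by fun_prop) fun z hz => ?_
        simp only [mem_ofPred_eq, Complex.re_ofReal_mul]
        exact mul_pos (by linarith [hr.2]) (hball z hz).1.1
      · refine ih.comp (by fun_prop) fun z hz => ?_
        simp only [mem_ofPred_eq, Complex.re_ofReal_mul]
        exact mul_pos hr.1 (hball z hz).1.1
    · refine (ae_restrict_iff' measurableSet_Ioo).2 (Eventually.of_forall fun r hr z hz => ?_)
      obtain ⟨hz, hzR, -⟩ := hball z hz
      exact norm_dyson_integrand_le hM (norm_dyson_le' hM0 hM n) hz hzR hr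

variable [CompleteSpace 𝔸]

theorem hasSum_dyson {c R M : ℝ} (hM0 : 0 ≤ M) (hM : ∀ z ∈ cone c, ‖z‖ ≤ R → ‖T₀ z‖ ≤ M)
    {z : ℂ} (hz : z ∈ cone c) (hR : ‖z‖ ≤ R) :
    HasSum (fun n => dyson T₀ P n z) (dysonSum T₀ P z) :=
  (Summable.of_norm_bounded (summable_dyson_bound M (M * ‖P‖ * ‖z‖))
    fun n => norm_dyson_le hM0 hM n z hz hR).hasSum

theorem differentiableOn_dysonSum (hT : DifferentiableOn ℂ T₀ {z | 0 < z.re})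
    (hb : ∀ c R : ℝ, 0 < c → ∃ M, 0 ≤ M ∧ ∀ z ∈ cone c, ‖z‖ ≤ R → ‖T₀ z‖ ≤ M) :
    DifferentiableOn ℂ (dysonSum T₀ P) {z | 0 < z.re} := by
  intro z₀ hz₀
  obtain ⟨ε, c, R, r₀, hε, hc, hR, -, hball⟩ := exists_ball_subset_cone hz₀
  obtain ⟨M, hM0, hM⟩ := hb c R hc
  have := Complex.differentiableOn_tsum_of_summable_norm (F := dyson T₀ P) (U := ball z₀ ε)
    (summable_dyson_bound M (M * ‖P‖ * R))
    (fun n => (differentiableOn_dyson hT hb n).mono fun z hz => (hball z hz).1.1) isOpen_ball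
    fun n z hz => by
      obtain ⟨hz, hzR, -⟩ := hball z hz
      exact norm_dyson_le' hM0 hM n z hz hzR
  exact (this.differentiableAt (ball_mem_nhds _ hε)).differentiableWithinAt

/-- This is the variation of constants formula: the recursion is summed over `n`, the factorial
bounds allowing the sum to move inside the integral. -/
theorem dysonSum_eq (hT : DifferentiableOn ℂ T₀ {z | 0 < z.re})
    (hb : ∀ c R : ℝ, 0 < c → ∃ M, 0 ≤ M ∧ ∀ z ∈ cone c, ‖z‖ ≤ R → ‖T₀ z‖ ≤ M)
    {z : ℂ} (hz : 0 < z.re) :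
    dysonSum T₀ P z = T₀ z + z • ∫ r in Ioo (0 : ℝ) 1,
      T₀ (((1 - r : ℝ) : ℂ) * z) * P * dysonSum T₀ P ((r : ℂ) * z) := by
  obtain ⟨ε, c, R, r₀, hε, hc, hR, -, hball⟩ := exists_ball_subset_cone hz
  obtain ⟨M, hM0, hM⟩ := hb c R hc
  obtain ⟨hzc, hzR, -⟩ := hball z (mem_ball_self hε)
  have hmeas : ∀ n, AEStronglyMeasurable
      (fun r : ℝ => T₀ (((1 - r : ℝ) : ℂ) * z) * P * dyson T₀ P n ((r : ℂ) * z))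
      (volume.restrict (Ioo (0 : ℝ) 1)) := fun n =>
    (continuousOn_dyson_integrand hT (differentiableOn_dyson hT hb n)
      hz).aestronglyMeasurable measurableSet_Ioo
  have hbound : ∀ n, ∀ᵐ r : ℝ ∂(volume.restrict (Ioo (0 : ℝ) 1)),
      ‖T₀ (((1 - r : ℝ) : ℂ) * z) * P * dyson T₀ P n ((r : ℂ) * z)‖ ≤
        M * ‖P‖ * (M * ((M * ‖P‖ * R) ^ n / n !)) := fun n =>
    (ae_restrict_iff' measurableSet_Ioo).2 (Eventually.of_forall fun r hr =>
      norm_dyson_integrand_le hM (norm_dyson_le' hM0 hM n) hzc hzR hr)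
  have hlim : ∀ᵐ r : ℝ ∂(volume.restrict (Ioo (0 : ℝ) 1)),
      HasSum (fun n => T₀ (((1 - r : ℝ) : ℂ) * z) * P * dyson T₀ P n ((r : ℂ) * z))
        (T₀ (((1 - r : ℝ) : ℂ) * z) * P * dysonSum T₀ P ((r : ℂ) * z)) :=
    (ae_restrict_iff' measurableSet_Ioo).2 (Eventually.of_forall fun r hr =>
      (hasSum_dyson hM0 hM (mul_mem_cone hzc hr.1)
        ((norm_ofReal_mul_le hr.1.le hr.2.le z).trans hzR)).mul_left _)
  have hsum := hasSum_integral_of_dominated_convergence _ hmeas hbound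
    (Eventually.of_forall fun r => (summable_dyson_bound M (M * ‖P‖ * R)).mul_left _)
    (integrable_const _) hlim
  have h1 := hasSum_dyson (P := P) hM0 hM hzc hzR
  have h2 : HasSum (fun n => dyson T₀ P (n + 1) z) _ := hsum.const_smul z
  rw [← h1.tsum_eq, h1.summable.tsum_eq_zero_add, h2.tsum_eq]
  rfl

end Dyson

/-! ### Volterra equations and the semigroup law of the perturbed family -/

section Volterra

open MeasureTheory Metric Nat

theorem intervalIntegrable_of_continuousOn_Ioo {G : Type*} [NormedAddCommGroup G]
    {f : ℝ → G} {a b N : ℝ} (hab : a ≤ b) (hf : ContinuousOn f (Ioo a b))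
    (hN : ∀ s ∈ Ioo a b, ‖f s‖ ≤ N) : IntervalIntegrable f volume a b := by
  rw [intervalIntegrable_iff_integrableOn_Ioo_of_le hab]
  exact (integrable_const N).mono' (hf.aestronglyMeasurable measurableSet_Ioo)
    ((ae_restrict_iff' measurableSet_Ioo).2 (Eventually.of_forall hN))

variable {𝔸 : Type*} [NormedRing 𝔸] [NormedAlgebra ℂ 𝔸]

theorem norm_volterra_kernel_le {𝔸 : Type*} [NormedRing 𝔸] {a F : ℝ → 𝔸} {P : 𝔸} {τ K N t s : ℝ}
    (ha : ∀ t, 0 < t → t ≤ τ → ‖a t‖ ≤ K) (hF : ∀ t, 0 < t → t ≤ τ → ‖F t‖ ≤ N)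
    (ht : t ≤ τ) (hs : s ∈ Ioo 0 t) : ‖a (t - s) * P * F s‖ ≤ K * ‖P‖ * N := by
  have h1 := ha (t - s) (by linarith [hs.2]) (by linarith [hs.1])
  have h2 := hF s hs.1 (by linarith [hs.2])
  have hK := (norm_nonneg _).trans h1
  calc _ ≤ ‖a (t - s)‖ * ‖P‖ * ‖F s‖ :=
        (norm_mul_le _ _).trans (mul_le_mul_of_nonneg_right (norm_mul_le _ _) (norm_nonneg _))
    _ ≤ _ := by gcongr

/-- Inserting the equation into itself `n` times gives a bound by `N (K ‖P‖ t)ⁿ / n!`, which tends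
to zero. -/
theorem volterra_unique {a F : ℝ → 𝔸} {P : 𝔸} {τ K N : ℝ}
    (ha : ∀ t, 0 < t → t ≤ τ → ‖a t‖ ≤ K) (hF : ∀ t, 0 < t → t ≤ τ → ‖F t‖ ≤ N)
    (h : ∀ t, 0 < t → t ≤ τ → F t = ∫ s in (0 : ℝ)..t, a (t - s) * P * F s) :
    ∀ t, 0 < t → t ≤ τ → F t = 0 := by
  intro t ht htτ
  have hK : 0 ≤ K := (norm_nonneg _).trans (ha t ht htτ)
  have hN : 0 ≤ N := (norm_nonneg _).trans (hF t ht htτ)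
  have key : ∀ n : ℕ, ∀ t, 0 < t → t ≤ τ → ‖F t‖ ≤ N * ((K * ‖P‖ * t) ^ n / n !) := by
    intro n
    induction n with
    | zero => intro t ht htτ; simpa using hF t ht htτ
    | succ n ih =>
      intro t ht htτ
      have hle : ‖∫ s in (0 : ℝ)..t, a (t - s) * P * F s‖ ≤
          ∫ s in (0 : ℝ)..t, K * ‖P‖ * N * (K * ‖P‖) ^ n / n ! * s ^ n := by
        rw [intervalIntegral.integral_of_le ht.le, intervalIntegral.integral_of_le ht.le,
          integral_Ioc_eq_integral_Ioo, integral_Ioc_eq_integral_Ioo]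
        refine norm_integral_le_of_norm_le ?_ ?_
        · exact ((by fun_prop : Continuous fun s : ℝ =>
            K * ‖P‖ * N * (K * ‖P‖) ^ n / n ! * s ^ n).integrableOn_Icc (a := 0)
            (b := t)).mono_set Ioo_subset_Icc_self
        · refine (ae_restrict_iff' measurableSet_Ioo).2 (Eventually.of_forall fun s hs => ?_)
          have h1 := ha (t - s) (by linarith [hs.2]) (by linarith [hs.1])
          have h2 := ih s hs.1 (by linarith [hs.2])
          calc _ ≤ ‖a (t - s)‖ * ‖P‖ * ‖F s‖ :=
                (norm_mul_le _ _).trans (mul_le_mul_of_nonneg_right (norm_mul_le _ _)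
                  (norm_nonneg _))
            _ ≤ K * ‖P‖ * (N * ((K * ‖P‖ * s) ^ n / n !)) := by gcongr
            _ = _ := by ring
      rw [h t ht htτ]
      refine hle.trans (le_of_eq ?_)
      rw [intervalIntegral.integral_const_mul, integral_pow, Nat.factorial_succ]
      push_cast
      field_simp
      ring
  have hlim := (FloorSemiring.tendsto_pow_div_factorial_atTop (K * ‖P‖ * t)).const_mul N
  rw [mul_zero] at hlim
  have := ge_of_tendsto' hlim fun n => key n t ht htτ
  simpa using this

variable [CompleteSpace 𝔸]

/-- For fixed `s`, the defect `u ↦ b (u + s) - b u * b s` is a bounded solution of the homogeneous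
Volterra equation, so it vanishes. -/
theorem volterra_map_add {a b : ℝ → 𝔸} {P : 𝔸} (ha : ContinuousOn a (Ioi 0))
    (hb : ContinuousOn b (Ioi 0))
    (hab : ∀ τ, ∃ K, ∀ t, 0 < t → t ≤ τ → ‖a t‖ ≤ K)
    (hbb : ∀ τ, ∃ K, ∀ t, 0 < t → t ≤ τ → ‖b t‖ ≤ K)
    (hadd : ∀ s t, 0 < s → 0 < t → a (s + t) = a s * a t)
    (h : ∀ t, 0 < t → b t = a t + ∫ s in (0 : ℝ)..t, a (t - s) * P * b s)
    {t s : ℝ} (ht : 0 < t) (hs : 0 < s) : b (t + s) = b t * b s := by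
  obtain ⟨K, hK⟩ := hab (t + s)
  obtain ⟨N, hN⟩ := hbb (t + s)
  have hint : ∀ u, 0 < u → u ≤ t + s →
      IntervalIntegrable (fun r => a (u - r) * P * b r) volume 0 u := fun u hu hut =>
    intervalIntegrable_of_continuousOn_Ioo hu.le
      (((ha.comp (by fun_prop) fun r hr => by
        simpa using hr.2).mul continuousOn_const).mul (hb.mono fun r hr => hr.1))
      fun r hr => norm_volterra_kernel_le hK hN hut hr
  -- The integral in the equation for `b (u + s)` is split at `s`. On `[0, s]` the kernel factors as
  -- `a u * a (s - r)`, and that part combines with `a u * a s` to `a u * b s`.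
  have hshift : ∀ u, 0 < u → u ≤ t →
      b (u + s) = a u * b s + ∫ r in (0 : ℝ)..u, a (u - r) * P * b (r + s) ∧
      IntervalIntegrable (fun r => a (u - r) * P * b (r + s)) volume 0 u := by
    intro u hu hut
    have hi := hint (u + s) (by positivity) (by linarith)
    have hi1 : IntervalIntegrable (fun r => a (u + s - r) * P * b r) volume 0 s :=
      hi.mono_set (by
        rw [uIcc_of_le hs.le, uIcc_of_le (by positivity)]
        exact Icc_subset_Icc_right (by linarith))
    have hi2 : IntervalIntegrable (fun r => a (u + s - r) * P * b r) volume s (u + s) :=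
      hi.mono_set (by
        rw [uIcc_of_le (by linarith), uIcc_of_le (by positivity)]
        exact Icc_subset_Icc_left hs.le)
    have e1 : ∫ r in (0 : ℝ)..s, a (u + s - r) * P * b r =
        a u * ∫ r in (0 : ℝ)..s, a (s - r) * P * b r := by
      rw [← ContinuousLinearMap.mul_apply' ℝ 𝔸 (a u),
        ← ContinuousLinearMap.intervalIntegral_comp_comm _ (hint s hs (by linarith)),
        intervalIntegral.integral_of_le hs.le, intervalIntegral.integral_of_le hs.le,
        integral_Ioc_eq_integral_Ioo, integral_Ioc_eq_integral_Ioo]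
      refine setIntegral_congr_fun measurableSet_Ioo fun r hr => ?_
      have : u + s - r = u + (s - r) := by ring
      simp only [this, ContinuousLinearMap.mul_apply', hadd u (s - r) hu (by linarith [hr.2]),
        mul_assoc]
    have e2 : ∫ r in (0 : ℝ)..u, a (u - r) * P * b (r + s) =
        ∫ r in s..(u + s), a (u + s - r) * P * b r := by
      have := intervalIntegral.integral_comp_add_right (a := 0) (b := u)
        (fun r => a (u + s - r) * P * b r) s
      rw [zero_add] at this
      rw [← this]
      simp only [add_sub_add_right_eq_sub]
    refine ⟨?_, ?_⟩
    · rw [h (u + s) (by positivity), hadd u s hu hs, e2, h s hs, mul_add, ← e1, add_assoc,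
        intervalIntegral.integral_add_adjacent_intervals hi1 hi2]
    · have := hi2.comp_add_right s
      simpa using this
  have hF := volterra_unique (F := fun u => b (u + s) - b u * b s) (P := P) (τ := t) (K := K)
    (N := N + N * N) (a := a) (fun u hu hut => hK u hu (by linarith)) (fun u hu hut => ?_)
    (fun u hu hut => ?_) t ht le_rfl
  · exact sub_eq_zero.1 hF
  · refine (norm_sub_le _ _).trans (add_le_add (hN _ (by positivity) (by linarith))
      ((norm_mul_le _ _).trans ?_))
    have h1 := hN u hu (by linarith)
    have h2 := hN s hs (by linarith)
    have := (norm_nonneg _).trans h1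
    gcongr
  · obtain ⟨h1, h2⟩ := hshift u hu hut
    have h3 := hint u hu (by linarith)
    have h4 : IntervalIntegrable (fun r => a (u - r) * P * b r * b s) volume 0 u :=
      h3.mul_const _
    simp only [mul_sub, ← mul_assoc]
    have h5 : ∫ r in (0 : ℝ)..u, a (u - r) * P * b r * b s =
        (∫ r in (0 : ℝ)..u, a (u - r) * P * b r) * b s :=
      ((ContinuousLinearMap.mul ℝ 𝔸).flip (b s)).intervalIntegral_comp_comm h3
    rw [intervalIntegral.integral_sub h2 h4, h5, h1]
    nth_rewrite 1 [h u hu]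
    rw [add_mul]
    abel

end Volterra

/-! ### Holomorphic semigroups on the half-plane and their bounded perturbations -/

section Holomorphic

open MeasureTheory Metric

variable {E : Type*} [NormedAddCommGroup E] [NormedSpace ℂ E]

/-- A semigroup on `(0, ∞)` with a holomorphic extension to the open right half-plane that is
bounded near `0` and strongly continuous at `0` in every smaller cone. -/
structure IsHolomorphicSemigroup (T : ℂ → E →L[ℂ] E) : Prop where
  diff : DifferentiableOn ℂ T {z | 0 < z.re}
  map_zero : T 0 = 1
  map_add : ∀ s t : ℝ, 0 < s → 0 < t → T ((s + t : ℝ) : ℂ) = T s * T t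
  bound : ∀ c R : ℝ, 0 < c → ∃ M, 0 ≤ M ∧ ∀ z ∈ cone c, ‖z‖ ≤ R → ‖T z‖ ≤ M
  strongCont : ∀ c : ℝ, 0 < c → ∀ x, Tendsto (fun z => T z x) (𝓝[cone c] 0) (𝓝 x)

/-- The identity theorem applies, since the real zeros `1 + 1 / (n + 1)` accumulate at `1`. -/
theorem eq_zero_of_forall_ofReal_pos {G : Type*} [NormedAddCommGroup G] [NormedSpace ℂ G]
    [CompleteSpace G] {f : ℂ → G} (hf : DifferentiableOn ℂ f {z | 0 < z.re})
    (h : ∀ t : ℝ, 0 < t → f t = 0) {z : ℂ} (hz : 0 < z.re) : f z = 0 := by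
  have han : AnalyticOnNhd ℂ f {z | 0 < z.re} := hf.analyticOnNhd isOpen_re_pos
  have hconv : Convex ℝ {z : ℂ | 0 < z.re} := convex_halfSpace_re_gt 0
  have hu : Tendsto (fun n : ℕ => (1 : ℂ) + ((1 / ((n : ℝ) + 1) : ℝ) : ℂ)) atTop (𝓝[≠] 1) := by
    refine tendsto_nhdsWithin_iff.2 ⟨?_, Eventually.of_forall fun n => ?_⟩
    · have h2 := ((Complex.continuous_ofReal.tendsto _).comp
        tendsto_one_div_add_atTop_nhds_zero_nat).const_add 1
      simpa [Function.comp_def] using h2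
    · have : (0 : ℝ) < 1 / ((n : ℝ) + 1) := by positivity
      simp only [mem_compl_iff, mem_singleton_iff, add_eq_left]
      exact_mod_cast this.ne'
  refine han.eqOn_zero_of_preconnected_of_frequently_eq_zero hconv.isPreconnected
    (z₀ := 1) (by simp) ?_ hz
  refine hu.frequently (Frequently.of_forall fun n => ?_)
  have := h (1 + 1 / ((n : ℝ) + 1)) (by positivity)
  push_cast at this ⊢
  exact this

variable {T : ℂ → E →L[ℂ] E}

theorem tendsto_ofReal_cone : Tendsto (fun t : ℝ => (t : ℂ)) (𝓝[>] 0) (𝓝[cone 1] 0) := by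
  refine tendsto_nhdsWithin_iff.2 ⟨?_, ?_⟩
  · have := (Complex.continuous_ofReal.tendsto 0).mono_left (nhdsWithin_le_nhds (s := Ioi 0))
    simpa using this
  · filter_upwards [self_mem_nhdsWithin] with t ht
    exact ofReal_mem_cone ht

theorem IsHolomorphicSemigroup.tendsto_zero (hT : IsHolomorphicSemigroup T) (x : E) :
    Tendsto (fun t : ℝ => T t x) (𝓝[>] 0) (𝓝 x) :=
  (hT.strongCont 1 one_pos x).comp tendsto_ofReal_cone

theorem IsHolomorphicSemigroup.isC0Semigroup (hT : IsHolomorphicSemigroup T) :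
    IsC0Semigroup fun t : ℝ => T t where
  map_zero := by simpa using hT.map_zero
  map_add := by
    intro s t hs ht
    rcases hs.eq_or_lt with rfl | hs
    · simp [hT.map_zero]
    rcases ht.eq_or_lt with rfl | ht
    · simp [hT.map_zero]
    exact hT.map_add s t hs ht
  strongCont := hT.tendsto_zero

/-- The semigroup law extends from real to complex times by two uses of the identity theorem, one in
each argument. -/
theorem IsHolomorphicSemigroup.isAnalyticSemigroup [CompleteSpace E]
    (hT : IsHolomorphicSemigroup T) :
    IsAnalyticSemigroup T (Real.pi / 2) where
  map_zero := hT.map_zero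
  map_add := by
    rw [sector_pi_div_two]
    have h1 : ∀ s : ℝ, 0 < s → ∀ z : ℂ, 0 < z.re → T (z + s) = T z * T s := by
      intro s hs z hz
      refine sub_eq_zero.1 (eq_zero_of_forall_ofReal_pos (f := fun z => T (z + s) - T z * T s)
        (DifferentiableOn.sub ?_ ?_) (fun t ht => ?_) hz)
      · refine hT.diff.comp (by fun_prop) fun w hw => ?_
        simp only [mem_ofPred_eq, Complex.add_re, Complex.ofReal_re] at hw ⊢
        positivity
      · exact hT.diff.mul (differentiableOn_const _)
      · have := hT.map_add t s ht hs
        push_cast at this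
        simp [this]
    intro z hz w hw
    rw [mem_ofPred_eq] at hz hw
    refine sub_eq_zero.1 (eq_zero_of_forall_ofReal_pos (f := fun w => T (z + w) - T z * T w)
      (DifferentiableOn.sub ?_ ?_) (fun t ht => ?_) hw)
    · refine hT.diff.comp (by fun_prop) fun w hw => ?_
      simp only [mem_ofPred_eq, Complex.add_re] at hw ⊢
      positivity
    · exact (differentiableOn_const _).mul hT.diff
    · simp [h1 t ht z hz]
  analytic := by
    rw [sector_pi_div_two]
    exact hT.diff
  strongCont := by
    intro δ hδ0 hδ x
    exact (hT.strongCont (Real.cos δ) (Real.cos_pos_of_mem_Ioo ⟨by linarith [Real.pi_pos], hδ⟩)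
      x).mono_left (nhdsWithin_mono _ (sector_subset_cone hδ))

variable [CompleteSpace E]

theorem continuousOn_ofReal_pos {G : Type*} [NormedAddCommGroup G] [NormedSpace ℂ G] {f : ℂ → G}
    (hf : DifferentiableOn ℂ f {z | 0 < z.re}) :
    ContinuousOn (fun t : ℝ => f (t : ℂ)) (Ioi 0) :=
  hf.continuousOn.comp (by fun_prop) fun t ht => by simpa using ht

/-- Bounded perturbations of a holomorphic semigroup. -/
theorem IsHolomorphicSemigroup.exists_perturbation (hT : IsHolomorphicSemigroup T)
    (P : E →L[ℂ] E) : ∃ T₁ : ℂ → E →L[ℂ] E, IsHolomorphicSemigroup T₁ ∧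
      ∀ x, Tendsto (fun t : ℝ => (t⁻¹ : ℝ) • (T₁ t x - T t x)) (𝓝[>] 0) (𝓝 (P x)) := by
  have hS := differentiableOn_dysonSum (P := P) hT.diff hT.bound
  have hSb : ∀ c R : ℝ, 0 < c →
      ∃ M, 0 ≤ M ∧ ∀ z ∈ cone c, ‖z‖ ≤ R → ‖dysonSum T P z‖ ≤ M := by
    intro c R hc
    obtain ⟨M, hM0, hM⟩ := hT.bound c R hc
    refine ⟨max 0 (∑' n : ℕ, M * ((M * ‖P‖ * R) ^ n / n.factorial)), le_max_left _ _,
      fun z hz hR => (norm_dysonSum_le hM0 hM hz hR).trans (le_max_right _ _)⟩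
  have heq : ∀ z : ℂ, 0 < z.re → _ := fun z hz => dysonSum_eq (P := P) hT.diff hT.bound hz
  -- The prefactor `z` in the recursion kills every term but the first at `z = 0`.
  have hS0 : dysonSum T P 0 = 1 := by
    rw [dysonSum, tsum_eq_single 0]
    · exact hT.map_zero
    · intro n hn
      obtain ⟨m, rfl⟩ := Nat.exists_eq_succ_of_ne_zero hn
      simp [dyson]
  have hSc : ∀ c : ℝ, 0 < c → ∀ x,
      Tendsto (fun z => dysonSum T P z x) (𝓝[cone c] 0) (𝓝 x) := by
    intro c hc x
    obtain ⟨M, hM0, hM⟩ := hT.bound c 1 hc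
    obtain ⟨N, hN0, hN⟩ := hSb c 1 hc
    have hdiff : Tendsto (fun z => (dysonSum T P z - T z) x) (𝓝[cone c] 0) (𝓝 0) := by
      have hlim : Tendsto (fun z : ℂ => ‖z‖ * (M * ‖P‖ * N) * ‖x‖) (𝓝[cone c] 0) (𝓝 0) := by
        have : Continuous fun z : ℂ => ‖z‖ * (M * ‖P‖ * N) * ‖x‖ := by fun_prop
        simpa using (this.tendsto 0).mono_left (nhdsWithin_le_nhds (s := cone c))
      refine squeeze_zero_norm' ?_ hlim
      have hev : ∀ᶠ z : ℂ in 𝓝[cone c] 0, z ∈ closedBall (0 : ℂ) 1 :=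
        mem_nhdsWithin_of_mem_nhds (closedBall_mem_nhds _ one_pos)
      filter_upwards [hev, self_mem_nhdsWithin] with z hz1 hz
      rw [mem_closedBall_zero_iff] at hz1
      refine ContinuousLinearMap.le_of_opNorm_le _ ?_ x
      rw [heq z hz.1, add_sub_cancel_left, norm_smul]
      gcongr
      have := norm_setIntegral_le_of_norm_le_const (μ := volume) (s := Ioo (0 : ℝ) 1)
        (C := M * ‖P‖ * N) (by simp)
        fun r hr => norm_dyson_integrand_le (P := P) hM hN hz hz1 hr
      simpa using this
    have := hdiff.add (hT.strongCont c hc x)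
    simpa using this
  have hadd : ∀ s t : ℝ, 0 < s → 0 < t →
      dysonSum T P ((s + t : ℝ) : ℂ) = dysonSum T P s * dysonSum T P t := by
    intro s t hs ht
    have hbd : ∀ {F : ℂ → E →L[ℂ] E}, (∀ c R : ℝ, 0 < c →
        ∃ M, 0 ≤ M ∧ ∀ z ∈ cone c, ‖z‖ ≤ R → ‖F z‖ ≤ M) →
        ∀ τ : ℝ, ∃ K, ∀ t : ℝ, 0 < t → t ≤ τ → ‖F t‖ ≤ K := by
      intro F hF τ
      obtain ⟨M, -, hM⟩ := hF 1 τ one_pos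
      refine ⟨M, fun t ht htτ => hM _ (ofReal_mem_cone ht) ?_⟩
      rwa [Complex.norm_real, Real.norm_of_nonneg ht.le]
    refine volterra_map_add (a := fun t : ℝ => T t) (b := fun t : ℝ => dysonSum T P t) (P := P)
      (continuousOn_ofReal_pos hT.diff) (continuousOn_ofReal_pos hS)
      (hbd hT.bound) (hbd hSb) hT.map_add (fun t ht => ?_) hs ht
    rw [heq t (by simpa using ht)]
    congr 1
    have h1 := intervalIntegral.smul_integral_comp_mul_left (a := 0) (b := 1)
      (fun s : ℝ => T ((t - s : ℝ) : ℂ) * P * dysonSum T P (s : ℂ)) t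
    rw [mul_zero, mul_one] at h1
    rw [← h1, intervalIntegral.integral_of_le zero_le_one, integral_Ioc_eq_integral_Ioo,
      ← Complex.coe_smul]
    congr 1
    refine setIntegral_congr_fun measurableSet_Ioo fun r hr => ?_
    have e1 : (((1 - r : ℝ) : ℂ) * t) = ((t - t * r : ℝ) : ℂ) := by push_cast; ring
    have e2 : (r : ℂ) * t = ((t * r : ℝ) : ℂ) := by push_cast; ring
    simp only [e1, e2]
  refine ⟨dysonSum T P, ⟨hS, hS0, hadd, hSb, hSc⟩, fun x => ?_⟩
  obtain ⟨M, hM0, hM⟩ := hT.bound 1 1 one_pos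
  obtain ⟨N, hN0, hN⟩ := hSb 1 1 one_pos
  have hsmall : ∀ᶠ t : ℝ in 𝓝[>] 0, t ≤ 1 :=
    mem_nhdsWithin_of_mem_nhds (Iic_mem_nhds one_pos)
  have hbnd : ∀ t : ℝ, 0 < t → t ≤ 1 → ∀ r ∈ Ioo (0 : ℝ) 1,
      ‖T (((1 - r : ℝ) : ℂ) * t) * P * dysonSum T P ((r : ℂ) * t)‖ ≤ M * ‖P‖ * N :=
    fun t ht ht1 r hr => norm_dyson_integrand_le (P := P) hM hN (ofReal_mem_cone ht)
      (by rwa [Complex.norm_real, Real.norm_of_nonneg ht.le]) hr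
  have hmeas : ∀ t : ℝ, 0 < t → AEStronglyMeasurable
      (fun r : ℝ => T (((1 - r : ℝ) : ℂ) * t) * P * dysonSum T P ((r : ℂ) * t))
      (volume.restrict (Ioo 0 1)) := fun t ht =>
    (continuousOn_dyson_integrand hT.diff hS (by simpa using ht)).aestronglyMeasurable
      measurableSet_Ioo
  -- By variation of constants, the difference quotient `(T₁ t x - T t x) / t` is the average over
  -- `r` of `T ((1 - r) t) P T₁ (r t) x`, whose integrand tends to `P x`.
  have hlim := tendsto_integral_filter_of_dominated_convergence
    (μ := volume.restrict (Ioo (0 : ℝ) 1)) (l := 𝓝[>] (0 : ℝ))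
    (F := fun (t : ℝ) (r : ℝ) =>
      (T (((1 - r : ℝ) : ℂ) * t) * P * dysonSum T P ((r : ℂ) * t)) x)
    (f := fun _ => P x) (fun _ => M * ‖P‖ * N * ‖x‖) ?_ ?_ (integrable_const _) ?_
  · simp only [integral_const, MeasurableSet.univ, measureReal_restrict_apply, univ_inter,
      Real.volume_real_Ioo_of_le zero_le_one, sub_zero, one_smul] at hlim
    refine hlim.congr' ?_
    filter_upwards [self_mem_nhdsWithin, hsmall] with t ht ht1
    rw [mem_Ioi] at ht
    rw [heq t (by simpa using ht), _root_.add_apply, add_sub_cancel_left, Complex.coe_smul,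
      _root_.smul_apply, inv_smul_smul₀ ht.ne']
    refine (ContinuousLinearMap.integral_apply ?_ x).symm
    exact (integrable_const (M * ‖P‖ * N)).mono' (hmeas t ht)
      ((ae_restrict_iff' measurableSet_Ioo).2 (Eventually.of_forall (hbnd t ht ht1)))
  · filter_upwards [self_mem_nhdsWithin] with t ht
    exact (ContinuousLinearMap.apply ℂ E x).continuous.comp_aestronglyMeasurable (hmeas t ht)
  · filter_upwards [self_mem_nhdsWithin, hsmall] with t ht ht1
    refine (ae_restrict_iff' measurableSet_Ioo).2 (Eventually.of_forall fun r hr => ?_)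
    exact ContinuousLinearMap.le_of_opNorm_le _ (hbnd t ht ht1 r hr) x
  · refine (ae_restrict_iff' measurableSet_Ioo).2 (Eventually.of_forall fun r hr => ?_)
    have hscale : ∀ q : ℝ, 0 < q → Tendsto (fun t : ℝ => (q : ℂ) * t) (𝓝[>] 0) (𝓝[cone 1] 0) := by
      intro q hq
      refine tendsto_nhdsWithin_iff.2 ⟨?_, ?_⟩
      · have : Continuous fun t : ℝ => (q : ℂ) * t := by fun_prop
        simpa using (this.tendsto 0).mono_left (nhdsWithin_le_nhds (s := Ioi 0))
      · filter_upwards [self_mem_nhdsWithin] with t ht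
        exact mul_mem_cone (ofReal_mem_cone ht) hq
    have hr1 : 0 < 1 - r := by linarith [hr.2]
    have h1 : Tendsto (fun t : ℝ => T (((1 - r : ℝ) : ℂ) * t) (P x)) (𝓝[>] 0) (𝓝 (P x)) :=
      (hT.strongCont 1 one_pos (P x)).comp (hscale _ hr1)
    have h2 : Tendsto (fun t : ℝ => P (dysonSum T P ((r : ℂ) * t) x) - P x) (𝓝[>] 0) (𝓝 0) := by
      have := ((P.continuous.tendsto x).comp
        ((hSc 1 one_pos x).comp (hscale _ hr.1))).sub_const (P x)
      simpa using this
    -- Both factors converge only strongly, so the moving vector is first replaced by its limit `P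
    -- x`, at a cost controlled by the uniform bound on `T`.
    have h3 : Tendsto (fun t : ℝ => T (((1 - r : ℝ) : ℂ) * t)
        (P (dysonSum T P ((r : ℂ) * t) x) - P x)) (𝓝[>] 0) (𝓝 0) := by
      have hM' := (h2.norm.const_mul M)
      rw [norm_zero, mul_zero] at hM'
      refine squeeze_zero_norm' ?_ hM'
      filter_upwards [self_mem_nhdsWithin, hsmall] with t ht ht1
      rw [mem_Ioi] at ht
      refine ContinuousLinearMap.le_of_opNorm_le _ (hM _ (mul_mem_cone (ofReal_mem_cone ht) hr1)
        ((norm_ofReal_mul_le hr1.le (by linarith [hr.1]) _).trans ?_)) _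
      rwa [Complex.norm_real, Real.norm_of_nonneg ht.le]
    have := h3.add h1
    rw [zero_add] at this
    refine this.congr fun t => ?_
    rw [map_sub, sub_add_cancel]
    rfl

end Holomorphic

/-! ### The Weierstrass kernel with complex time: derivatives, Gaussian bounds, moments -/

section Kernel

open MeasureTheory Metric

/-- The Weierstrass kernel `(π z)^(-1/2) exp (-s² / (4 z))`. -/
noncomputable def heatKernel (z : ℂ) (s : ℝ) : ℂ :=
  ((Real.pi : ℂ) * z) ^ ((-(1 / 2) : ℝ) : ℂ) * Complex.exp (-(1 / (4 * z)) * (s : ℂ) ^ 2)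

/-- The common value of the second `s`-derivative and of the `z`-derivative of the Weierstrass
kernel. -/
noncomputable def heatKernel₂ (z : ℂ) (s : ℝ) : ℂ :=
  (-(1 / (2 * z)) + (1 / (4 * z ^ 2)) * (s : ℂ) ^ 2) * heatKernel z s

theorem hasDerivAt_heatKernel_right (z : ℂ) (s : ℝ) :
    HasDerivAt (heatKernel z) (-(1 / (2 * z)) * (s * heatKernel z s)) s := by
  have h1 : HasDerivAt (fun s : ℝ => (s : ℂ)) 1 s := Complex.ofRealCLM.hasDerivAt
  have h2 := (((h1.pow 2).const_mul (-(1 / (4 * z)))).cexp).const_mul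
    (((Real.pi : ℂ) * z) ^ ((-(1 / 2) : ℝ) : ℂ))
  refine HasDerivAt.congr_deriv (f := heatKernel z) h2 ?_
  simp only [heatKernel, Pi.pow_apply]
  push_cast
  simp only [div_eq_mul_inv, mul_inv]
  ring

theorem hasDerivAt_heatKernel_right₂ (z : ℂ) (s : ℝ) :
    HasDerivAt (fun s : ℝ => -(1 / (2 * z)) * (s * heatKernel z s)) (heatKernel₂ z s) s := by
  have h1 : HasDerivAt (fun s : ℝ => (s : ℂ)) 1 s := Complex.ofRealCLM.hasDerivAt
  refine HasDerivAt.congr_deriv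
    ((h1.mul (hasDerivAt_heatKernel_right z s)).const_mul (-(1 / (2 * z)))) ?_
  simp only [heatKernel₂, div_eq_mul_inv, mul_inv]
  ring

/-- Together with `hasDerivAt_heatKernel_right₂` this is the heat equation for the kernel. It makes
the Weierstrass integral of a cosine function solve the first order problem. -/
theorem hasDerivAt_heatKernel_left {z : ℂ} (hz : 0 < z.re) (s : ℝ) :
    HasDerivAt (fun z => heatKernel z s) (heatKernel₂ z s) z := by
  have hz0 : z ≠ 0 := fun h => by simp [h] at hz
  have hpi : (0 : ℝ) < Real.pi := Real.pi_pos
  have hslit : (Real.pi : ℂ) * z ∈ Complex.slitPlane := by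
    left
    rw [Complex.re_ofReal_mul]
    positivity
  have h1 : HasDerivAt (fun z : ℂ => (Real.pi : ℂ) * z) (Real.pi : ℂ) z := by
    simpa using (hasDerivAt_id z).const_mul (Real.pi : ℂ)
  have h2 := h1.cpow_const (c := ((-(1 / 2) : ℝ) : ℂ)) hslit
  have h3 : HasDerivAt (fun z : ℂ => -(1 / (4 * z)) * (s : ℂ) ^ 2)
      ((1 / (4 * z ^ 2)) * (s : ℂ) ^ 2) z := by
    have := ((((hasDerivAt_id z).const_mul (4 : ℂ)).inv (by simpa using hz0)).neg).mul_const
      ((s : ℂ) ^ 2)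
    simp only [one_div]
    refine HasDerivAt.congr_deriv (f := fun z : ℂ => -(4 * z)⁻¹ * (s : ℂ) ^ 2) this ?_
    simp only [id, mul_one]
    field_simp
  have h4 := h2.mul h3.cexp
  refine HasDerivAt.congr_deriv (f := fun z => heatKernel z s) h4 ?_
  have hpz : (Real.pi : ℂ) * z ≠ 0 := Complex.slitPlane_ne_zero hslit
  rw [Complex.cpow_sub _ _ hpz, Complex.cpow_one]
  simp only [heatKernel₂, heatKernel]
  have : (Real.pi : ℂ) ≠ 0 := by exact_mod_cast hpi.ne'
  push_cast
  field_simp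

/-- In the cone, `Re (1 / (4 z)) = Re z / (4 ‖z‖²)` is at least `c / (4 ‖z‖)`, so the kernel decays
like a Gaussian. Half of that decay absorbs `exp (ω s)` by completing the square, which leaves the
constant `exp (2 ω² R / c)`. -/
theorem norm_heatKernel_mul_exp_le {c r R ω : ℝ} {z : ℂ} (hc : 0 < c) (hr : 0 < r)
    (hz : z ∈ cone c) (hrz : r ≤ ‖z‖) (hzR : ‖z‖ ≤ R) (s : ℝ) :
    ‖heatKernel z s‖ * Real.exp (ω * s) ≤
      (Real.pi * r) ^ (-(1 / 2) : ℝ) * Real.exp (2 * ω ^ 2 * R / c) *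
        Real.exp (-(c / (8 * R)) * s ^ 2) := by
  have hz0 : 0 < ‖z‖ := hr.trans_le hrz
  have hR : 0 < R := hz0.trans_le hzR
  have hpi := Real.pi_pos
  have h1 : ‖((Real.pi : ℂ) * z) ^ ((-(1 / 2) : ℝ) : ℂ)‖ ≤ (Real.pi * r) ^ (-(1 / 2) : ℝ) := by
    rw [Complex.norm_cpow_real, norm_mul, Complex.norm_real, Real.norm_of_nonneg hpi.le]
    exact Real.rpow_le_rpow_of_nonpos (by positivity) (by gcongr) (by norm_num)
  have hre : c / (4 * ‖z‖) ≤ (1 / (4 * z)).re := by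
    have : (1 / (4 * z)).re = z.re / (4 * ‖z‖ ^ 2) := by
      rw [one_div, Complex.inv_re, ← Complex.normSq_eq_norm_sq, Complex.normSq_mul]
      simp only [Complex.mul_re, Complex.re_ofNat, Complex.im_ofNat, zero_mul, sub_zero,
        Complex.normSq_ofNat]
      have : Complex.normSq z ≠ 0 := by
        rw [Complex.normSq_eq_norm_sq]; positivity
      field_simp
    rw [this, div_le_div_iff₀ (by positivity) (by positivity)]
    nlinarith [hz.2, mul_pos hz0 hz0]
  have h2 : ‖Complex.exp (-(1 / (4 * z)) * (s : ℂ) ^ 2)‖ ≤ Real.exp (-(c / (4 * ‖z‖)) * s ^ 2) := by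
    rw [Complex.norm_exp, ← Complex.ofReal_pow, Complex.re_mul_ofReal, Complex.neg_re]
    gcongr
  have h3 : -(c / (4 * ‖z‖)) * s ^ 2 + ω * s ≤ 2 * ω ^ 2 * R / c + -(c / (8 * R)) * s ^ 2 := by
    have e1 : ω * s ≤ 2 * ω ^ 2 * R / c + c / (8 * R) * s ^ 2 := by
      have : 2 * ω ^ 2 * R / c + c / (8 * R) * s ^ 2 - ω * s =
          (4 * R * ω - c * s) ^ 2 / (8 * R * c) := by
        field_simp
        ring
      have : 0 ≤ (4 * R * ω - c * s) ^ 2 / (8 * R * c) := by positivity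
      linarith
    have e2 : c / (4 * R) * s ^ 2 ≤ c / (4 * ‖z‖) * s ^ 2 := by gcongr
    have e3 : c / (4 * R) * s ^ 2 = 2 * (c / (8 * R) * s ^ 2) := by
      field_simp
      ring
    linarith
  calc ‖heatKernel z s‖ * Real.exp (ω * s)
      ≤ (Real.pi * r) ^ (-(1 / 2) : ℝ) * Real.exp (-(c / (4 * ‖z‖)) * s ^ 2) *
          Real.exp (ω * s) := by
        rw [heatKernel, norm_mul]
        gcongr
    _ = (Real.pi * r) ^ (-(1 / 2) : ℝ) * Real.exp (-(c / (4 * ‖z‖)) * s ^ 2 + ω * s) := by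
        rw [mul_assoc, ← Real.exp_add]
    _ ≤ (Real.pi * r) ^ (-(1 / 2) : ℝ) *
          Real.exp (2 * ω ^ 2 * R / c + -(c / (8 * R)) * s ^ 2) := by
        gcongr
    _ = _ := by rw [Real.exp_add]; ring

theorem integrable_pow_mul_exp_neg_mul_sq {b : ℝ} (hb : 0 < b) (n : ℕ) :
    Integrable fun s : ℝ => s ^ n * Real.exp (-b * s ^ 2) := by
  simpa using integrable_rpow_mul_exp_neg_mul_sq hb (s := n)
    (by linarith [(n.cast_nonneg : (0 : ℝ) ≤ n)])

theorem continuous_heatKernel (z : ℂ) : Continuous (heatKernel z) := by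
  unfold heatKernel
  fun_prop

theorem mem_cone_self {z : ℂ} (hz : 0 < z.re) :
    0 < ‖z‖ ∧ 0 < z.re / ‖z‖ ∧ z ∈ cone (z.re / ‖z‖) := by
  have hz0 : 0 < ‖z‖ := hz.trans_le (Complex.re_le_norm z)
  exact ⟨hz0, div_pos hz hz0, hz, by rw [div_mul_cancel₀ _ hz0.ne']⟩

theorem integrableOn_heatKernel_weight {z : ℂ} (hz : 0 < z.re) (n : ℕ) (ω : ℝ) :
    IntegrableOn (fun s : ℝ => s ^ n * (‖heatKernel z s‖ * Real.exp (ω * s))) (Ioi 0) := by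
  obtain ⟨hz0, hc, hzc⟩ := mem_cone_self hz
  refine (((integrable_pow_mul_exp_neg_mul_sq (b := z.re / ‖z‖ / (8 * ‖z‖)) (by positivity)
    n).const_mul ((Real.pi * ‖z‖) ^ (-(1 / 2) : ℝ) *
      Real.exp (2 * ω ^ 2 * ‖z‖ / (z.re / ‖z‖)))).integrableOn).mono' ?_ ?_
  · have := continuous_heatKernel z
    exact (by fun_prop : Continuous fun s : ℝ =>
      s ^ n * (‖heatKernel z s‖ * Real.exp (ω * s))).aestronglyMeasurable
  · refine (ae_restrict_iff' measurableSet_Ioi).2 (Eventually.of_forall fun s hs => ?_)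
    rw [mem_Ioi] at hs
    rw [Real.norm_of_nonneg (by positivity)]
    refine (mul_le_mul_of_nonneg_left (norm_heatKernel_mul_exp_le hc hz0 hzc le_rfl le_rfl s)
      (by positivity)).trans (le_of_eq ?_)
    ring

/-- The kernel concentrates at scale `√‖z‖`, so its mass stays bounded down to the vertex of the
cone and its first moment is of order `√‖z‖`. The second estimate becomes the order `‖z‖^(-1/2)` of
the `V`-valued family after division by `2 z`. -/
theorem integral_heatKernel_weight_le {c R ω : ℝ} (hc : 0 < c) :
    ∃ K : ℝ, 0 ≤ K ∧ ∀ z ∈ cone c, ‖z‖ ≤ R →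
      ∫ s in Ioi (0 : ℝ), ‖heatKernel z s‖ * Real.exp (ω * s) ≤ K ∧
      ∫ s in Ioi (0 : ℝ), s * (‖heatKernel z s‖ * Real.exp (ω * s)) ≤ K * √‖z‖ := by
  have hpi := Real.pi_pos
  set Q := Real.exp (2 * ω ^ 2 * R / c) with hQ
  refine ⟨Q * (√(8 / c) / 2) + Q * (4 / (c * √Real.pi)), by positivity, fun z hz hzR => ?_⟩
  have hz0 : 0 < ‖z‖ := hz.1.trans_le (Complex.re_le_norm z)
  have hsq : 0 < √‖z‖ := Real.sqrt_pos.2 hz0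
  have hsp : 0 < √Real.pi := Real.sqrt_pos.2 hpi
  have hb : 0 < c / (8 * ‖z‖) := by positivity
  -- The Gaussian bound is used with both radii equal to `‖z‖`, to keep the correct scaling; only
  -- the harmless exponential constant is estimated through `R`.
  have hpt : ∀ s, ‖heatKernel z s‖ * Real.exp (ω * s) ≤
      (Q / (√Real.pi * √‖z‖)) * Real.exp (-(c / (8 * ‖z‖)) * s ^ 2) := by
    intro s
    refine (norm_heatKernel_mul_exp_le hc hz0 hz le_rfl le_rfl s).trans ?_
    have e1 : (Real.pi * ‖z‖) ^ (-(1 / 2) : ℝ) = 1 / (√Real.pi * √‖z‖) := by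
      rw [Real.rpow_neg (by positivity), ← Real.sqrt_eq_rpow, Real.sqrt_mul hpi.le, one_div]
    rw [e1]
    have e2 : Real.exp (2 * ω ^ 2 * ‖z‖ / c) ≤ Q := by
      rw [hQ]
      gcongr
    rw [div_eq_mul_one_div Q, mul_comm Q]
    gcongr
  have i0 : ∫ s in Ioi (0 : ℝ), Real.exp (-(c / (8 * ‖z‖)) * s ^ 2) =
      √(Real.pi / (c / (8 * ‖z‖))) / 2 := integral_gaussian_Ioi _
  have i1 : ∫ s in Ioi (0 : ℝ), s * Real.exp (-(c / (8 * ‖z‖)) * s ^ 2) =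
      (2 * (c / (8 * ‖z‖)))⁻¹ := by
    have := integral_mul_cexp_neg_mul_sq (b := ((c / (8 * ‖z‖) : ℝ) : ℂ)) 
      (by rwa [Complex.ofReal_re])
    have h2 : ∫ s in Ioi (0 : ℝ), (s : ℂ) * Complex.exp (-((c / (8 * ‖z‖) : ℝ) : ℂ) * (s : ℂ) ^ 2)
        = ((∫ s in Ioi (0 : ℝ), s * Real.exp (-(c / (8 * ‖z‖)) * s ^ 2) : ℝ) : ℂ) := by
      rw [← integral_complex_ofReal]
      congr 1
      funext s
      push_cast
      rfl
    rw [h2] at this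
    exact_mod_cast this
  have g0 : IntegrableOn (fun s : ℝ => Real.exp (-(c / (8 * ‖z‖)) * s ^ 2)) (Ioi 0) :=
    (integrable_exp_neg_mul_sq hb).integrableOn
  have g1 : IntegrableOn (fun s : ℝ => s * Real.exp (-(c / (8 * ‖z‖)) * s ^ 2)) (Ioi 0) :=
    (integrable_mul_exp_neg_mul_sq hb).integrableOn
  constructor
  · calc ∫ s in Ioi (0 : ℝ), ‖heatKernel z s‖ * Real.exp (ω * s)
        ≤ ∫ s in Ioi (0 : ℝ), (Q / (√Real.pi * √‖z‖)) * Real.exp (-(c / (8 * ‖z‖)) * s ^ 2) := by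
          refine setIntegral_mono_on (by simpa using integrableOn_heatKernel_weight hz.1 0 ω)
            (g0.const_mul _) measurableSet_Ioi fun s _ => hpt s
      _ = Q * (√(8 / c) / 2) := by
          rw [integral_const_mul, i0]
          have : Real.pi / (c / (8 * ‖z‖)) = Real.pi * ‖z‖ * (8 / c) := by
            field_simp
          rw [this, Real.sqrt_mul (by positivity), Real.sqrt_mul hpi.le]
          field_simp
      _ ≤ _ := le_add_of_nonneg_right (by positivity)
  · calc ∫ s in Ioi (0 : ℝ), s * (‖heatKernel z s‖ * Real.exp (ω * s))
        ≤ ∫ s in Ioi (0 : ℝ),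
            (Q / (√Real.pi * √‖z‖)) * (s * Real.exp (-(c / (8 * ‖z‖)) * s ^ 2)) := by
          refine setIntegral_mono_on (by simpa using integrableOn_heatKernel_weight hz.1 1 ω)
            (g1.const_mul _) measurableSet_Ioi fun s hs => ?_
          rw [mem_Ioi] at hs
          refine (mul_le_mul_of_nonneg_left (hpt s) hs.le).trans (le_of_eq ?_)
          ring
      _ = Q * (4 / (c * √Real.pi)) * √‖z‖ := by
          rw [integral_const_mul, i1]
          have : ‖z‖ = √‖z‖ * √‖z‖ := (Real.mul_self_sqrt hz0.le).symm
          have e : (2 * (c / (8 * ‖z‖)))⁻¹ = 4 * (√‖z‖ * √‖z‖) / c := by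
            rw [← this]
            field_simp
            norm_num
          rw [e]
          field_simp
      _ ≤ _ := by
          gcongr
          exact le_add_of_nonneg_left (by positivity)

theorem integral_heatKernel {z : ℂ} (hz : 0 < z.re) :
    ∫ s in Ioi (0 : ℝ), heatKernel z s = 1 := by
  have hz0 : z ≠ 0 := fun h => by simp [h] at hz
  have hpi : (Real.pi : ℂ) ≠ 0 := by exact_mod_cast Real.pi_ne_zero
  have hb : 0 < (1 / (4 * z)).re := by
    rw [one_div, Complex.inv_re]
    refine div_pos (by simpa using hz) (Complex.normSq_pos.2 (by simpa using hz0))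
  have h1 := integral_gaussian_complex_Ioi hb
  simp only [heatKernel]
  rw [integral_const_mul, h1]
  have h2 : (Real.pi : ℂ) / (1 / (4 * z)) = ((4 : ℝ) : ℂ) * (Real.pi * z) := by
    push_cast
    field_simp
  have hpz : (Real.pi : ℂ) * z ≠ 0 := mul_ne_zero hpi hz0
  -- The factor `4` is a positive real and splits off the logarithm without any branch ambiguity, so
  -- the half powers of `π z` cancel exactly and leave `exp (log 2)`.
  have h4 : Real.log 4 = 2 * Real.log 2 := by
    rw [show (4 : ℝ) = 2 ^ 2 by norm_num, Real.log_pow]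
    norm_num
  rw [h2, Complex.cpow_def_of_ne_zero hpz, Complex.cpow_def_of_ne_zero
    (mul_ne_zero (by norm_num) hpz), Complex.log_ofReal_mul (by norm_num) hpz, mul_div_assoc',
    ← Complex.exp_add, h4]
  have : Complex.log (Real.pi * z) * ((-(1 / 2) : ℝ) : ℂ) +
      (((2 * Real.log 2 : ℝ) : ℂ) + Complex.log (Real.pi * z)) * (1 / 2) = (Real.log 2 : ℝ) := by
    push_cast
    ring
  rw [this, ← Complex.ofReal_exp, Real.exp_log (by norm_num)]
  norm_num

end Kernel

/-! ### Weierstrass integrals of vector-valued functions -/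

section KernelIntegrals

open MeasureTheory Metric

variable {Y : Type*} [NormedAddCommGroup Y] [NormedSpace ℂ Y] {φ ψ : ℝ → Y} {N ω : ℝ}

theorem aestronglyMeasurable_heatKernel_smul (hφ : ContinuousOn φ (Ici 0)) (z : ℂ) (n : ℕ) :
    AEStronglyMeasurable (fun s : ℝ => ((s : ℂ) ^ n * heatKernel z s) • φ s)
      (volume.restrict (Ioi 0)) := by
  have := continuous_heatKernel z
  refine (ContinuousOn.fun_smul ?_ (hφ.mono Ioi_subset_Ici_self)).aestronglyMeasurable
    measurableSet_Ioi
  exact Continuous.continuousOn (by fun_prop)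

theorem norm_heatKernel_smul_le (hb : ∀ s, 0 ≤ s → ‖φ s‖ ≤ N * Real.exp (ω * s)) (z : ℂ) (n : ℕ)
    {s : ℝ} (hs : 0 ≤ s) : ‖((s : ℂ) ^ n * heatKernel z s) • φ s‖ ≤
      N * (s ^ n * (‖heatKernel z s‖ * Real.exp (ω * s))) := by
  rw [norm_smul, norm_mul, norm_pow, Complex.norm_real, Real.norm_of_nonneg hs]
  calc _ ≤ s ^ n * ‖heatKernel z s‖ * (N * Real.exp (ω * s)) := by
        gcongr
        exact hb s hs
    _ = _ := by ring

theorem integrableOn_heatKernel_smul (hφ : ContinuousOn φ (Ici 0))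
    (hb : ∀ s, 0 ≤ s → ‖φ s‖ ≤ N * Real.exp (ω * s)) {z : ℂ} (hz : 0 < z.re) (n : ℕ) :
    IntegrableOn (fun s : ℝ => ((s : ℂ) ^ n * heatKernel z s) • φ s) (Ioi 0) :=
  ((integrableOn_heatKernel_weight hz n ω).const_mul N).mono'
    (aestronglyMeasurable_heatKernel_smul hφ z n)
    ((ae_restrict_iff' measurableSet_Ioi).2 (Eventually.of_forall fun _ hs =>
      norm_heatKernel_smul_le hb z n (le_of_lt hs)))

theorem hasDerivAt_integral_heatKernel (hφ : ContinuousOn φ (Ici 0))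
    (hb : ∀ s, 0 ≤ s → ‖φ s‖ ≤ N * Real.exp (ω * s)) {z : ℂ} (hz : 0 < z.re) (n : ℕ) :
    HasDerivAt (fun z => ∫ s in Ioi (0 : ℝ), ((s : ℂ) ^ n * heatKernel z s) • φ s)
      (∫ s in Ioi (0 : ℝ), ((s : ℂ) ^ n * heatKernel₂ z s) • φ s) z := by
  obtain ⟨ε, c, R, r, hε, hc, hR, hr, hball⟩ := exists_ball_subset_cone hz
  have hN : 0 ≤ N := by simpa using (norm_nonneg _).trans (hb 0 le_rfl)
  have hder : ∀ w : ℂ, 0 < w.re → ∀ s : ℝ, HasDerivAt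
      (fun z => ((s : ℂ) ^ n * heatKernel z s) • φ s) (((s : ℂ) ^ n * heatKernel₂ w s) • φ s) w :=
    fun w hw s => ((hasDerivAt_heatKernel_left hw s).const_mul _).smul_const _
  have key := hasDerivAt_integral_of_differentiableOn (μ := volume.restrict (Ioi (0 : ℝ)))
    (F := fun z s => ((s : ℂ) ^ n * heatKernel z s) • φ s) (z₀ := z) hε
    (bound := fun s => N * ((Real.pi * r) ^ (-(1 / 2) : ℝ) * Real.exp (2 * ω ^ 2 * R / c)) *
        (s ^ n * Real.exp (-(c / (8 * R)) * s ^ 2)))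
    (fun w _ => aestronglyMeasurable_heatKernel_smul hφ w n) ?_ ?_ ?_
  · simpa only [(hder z hz _).deriv] using key
  · exact Eventually.of_forall fun s w hw =>
      (hder w (hball w hw).1.1 s).differentiableAt.differentiableWithinAt
  · refine (ae_restrict_iff' measurableSet_Ioi).2 (Eventually.of_forall fun s hs w hw => ?_)
    rw [mem_Ioi] at hs
    obtain ⟨hw, hwR, hrw⟩ := hball w hw
    refine (norm_heatKernel_smul_le hb w n hs.le).trans ?_
    calc _ ≤ N * (s ^ n * ((Real.pi * r) ^ (-(1 / 2) : ℝ) * Real.exp (2 * ω ^ 2 * R / c) *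
          Real.exp (-(c / (8 * R)) * s ^ 2))) := by
          refine mul_le_mul_of_nonneg_left (mul_le_mul_of_nonneg_left ?_ (by positivity)) hN
          exact norm_heatKernel_mul_exp_le hc hr hw hrw hwR s
      _ = _ := by ring
  · exact ((integrable_pow_mul_exp_neg_mul_sq (by positivity) n).const_mul _).integrableOn

theorem integrableOn_heatKernel₂_smul (hφ : ContinuousOn φ (Ici 0))
    (hb : ∀ s, 0 ≤ s → ‖φ s‖ ≤ N * Real.exp (ω * s)) {z : ℂ} (hz : 0 < z.re) :
    IntegrableOn (fun s : ℝ => heatKernel₂ z s • φ s) (Ioi 0) := by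
  refine (((integrableOn_heatKernel_smul hφ hb hz 0).smul (-(1 / (2 * z)))).add
    ((integrableOn_heatKernel_smul hφ hb hz 2).smul (1 / (4 * z ^ 2)))).congr
    (Eventually.of_forall fun s => ?_)
  simp only [Pi.add_apply, Pi.smul_apply, smul_smul, ← add_smul, heatKernel₂]
  congr 1
  ring

theorem integrableOn_heatKernel_deriv_smul (hφ : ContinuousOn φ (Ici 0))
    (hb : ∀ s, 0 ≤ s → ‖φ s‖ ≤ N * Real.exp (ω * s)) {z : ℂ} (hz : 0 < z.re) :
    IntegrableOn (fun s : ℝ => (-(1 / (2 * z)) * (s * heatKernel z s)) • φ s) (Ioi 0) := by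
  refine ((integrableOn_heatKernel_smul hφ hb hz 1).smul (-(1 / (2 * z)))).congr
    (Eventually.of_forall fun s => ?_)
  simp only [Pi.smul_apply, smul_smul, pow_one]

variable [CompleteSpace Y]

/-- Integration by parts on the half-line: the boundary term at infinity vanishes because the
product and its derivative are both integrable. -/
theorem integral_Ioi_smul_deriv {k k' : ℝ → ℂ} (hk : ∀ s, HasDerivAt k (k' s) s)
    (hφ : ContinuousOn φ (Ici 0)) (hφ' : ∀ s, 0 < s → HasDerivAt φ (ψ s) s)
    (h0 : k 0 • φ 0 = 0) (i1 : IntegrableOn (fun s => k s • φ s) (Ioi 0))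
    (i2 : IntegrableOn (fun s => k' s • φ s) (Ioi 0))
    (i3 : IntegrableOn (fun s => k s • ψ s) (Ioi 0)) :
    ∫ s in Ioi (0 : ℝ), k s • ψ s = -∫ s in Ioi (0 : ℝ), k' s • φ s := by
  have hd : ∀ s ∈ Ioi (0 : ℝ), HasDerivAt (fun s => k s • φ s) (k s • ψ s + k' s • φ s) s :=
    fun s hs => (hk s).smul (hφ' s hs)
  have hi : IntegrableOn (fun s => k s • ψ s + k' s • φ s) (Ioi 0) := i3.add i2
  have hc : ContinuousWithinAt (fun s => k s • φ s) (Ici 0) 0 :=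
    (hk 0).continuousAt.continuousWithinAt.smul (hφ 0 self_mem_Ici)
  have := integral_Ioi_of_hasDerivAt_of_tendsto hc hd hi
    (tendsto_zero_of_hasDerivAt_of_integrableOn_Ioi hd hi i1)
  rw [integral_add i3 i2, h0, sub_zero] at this
  exact eq_neg_of_add_eq_zero_left this

/-- With `φ` the sine and `ψ` the cosine orbit, this trades the cosine family for the sine family,
which gains values in `V`. -/
theorem integral_heatKernel_smul_deriv {N' : ℝ} (hφ : ContinuousOn φ (Ici 0))
    (hψ : ContinuousOn ψ (Ici 0)) (hφ' : ∀ s, 0 < s → HasDerivAt φ (ψ s) s) (h0 : φ 0 = 0)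
    (hb : ∀ s, 0 ≤ s → ‖φ s‖ ≤ N * Real.exp (ω * s))
    (hb' : ∀ s, 0 ≤ s → ‖ψ s‖ ≤ N' * Real.exp (ω * s)) {z : ℂ} (hz : 0 < z.re) :
    ∫ s in Ioi (0 : ℝ), heatKernel z s • ψ s =
      (1 / (2 * z)) • ∫ s in Ioi (0 : ℝ), ((s : ℂ) ^ 1 * heatKernel z s) • φ s := by
  have := integral_Ioi_smul_deriv (hasDerivAt_heatKernel_right z) hφ hφ' (by simp [h0])
    (by simpa using integrableOn_heatKernel_smul hφ hb hz 0)
    (integrableOn_heatKernel_deriv_smul hφ hb hz)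
    (by simpa using integrableOn_heatKernel_smul hψ hb' hz 0)
  rw [this, ← integral_smul, ← integral_neg]
  congr 1
  funext s
  rw [smul_smul, ← neg_smul]
  ring_nf

/-- A second integration by parts moves from the sine orbit to its primitive, whose image in `X`
lies in `D(C)`. -/
theorem integral_heatKernel_smul_deriv₂ {N' : ℝ} (hφ : ContinuousOn φ (Ici 0))
    (hψ : ContinuousOn ψ (Ici 0)) (hφ' : ∀ s, 0 < s → HasDerivAt φ (ψ s) s)
    (hb : ∀ s, 0 ≤ s → ‖φ s‖ ≤ N * Real.exp (ω * s))
    (hb' : ∀ s, 0 ≤ s → ‖ψ s‖ ≤ N' * Real.exp (ω * s)) {z : ℂ} (hz : 0 < z.re) :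
    (1 / (2 * z)) • ∫ s in Ioi (0 : ℝ), ((s : ℂ) ^ 1 * heatKernel z s) • ψ s =
      ∫ s in Ioi (0 : ℝ), heatKernel₂ z s • φ s := by
  have := integral_Ioi_smul_deriv (hasDerivAt_heatKernel_right₂ z) hφ hφ' (by simp)
    (integrableOn_heatKernel_deriv_smul hφ hb hz) (integrableOn_heatKernel₂_smul hφ hb hz)
    (integrableOn_heatKernel_deriv_smul hψ hb' hz)
  rw [← neg_eq_iff_eq_neg] at this
  rw [← this, ← integral_smul, ← integral_neg]
  congr 1
  funext s
  rw [smul_smul, ← neg_smul]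
  ring_nf

/-- The preceding identity applied to a constant function, whose derivative is zero. It permits
replacing `c s x` by `c s x - x` under the second-derivative kernel. -/
theorem integral_heatKernel₂_smul_const {z : ℂ} (hz : 0 < z.re) (x : Y) :
    ∫ s in Ioi (0 : ℝ), heatKernel₂ z s • x = 0 := by
  have h := integral_heatKernel_smul_deriv₂ (φ := fun _ => x) (ψ := fun _ => (0 : Y))
    (N := ‖x‖) (N' := 0) (ω := 0) continuousOn_const continuousOn_const
    (fun s _ => hasDerivAt_const s x) (by simp) (by simp) hz
  rw [← h]
  simp

/-- The kernel is an approximate identity of total mass `1`. Its first moment tends to zero, which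
is enough once the increment of `φ` is bounded by a small constant plus a multiple of `s`, up to the
weight `exp (ω s)`. -/
theorem tendsto_integral_heatKernel {c : ℝ} (hc : 0 < c) (hω : 0 ≤ ω)
    (hφ : ContinuousOn φ (Ici 0)) (hb : ∀ s, 0 ≤ s → ‖φ s‖ ≤ N * Real.exp (ω * s)) :
    Tendsto (fun z => ∫ s in Ioi (0 : ℝ), heatKernel z s • φ s) (𝓝[cone c] 0) (𝓝 (φ 0)) := by
  obtain ⟨K, hK0, hK⟩ := integral_heatKernel_weight_le (R := 1) (ω := ω) hc
  have hN : 0 ≤ N := by simpa using (norm_nonneg _).trans (hb 0 le_rfl)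
  rw [Metric.tendsto_nhds]
  intro ε hε
  have hε' : 0 < ε / (2 * (K + 1)) := by positivity
  obtain ⟨η, hη, hηφ⟩ := Metric.continuousWithinAt_iff.1 (hφ 0 self_mem_Ici) _ hε'
  -- Continuity at `0` gives the constant for `s < η`. For `s ≥ η` the factor `s / η ≥ 1` turns the
  -- growth bound into a linear one. The `K + 1` avoids division by zero and keeps the limit below
  -- `ε`.
  have hpt : ∀ s, 0 ≤ s → ‖φ s - φ 0‖ ≤
      (ε / (2 * (K + 1)) + 2 * N / η * s) * Real.exp (ω * s) := by
    intro s hs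
    have h1 : 1 ≤ Real.exp (ω * s) := Real.one_le_exp (by positivity)
    rcases lt_or_ge s η with h | h
    · have h2 := hηφ (x := s) hs (by rwa [Real.dist_eq, sub_zero, abs_of_nonneg hs])
      rw [dist_eq_norm] at h2
      refine h2.le.trans ?_
      calc ε / (2 * (K + 1)) ≤ ε / (2 * (K + 1)) + 2 * N / η * s :=
            le_add_of_nonneg_right (by positivity)
        _ ≤ _ := le_mul_of_one_le_right (by positivity) h1
    · have h2 : ‖φ s - φ 0‖ ≤ 2 * N * Real.exp (ω * s) := by
        have h3 := hb s hs
        have h4 := hb 0 le_rfl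
        rw [mul_zero, Real.exp_zero, mul_one] at h4
        have h5 : N ≤ N * Real.exp (ω * s) := le_mul_of_one_le_right hN h1
        linarith [norm_sub_le (φ s) (φ 0)]
      refine h2.trans (mul_le_mul_of_nonneg_right ?_ (by positivity))
      have h6 : 2 * N ≤ 2 * N / η * s := by
        rw [div_mul_eq_mul_div, le_div_iff₀ hη]
        gcongr
      linarith
  have hlim : Tendsto (fun z : ℂ => ε / (2 * (K + 1)) * K + 2 * N / η * (K * √‖z‖)) (𝓝[cone c] 0)
      (𝓝 (ε / (2 * (K + 1)) * K)) := by
    have : Continuous fun z : ℂ => ε / (2 * (K + 1)) * K + 2 * N / η * (K * √‖z‖) := by fun_prop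
    simpa using (this.tendsto 0).mono_left (nhdsWithin_le_nhds (s := cone c))
  have hlt : ε / (2 * (K + 1)) * K < ε := by
    rw [div_mul_eq_mul_div, div_lt_iff₀ (by positivity)]
    nlinarith
  have hev : ∀ᶠ z : ℂ in 𝓝[cone c] 0, z ∈ closedBall (0 : ℂ) 1 :=
    mem_nhdsWithin_of_mem_nhds (closedBall_mem_nhds _ one_pos)
  filter_upwards [hlim.eventually (gt_mem_nhds hlt), hev, self_mem_nhdsWithin] with z hzε hz1 hz
  rw [mem_closedBall_zero_iff] at hz1
  refine lt_of_le_of_lt ?_ hzε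
  obtain ⟨hK1, hK2⟩ := hK z hz hz1
  have i1 : IntegrableOn (fun s : ℝ => heatKernel z s • φ s) (Ioi 0) := by
    simpa using integrableOn_heatKernel_smul hφ hb hz.1 0
  have i2 : IntegrableOn (fun s : ℝ => heatKernel z s • φ 0) (Ioi 0) := by
    simpa using integrableOn_heatKernel_smul (φ := fun _ => φ 0) (N := ‖φ 0‖) (ω := 0)
      continuousOn_const (by simp) hz.1 0
  have hw0 : IntegrableOn (fun s : ℝ => ‖heatKernel z s‖ * Real.exp (ω * s)) (Ioi 0) := by
    simpa using integrableOn_heatKernel_weight hz.1 0 ω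
  have hw1 : IntegrableOn (fun s : ℝ => s * (‖heatKernel z s‖ * Real.exp (ω * s))) (Ioi 0) := by
    simpa using integrableOn_heatKernel_weight hz.1 1 ω
  have e1 : (∫ s in Ioi (0 : ℝ), heatKernel z s • φ s) - φ 0 =
      ∫ s in Ioi (0 : ℝ), (heatKernel z s • φ s - heatKernel z s • φ 0) := by
    rw [integral_sub i1 i2, integral_smul_const, integral_heatKernel hz.1, one_smul]
  rw [dist_eq_norm, e1]
  calc _ ≤ ∫ s in Ioi (0 : ℝ), (ε / (2 * (K + 1)) * (‖heatKernel z s‖ * Real.exp (ω * s)) +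
        2 * N / η * (s * (‖heatKernel z s‖ * Real.exp (ω * s)))) := by
        refine norm_integral_le_of_norm_le ((hw0.const_mul _).add (hw1.const_mul _))
          ((ae_restrict_iff' measurableSet_Ioi).2 (Eventually.of_forall fun s hs => ?_))
        rw [← smul_sub, norm_smul]
        refine (mul_le_mul_of_nonneg_left (hpt s (le_of_lt hs)) (norm_nonneg _)).trans
          (le_of_eq ?_)
        ring
    _ ≤ _ := by
        rw [integral_add (hw0.const_mul _) (hw1.const_mul _), integral_const_mul,
          integral_const_mul]
        gcongr

end KernelIntegrals

/-! ### Cosine and sine families from the wave semigroup -/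

section Sine

open MeasureTheory Metric

variable {V X : Type*} [NormedAddCommGroup V] [NormedSpace ℂ V]
  [NormedAddCommGroup X] [NormedSpace ℂ X]

/-- The cosine and sine families on `[0, ∞)` of an operator `C`, exponentially bounded, the
sine family with values in `V`. -/
structure IsCosineSinePair (ι : V →L[ℂ] X) (C : X →ₗ.[ℂ] X) (M ω : ℝ)
    (c : ℝ → X →L[ℂ] X) (S : ℝ → X →L[ℂ] V) : Prop where
  omega_nonneg : 0 ≤ ω
  cos_zero : c 0 = 1
  cos_continuousOn : ∀ x, ContinuousOn (fun s => c s x) (Ici 0)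
  sin_continuousOn : ∀ x, ContinuousOn (fun s => S s x) (Ici 0)
  norm_cos_le : ∀ s, 0 ≤ s → ‖c s‖ ≤ M * Real.exp (ω * s)
  norm_sin_le : ∀ s, 0 ≤ s → ‖S s‖ ≤ M * Real.exp (ω * s)
  sin_eq : ∀ x s, 0 ≤ s → ι (S s x) = ∫ r in (0 : ℝ)..s, c r x
  integral_sin_mem : ∀ x s, 0 ≤ s → (ι (∫ r in (0 : ℝ)..s, S r x), c s x - x) ∈ C.graph
  cos_map_mem : ∀ x y, (x, y) ∈ C.graph → ∀ s, 0 ≤ s → (c s x, c s y) ∈ C.graph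
  isClosed_graph : IsClosed (C.graph : Set (X × X))

variable {ι : V →L[ℂ] X} {C : X →ₗ.[ℂ] X}

theorem GeneratesCOFWithPhaseSpace.exists_norm_le (hC : GeneratesCOFWithPhaseSpace ι C) :
    ∃ K : ℝ, 0 ≤ K ∧ ∀ v y, (ι v, y) ∈ C.graph → ‖v‖ ≤ K * (‖ι v‖ + ‖y‖) := by
  obtain ⟨K, hK⟩ := hC.embedding
  refine ⟨max K 0, le_max_right _ _, fun v y h => ?_⟩
  rw [LinearPMap.mem_graph_iff] at h
  obtain ⟨⟨w, hw⟩, h1, h2⟩ := h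
  obtain rfl : w = ι v := h1
  obtain rfl : C ⟨ι v, hw⟩ = y := h2
  exact (hK v hw).trans (mul_le_mul_of_nonneg_right (le_max_left _ _) (by positivity))

theorem GeneratesCOFWithPhaseSpace.exists_eq (hC : GeneratesCOFWithPhaseSpace ι C) {x y : X}
    (h : (x, y) ∈ C.graph) : ∃ v, ι v = x := by
  rw [LinearPMap.mem_graph_iff] at h
  obtain ⟨w, h1, -⟩ := h
  obtain ⟨v, hv⟩ := hC.domain_le w.2
  exact ⟨v, hv.trans h1⟩

variable [CompleteSpace V]

/-- Convergence in the graph of `C` forces convergence of the lifts in `V`, by the embedding of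
`D(C)`. The points `((v, 0), (0, C v))` then converge in the graph of the wave matrix, which is
closed as a generator. -/
theorem GeneratesCOFWithPhaseSpace.isClosed_graph [CompleteSpace X]
    (hC : GeneratesCOFWithPhaseSpace ι C) : IsClosed (C.graph : Set (X × X)) := by
  obtain ⟨W, hW, hgen⟩ := hC.semigroup
  have hcl := hgen.isClosed_graph hW
  obtain ⟨K, hK0, hK⟩ := hC.exists_norm_le
  refine IsSeqClosed.isClosed fun p q hp hpq => ?_
  choose v hv using fun n => hC.exists_eq (x := (p n).1) (y := (p n).2) (hp n)
  have hvn : ∀ n m, dist (v n) (v m) ≤ 2 * K * dist (p n) (p m) := by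
    intro n m
    have h1 : (ι (v n - v m), (p n).2 - (p m).2) ∈ C.graph := by
      rw [map_sub, hv, hv]
      exact C.graph.sub_mem (hp n) (hp m)
    have h2 := hK _ _ h1
    rw [map_sub, hv, hv, ← dist_eq_norm, ← dist_eq_norm, ← dist_eq_norm] at h2
    have h3 : dist (p n).1 (p m).1 ≤ dist (p n) (p m) := le_max_left _ _
    have h4 : dist (p n).2 (p m).2 ≤ dist (p n) (p m) := le_max_right _ _
    refine h2.trans ?_
    nlinarith
  have hcau : CauchySeq v := by
    have hp' := hpq.cauchySeq
    rw [cauchySeq_iff_tendsto_dist_atTop_0] at hp' ⊢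
    have := hp'.const_mul (2 * K)
    rw [mul_zero] at this
    exact squeeze_zero (fun _ => dist_nonneg) (fun n => hvn _ _) this
  obtain ⟨w, hw⟩ := cauchySeq_tendsto_of_complete hcau
  have hx : ι w = q.1 := by
    have h1 := (ι.continuous.tendsto w).comp hw
    have h2 := (continuous_fst.tendsto q).comp hpq
    refine tendsto_nhds_unique (h1.congr fun n => ?_) h2
    exact hv n
  have hmem : ((w, (0 : X)), ((0 : V), q.2)) ∈ (waveMatrix ι hC.injective C).graph := by
    refine hcl.mem_of_tendsto (((hw.prodMk_nhds tendsto_const_nhds).prodMk_nhds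
      (tendsto_const_nhds.prodMk_nhds ((continuous_snd.tendsto q).comp hpq))))
      (Eventually.of_forall fun n => ?_)
    rw [SetLike.mem_coe, mem_graph_waveMatrix_iff]
    refine ⟨by simp, ?_⟩
    rw [hv]
    exact hp n
  rw [mem_graph_waveMatrix_iff, hx] at hmem
  exact hmem.2

/-- The second column of the wave semigroup is the pair: `W s (0, x) = (S s x, c s x)`. That `∫ W
(0, x)` lies in the domain of the generator encodes both that sine is the primitive of cosine and
that `C` maps the primitive of sine to `c s x - x`. -/
theorem GeneratesCOFWithPhaseSpace.exists_cosineSinePair [CompleteSpace X]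
    (hC : GeneratesCOFWithPhaseSpace ι C) :
    ∃ (M ω : ℝ) (c : ℝ → X →L[ℂ] X) (S : ℝ → X →L[ℂ] V), IsCosineSinePair ι C M ω c S := by
  have hcl := hC.isClosed_graph
  obtain ⟨W, hW, hgen⟩ := hC.semigroup
  obtain ⟨M, ω, hM, hω, hbd⟩ := hW.exists_bound
  have hint : ∀ (x : V × X) (s : ℝ), 0 ≤ s → IntervalIntegrable (fun r => W r x) volume 0 s :=
    fun x s hs => hW.intervalIntegrable x le_rfl hs
  have hWx : ∀ (x : X) (s : ℝ), 0 ≤ s → ‖W s (0, x)‖ ≤ M * Real.exp (ω * s) * ‖x‖ := by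
    intro x s hs
    refine ((W s).le_of_opNorm_le (hbd s hs) _).trans_eq ?_
    simp [Prod.norm_def]
  have hkey : ∀ (x : X) (s : ℝ), 0 ≤ s →
      ι (W s (0, x)).1 = ∫ r in (0 : ℝ)..s, (W r (0, x)).2 ∧
      (ι (∫ r in (0 : ℝ)..s, (W r (0, x)).1), (W s (0, x)).2 - x) ∈ C.graph := by
    intro x s hs
    have h1 := hgen.integral_mem_graph hW (0, x) hs
    have e1 : (∫ r in (0 : ℝ)..s, W r (0, x)).1 = ∫ r in (0 : ℝ)..s, (W r (0, x)).1 :=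
      ((ContinuousLinearMap.fst ℂ V X).intervalIntegral_comp_comm (hint _ s hs)).symm
    have e2 : (∫ r in (0 : ℝ)..s, W r (0, x)).2 = ∫ r in (0 : ℝ)..s, (W r (0, x)).2 :=
      ((ContinuousLinearMap.snd ℂ V X).intervalIntegral_comp_comm (hint _ s hs)).symm
    have h2 := (mem_graph_waveMatrix_iff ι hC.injective C (∫ r in (0 : ℝ)..s, W r (0, x)).1
      (W s (0, x) - (0, x)).1 (∫ r in (0 : ℝ)..s, W r (0, x)).2 (W s (0, x) - (0, x)).2).1 h1
    rw [e1, e2] at h2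
    simp only [Prod.fst_sub, Prod.snd_sub, sub_zero] at h2
    exact ⟨h2.1.symm, h2.2⟩
  refine ⟨M, ω, fun s => (ContinuousLinearMap.snd ℂ V X) ∘L (W s) ∘L
    (ContinuousLinearMap.inr ℂ V X), fun s => (ContinuousLinearMap.fst ℂ V X) ∘L (W s) ∘L
    (ContinuousLinearMap.inr ℂ V X), hω, ?_, fun x => ?_, fun x => ?_, fun s hs => ?_,
    fun s hs => ?_, fun x s hs => (hkey x s hs).1, fun x s hs => (hkey x s hs).2,
    fun x y hxy s hs => ?_, hcl⟩
  · ext x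
    simp [hW.map_zero]
  · exact continuous_snd.comp_continuousOn (hW.continuousOn (0, x))
  · exact continuous_fst.comp_continuousOn (hW.continuousOn (0, x))
  · exact ContinuousLinearMap.opNorm_le_bound _ (by positivity) fun x =>
      (le_max_right _ _).trans (hWx x s hs)
  · exact ContinuousLinearMap.opNorm_le_bound _ (by positivity) fun x =>
      (le_max_left _ _).trans (hWx x s hs)
  -- The wave matrix acts along the chain `(0, ι v) ↦ (v, 0) ↦ (0, y)`, and the semigroup preserves
  -- both links. The first link identifies `c s (ι v)` with the first coordinate of `W s (v, 0)`;
  -- the second applies `C` to it.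
  · obtain ⟨v, rfl⟩ := hC.exists_eq hxy
    have g1 : (((0 : V), ι v), (v, (0 : X))) ∈ (waveMatrix ι hC.injective C).graph := by
      rw [mem_graph_waveMatrix_iff, map_zero]
      exact ⟨rfl, C.graph.zero_mem⟩
    have g2 : ((v, (0 : X)), ((0 : V), y)) ∈ (waveMatrix ι hC.injective C).graph := by
      rw [mem_graph_waveMatrix_iff]
      exact ⟨by simp, hxy⟩
    have k1 := (mem_graph_waveMatrix_iff ι hC.injective C (W s (0, ι v)).1 (W s (v, 0)).1
      (W s (0, ι v)).2 (W s (v, 0)).2).1 (hgen.map_mem_graph hW g1 hs)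
    have k2 := (mem_graph_waveMatrix_iff ι hC.injective C (W s (v, 0)).1 (W s (0, y)).1
      (W s (v, 0)).2 (W s (0, y)).2).1 (hgen.map_mem_graph hW g2 hs)
    change ((W s (0, ι v)).2, (W s (0, y)).2) ∈ C.graph
    rw [k1.1]
    exact k2.2

end Sine

/-! ### The Weierstrass formula and its lift to `V` -/

section HeatPair

open MeasureTheory Metric

theorem hasDerivAt_ofReal_of_differentiableOn {G : Type*} [NormedAddCommGroup G] [NormedSpace ℂ G]
    {f : ℂ → G} (hf : DifferentiableOn ℂ f {z | 0 < z.re}) {t : ℝ} (ht : 0 < t) :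
    HasDerivAt (fun t : ℝ => f t) (deriv f t) t := by
  have h1 : HasDerivAt (fun s : ℝ => (s : ℂ)) 1 t := Complex.ofRealCLM.hasDerivAt
  have h2 := (hf.differentiableAt (isOpen_re_pos.mem_nhds
    (show (t : ℂ) ∈ {z : ℂ | 0 < z.re} by simpa using ht))).hasDerivAt
  refine HasDerivAt.congr_deriv (f := fun t : ℝ => f t) (HasDerivAt.scomp t h2 h1) ?_
  simp

/-- The function `r ↦ T (τ - r) (U r)` has zero derivative, so it keeps its limiting value at `r =
0`. This is the common core of the semigroup law and of uniqueness of solutions. -/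
theorem apply_eq_of_deriv_apply_eq {Y Z : Type*} [NormedAddCommGroup Y] [NormedSpace ℂ Y]
    [NormedAddCommGroup Z] [NormedSpace ℂ Z] {T : ℂ → Y →L[ℂ] Z} {U U' : ℝ → Y} {u₀ : Y} {τ : ℝ}
    (hT : DifferentiableOn ℂ T {z | 0 < z.re}) (hU : ∀ s ∈ Ioo 0 τ, HasDerivAt U (U' s) s)
    (h : ∀ s ∈ Ioo 0 τ, deriv T ((τ - s : ℝ) : ℂ) (U s) = T ((τ - s : ℝ) : ℂ) (U' s))
    (h0 : Tendsto U (𝓝[>] 0) (𝓝 u₀)) {s : ℝ} (hs : s ∈ Ioo 0 τ) :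
    T ((τ - s : ℝ) : ℂ) (U s) = T τ u₀ := by
  have hτ : 0 < τ := hs.1.trans hs.2
  have hd : ∀ r ∈ Ioo 0 τ, HasDerivAt (fun r : ℝ => T ((τ - r : ℝ) : ℂ) (U r)) 0 r := by
    intro r hr
    have h1 := hasDerivAt_ofReal_of_differentiableOn hT (t := τ - r) (by linarith [hr.2])
    have h2 : HasDerivAt (fun r : ℝ => T ((τ - r : ℝ) : ℂ)) (-deriv T ((τ - r : ℝ) : ℂ)) r := by
      have h3 := HasDerivAt.scomp r h1 ((hasDerivAt_id r).const_sub τ)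
      refine HasDerivAt.congr_deriv (f := fun r : ℝ => T ((τ - r : ℝ) : ℂ)) h3 ?_
      simp
    have h3 := (ContinuousLinearMap.restrictScalarsL ℂ Y Z ℝ ℝ).hasFDerivAt.comp_hasDerivAt r h2
    have h4 := h3.clm_apply (hU r hr)
    refine h4.congr_deriv ?_
    change -deriv T ((τ - r : ℝ) : ℂ) (U r) + T ((τ - r : ℝ) : ℂ) (U' r) = 0
    rw [h r hr, neg_add_cancel]
  obtain ⟨k, hk⟩ := isOpen_Ioo.exists_is_const_of_deriv_eq_zero (convex_Ioo 0 τ).isPreconnected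
    (fun r hr => (hd r hr).differentiableAt.differentiableWithinAt)
    (fun r hr => (hd r hr).deriv)
  have hlim : Tendsto (fun r : ℝ => T ((τ - r : ℝ) : ℂ) (U r)) (𝓝[>] 0) (𝓝 (T τ u₀)) := by
    have hc : ContinuousAt T (τ : ℂ) := (hT.differentiableAt (isOpen_re_pos.mem_nhds
      (show (τ : ℂ) ∈ {z : ℂ | 0 < z.re} by simpa using hτ))).continuousAt
    have h5 : Tendsto (fun r : ℝ => ((τ - r : ℝ) : ℂ)) (𝓝[>] 0) (𝓝 (τ : ℂ)) := by
      have : Continuous fun r : ℝ => ((τ - r : ℝ) : ℂ) := by fun_prop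
      simpa using (this.tendsto 0).mono_left (nhdsWithin_le_nhds (s := Ioi 0))
    exact (isBoundedBilinearMap_apply.continuous.tendsto (T τ, u₀)).comp
      ((hc.tendsto.comp h5).prodMk_nhds h0)
  rw [hk s hs]
  refine tendsto_nhds_unique (tendsto_const_nhds.congr' ?_) hlim
  filter_upwards [Ioo_mem_nhdsGT hτ] with r hr
  exact (hk r hr).symm

/-- Extending `f` to negative times by its value at `0` makes it continuous on the line without
changing the primitive on `[0, ∞)`. -/
theorem exists_primitive {G : Type*} [NormedAddCommGroup G] [NormedSpace ℝ G] [CompleteSpace G]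
    {f : ℝ → G} (hf : ContinuousOn f (Ici 0)) :
    ContinuousOn (fun s => ∫ r in (0 : ℝ)..s, f r) (Ici 0) ∧
      ∀ s, 0 < s → HasDerivAt (fun s => ∫ r in (0 : ℝ)..s, f r) (f s) s := by
  have hg : Continuous fun s => f (max s 0) :=
    hf.comp_continuous (by fun_prop) fun s => le_max_right s 0
  have heq : EqOn (fun s => ∫ r in (0 : ℝ)..s, f r) (fun s => ∫ r in (0 : ℝ)..s, f (max r 0))
      (Ici 0) := by
    intro s hs
    refine intervalIntegral.integral_congr fun r hr => ?_
    rw [uIcc_of_le hs] at hr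
    simp only [max_eq_left hr.1]
  have hd : ∀ s, HasDerivAt (fun s => ∫ r in (0 : ℝ)..s, f (max r 0)) (f (max s 0)) s := fun s =>
    intervalIntegral.integral_hasDerivAt_right (hg.intervalIntegrable _ _)
      (hg.stronglyMeasurableAtFilter _ _) hg.continuousAt
  refine ⟨ContinuousOn.congr (fun s _ => (hd s).continuousAt.continuousWithinAt) heq,
    fun s hs => ?_⟩
  have := (hd s).congr_of_eventuallyEq (heq.eventuallyEq_of_mem (Ici_mem_nhds hs))
  rwa [max_eq_left hs.le] at this

theorem exists_heatKernel_clm {X Y : Type*} [NormedAddCommGroup X] [NormedSpace ℂ X]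
    [CompleteSpace X] [NormedAddCommGroup Y] [NormedSpace ℂ Y] [CompleteSpace Y]
    {Φ : ℝ → X →L[ℂ] Y} {M ω : ℝ} (hΦ : ∀ x, ContinuousOn (fun s => Φ s x) (Ici 0))
    (hb : ∀ s, 0 ≤ s → ‖Φ s‖ ≤ M * Real.exp (ω * s)) (n : ℕ) :
    ∃ L : ℂ → X →L[ℂ] Y, DifferentiableOn ℂ L {z | 0 < z.re} ∧
      (∀ z : ℂ, 0 < z.re → ∀ x,
        L z x = ∫ s in Ioi (0 : ℝ), ((s : ℂ) ^ n * heatKernel z s) • Φ s x) ∧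
      ∀ z : ℂ, 0 < z.re →
        ‖L z‖ ≤ M * ∫ s in Ioi (0 : ℝ), s ^ n * (‖heatKernel z s‖ * Real.exp (ω * s)) := by
  have hbx : ∀ x s, 0 ≤ s → ‖Φ s x‖ ≤ M * ‖x‖ * Real.exp (ω * s) := fun x s hs =>
    ((Φ s).le_of_opNorm_le (hb s hs) x).trans_eq (by ring)
  have hex : ∀ z : ℂ, ∃ L : X →L[ℂ] Y, 0 < z.re →
      (∀ x, L x = ∫ s in Ioi (0 : ℝ), ((s : ℂ) ^ n * heatKernel z s) • Φ s x) ∧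
      ‖L‖ ≤ M * ∫ s in Ioi (0 : ℝ), s ^ n * (‖heatKernel z s‖ * Real.exp (ω * s)) := by
    intro z
    by_cases hz : 0 < z.re
    · obtain ⟨L, hL1, hL2⟩ := exists_clm_integral (μ := volume.restrict (Ioi (0 : ℝ)))
        (Φ := fun s => ((s : ℂ) ^ n * heatKernel z s) • Φ s)
        ((integrableOn_heatKernel_weight hz n ω).const_mul M)
        (fun x => aestronglyMeasurable_heatKernel_smul (hΦ x) z n)
        ((ae_restrict_iff' measurableSet_Ioi).2 (Eventually.of_forall fun s hs =>
          norm_heatKernel_smul_le hb z n (le_of_lt hs)))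
      rw [integral_const_mul] at hL2
      exact ⟨L, fun _ => ⟨hL1, hL2⟩⟩
    · exact ⟨0, fun h => absurd h hz⟩
  choose L hL using hex
  refine ⟨L, differentiableOn_clm_of_strong isOpen_re_pos fun x z hz => ?_,
    fun z hz => (hL z hz).1, fun z hz => (hL z hz).2⟩
  have h1 := (hasDerivAt_integral_heatKernel (hΦ x) (hbx x) hz n).differentiableAt
  refine (h1.congr_of_eventuallyEq ?_).differentiableWithinAt
  filter_upwards [isOpen_re_pos.mem_nhds hz] with w hw
  exact (hL w hw).1 x

variable {V X : Type*} [NormedAddCommGroup V] [NormedSpace ℂ V]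
  [NormedAddCommGroup X] [NormedSpace ℂ X]

/-- `E` is the holomorphic family `exp (z C)` on the right half-plane, and `Y` is the same family
with values in `V`. -/
structure IsHeatPair (ι : V →L[ℂ] X) (C : X →ₗ.[ℂ] X)
    (E : ℂ → X →L[ℂ] X) (Y : ℂ → X →L[ℂ] V) : Prop where
  diff : DifferentiableOn ℂ E {z | 0 < z.re}
  diff_lift : DifferentiableOn ℂ Y {z | 0 < z.re}
  lift : ∀ z : ℂ, 0 < z.re → ∀ x, ι (Y z x) = E z x
  bound : ∀ c R : ℝ, 0 < c → ∃ M, 0 ≤ M ∧ ∀ z ∈ cone c, ‖z‖ ≤ R → ‖E z‖ ≤ M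
  bound_lift : ∀ c R : ℝ, 0 < c → ∃ M, 0 ≤ M ∧ ∀ z ∈ cone c, ‖z‖ ≤ R → ‖Y z‖ ≤ M / √‖z‖
  strongCont : ∀ c : ℝ, 0 < c → ∀ x, Tendsto (fun z => E z x) (𝓝[cone c] 0) (𝓝 x)
  mem_graph : ∀ z : ℂ, 0 < z.re → ∀ x, (E z x, deriv E z x) ∈ C.graph
  map_mem : ∀ x y, (x, y) ∈ C.graph → ∀ z : ℂ, 0 < z.re → (E z x, E z y) ∈ C.graph

variable {ι : V →L[ℂ] X} {C : X →ₗ.[ℂ] X} [CompleteSpace V] [CompleteSpace X]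

/-- `E z` is the Weierstrass integral of the cosine family, and `Y z` is `1 / (2 z)` times the
first-moment integral of the sine family; they agree by one integration by parts. After a second
one, `E z x` and its `z`-derivative are integrals of the first and second coordinates of a curve in
the graph of `C` against the same kernel, so closedness puts the pair in the graph. -/
theorem IsCosineSinePair.exists_heatPair {M ω : ℝ} {c : ℝ → X →L[ℂ] X} {S : ℝ → X →L[ℂ] V}
    (h : IsCosineSinePair ι C M ω c S) :
    ∃ (E : ℂ → X →L[ℂ] X) (Y : ℂ → X →L[ℂ] V), IsHeatPair ι C E Y := by
  have hM0 : 0 ≤ M := by simpa using (norm_nonneg _).trans (h.norm_cos_le 0 le_rfl)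
  obtain ⟨E, hEd, hE, hEb⟩ := exists_heatKernel_clm h.cos_continuousOn h.norm_cos_le 0
  obtain ⟨Z, hZd, hZ, hZb⟩ := exists_heatKernel_clm h.sin_continuousOn h.norm_sin_le 1
  simp only [pow_zero, one_mul] at hE hEb
  -- The primitive of the sine family costs a factor `s`, absorbed by raising the exponential rate
  -- from `ω` to `ω + 1`.
  have hexp : ∀ s, 0 ≤ s → Real.exp (ω * s) ≤ Real.exp ((ω + 1) * s) := fun s hs =>
    Real.exp_le_exp.2 (by nlinarith)
  have hcb : ∀ x s, 0 ≤ s → ‖c s x‖ ≤ M * ‖x‖ * Real.exp (ω * s) := fun x s hs =>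
    ((c s).le_of_opNorm_le (h.norm_cos_le s hs) x).trans_eq (by ring)
  have hSb : ∀ x s, 0 ≤ s → ‖S s x‖ ≤ M * ‖x‖ * Real.exp (ω * s) := fun x s hs =>
    ((S s).le_of_opNorm_le (h.norm_sin_le s hs) x).trans_eq (by ring)
  have hSb' : ∀ x s, 0 ≤ s → ‖S s x‖ ≤ M * ‖x‖ * Real.exp ((ω + 1) * s) := fun x s hs =>
    (hSb x s hs).trans (mul_le_mul_of_nonneg_left (hexp s hs) (by positivity))
  have hab : ∀ x s, 0 ≤ s →
      ‖∫ r in (0 : ℝ)..s, S r x‖ ≤ M * ‖x‖ * Real.exp ((ω + 1) * s) := by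
    intro x s hs
    have h1 : ‖∫ r in (0 : ℝ)..s, S r x‖ ≤ M * ‖x‖ * Real.exp (ω * s) * |s - 0| := by
      refine intervalIntegral.norm_integral_le_of_norm_le_const fun r hr => ?_
      rw [uIoc_of_le hs] at hr
      refine (hSb x r hr.1.le).trans ?_
      have := h.omega_nonneg
      gcongr
      exact hr.2
    rw [sub_zero, abs_of_nonneg hs] at h1
    refine h1.trans ?_
    rw [add_mul, one_mul, Real.exp_add, ← mul_assoc]
    gcongr
    linarith [Real.add_one_le_exp s]
  have hιY : ∀ z : ℂ, 0 < z.re → ∀ x, ι (((1 / (2 * z)) • Z z) x) = E z x := by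
    intro z hz x
    have hprim := exists_primitive (h.cos_continuousOn x)
    have hφ : ContinuousOn (fun s => ι (S s x)) (Ici 0) :=
      ι.continuous.comp_continuousOn (h.sin_continuousOn x)
    have h1 := integral_heatKernel_smul_deriv (φ := fun s => ι (S s x)) (ψ := fun s => c s x)
      (N := ‖ι‖ * (M * ‖x‖)) hφ (h.cos_continuousOn x)
      (fun s hs => (hprim.2 s hs).congr_of_eventuallyEq ?_) ?_ (fun s hs => ?_) (hcb x) hz
    · rw [hE z hz, h1, _root_.smul_apply, map_smul, hZ z hz,
        ← ContinuousLinearMap.integral_comp_comm _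
          (integrableOn_heatKernel_smul (h.sin_continuousOn x) (hSb x) hz 1)]
      simp only [map_smul]
    · filter_upwards [Ici_mem_nhds hs] with r hr
      exact h.sin_eq x r hr
    · simpa using h.sin_eq x 0 le_rfl
    · refine (ι.le_opNorm _).trans ?_
      rw [mul_assoc]
      exact mul_le_mul_of_nonneg_left (hSb x s hs) (norm_nonneg _)
  refine ⟨E, fun z => (1 / (2 * z)) • Z z, hEd, ?_, hιY, ?_, ?_, ?_, ?_, ?_⟩
  · refine DifferentiableOn.fun_smul (DifferentiableOn.div (by fun_prop) (by fun_prop)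
      fun z hz h0 => ?_) hZd
    have : z = 0 := by simpa using h0
    simp [this] at hz
  · intro a R ha
    obtain ⟨K, hK0, hK⟩ := integral_heatKernel_weight_le (R := R) (ω := ω) ha
    exact ⟨M * K, by positivity, fun z hz hR => (hEb z hz.1).trans
      (mul_le_mul_of_nonneg_left (hK z hz hR).1 hM0)⟩
  · intro a R ha
    obtain ⟨K, hK0, hK⟩ := integral_heatKernel_weight_le (R := R) (ω := ω) ha
    refine ⟨M * K / 2, by positivity, fun z hz hR => ?_⟩
    have hz0 : 0 < ‖z‖ := hz.1.trans_le (Complex.re_le_norm z)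
    have hsq : 0 < √‖z‖ := Real.sqrt_pos.2 hz0
    have h1 := (hZb z hz.1).trans (mul_le_mul_of_nonneg_left (by simpa using (hK z hz hR).2) hM0)
    rw [norm_smul, norm_div, norm_mul, norm_one, Complex.norm_ofNat]
    calc _ ≤ 1 / (2 * ‖z‖) * (M * (K * √‖z‖)) := by gcongr
      _ = 1 / (2 * (√‖z‖ * √‖z‖)) * (M * (K * √‖z‖)) := by rw [Real.mul_self_sqrt hz0.le]
      _ = _ := by field_simp
  · intro a ha x
    have h1 := tendsto_integral_heatKernel ha h.omega_nonneg (h.cos_continuousOn x) (hcb x)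
    simp only [h.cos_zero, one_apply_eq_self] at h1
    refine h1.congr' ?_
    filter_upwards [self_mem_nhdsWithin] with z hz
    exact (hE z hz.1 x).symm
  · intro z hz x
    obtain ⟨hprim1, hprim2⟩ := exists_primitive (h.sin_continuousOn x)
    have hιprim : ContinuousOn (fun s => ι (∫ r in (0 : ℝ)..s, S r x)) (Ici 0) :=
      ι.continuous.comp_continuousOn hprim1
    have hιab : ∀ s, 0 ≤ s → ‖ι (∫ r in (0 : ℝ)..s, S r x)‖ ≤
        ‖ι‖ * (M * ‖x‖) * Real.exp ((ω + 1) * s) := fun s hs => by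
      refine (ι.le_opNorm _).trans ?_
      rw [mul_assoc]
      exact mul_le_mul_of_nonneg_left (hab x s hs) (norm_nonneg _)
    have i1 := integrableOn_heatKernel₂_smul hιprim hιab hz
    have i2 := integrableOn_heatKernel₂_smul (h.cos_continuousOn x) (hcb x) hz
    have i3 : IntegrableOn (fun s : ℝ => heatKernel₂ z s • x) (Ioi 0) :=
      integrableOn_heatKernel₂_smul (φ := fun _ => x) (N := ‖x‖) (ω := 0) continuousOn_const
        (by simp) hz
    have e1 : E z x = ∫ s in Ioi (0 : ℝ), heatKernel₂ z s • ι (∫ r in (0 : ℝ)..s, S r x) := by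
      rw [← hιY z hz, _root_.smul_apply, hZ z hz, integral_heatKernel_smul_deriv₂ hprim1
        (h.sin_continuousOn x) hprim2 (hab x) (hSb' x) hz,
        ← ContinuousLinearMap.integral_comp_comm _
          (integrableOn_heatKernel₂_smul hprim1 (hab x) hz)]
      simp only [map_smul]
    -- The `z`-derivative falls on the kernel, and subtracting the constant `x` is free because the
    -- second-derivative kernel has mean zero.
    have e2 : deriv E z x = ∫ s in Ioi (0 : ℝ), heatKernel₂ z s • (c s x - x) := by
      have d1 : HasDerivAt (fun w => E w x) (deriv E z x) z :=
        (ContinuousLinearMap.apply ℂ X x).hasFDerivAt.comp_hasDerivAt z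
          (hEd.differentiableAt (isOpen_re_pos.mem_nhds hz)).hasDerivAt
      have d2 := hasDerivAt_integral_heatKernel (h.cos_continuousOn x) (hcb x) hz 0
      simp only [pow_zero, one_mul] at d2
      have d3 := d2.congr_of_eventuallyEq (f₁ := fun w => E w x) (by
        filter_upwards [isOpen_re_pos.mem_nhds hz] with w hw
        exact hE w hw x)
      rw [d1.unique d3]
      simp only [smul_sub]
      rw [integral_sub i2 i3, integral_heatKernel₂_smul_const hz, sub_zero]
    have i4 : IntegrableOn (fun s : ℝ => heatKernel₂ z s • (c s x - x)) (Ioi 0) := by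
      simp only [smul_sub]
      exact i2.sub i3
    rw [e1, e2, ← integral_pair i1 i4]
    refine integral_mem_of_isClosed C.graph h.isClosed_graph (i1.prodMk i4)
      ((ae_restrict_iff' measurableSet_Ioi).2 (Eventually.of_forall fun s hs => ?_))
    exact C.graph.smul_mem _ (h.integral_sin_mem x s (le_of_lt hs))
  · intro x y hxy z hz
    have i1 := integrableOn_heatKernel_smul (h.cos_continuousOn x) (hcb x) hz 0
    have i2 := integrableOn_heatKernel_smul (h.cos_continuousOn y) (hcb y) hz 0
    simp only [pow_zero, one_mul] at i1 i2
    rw [hE z hz, hE z hz, ← integral_pair i1 i2]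
    refine integral_mem_of_isClosed C.graph h.isClosed_graph (i1.prodMk i2)
      ((ae_restrict_iff' measurableSet_Ioi).2 (Eventually.of_forall fun s hs => ?_))
    exact C.graph.smul_mem _ (h.cos_map_mem x y hxy s (le_of_lt hs))

end HeatPair

/-! ### The semigroup law and generator of `E`, and the primitive of `Y` -/

section HeatSemigroup

open MeasureTheory Metric

theorem hasDerivAt_apply_ofReal {Y Z : Type*} [NormedAddCommGroup Y] [NormedSpace ℂ Y]
    [NormedAddCommGroup Z] [NormedSpace ℂ Z] {T : ℂ → Y →L[ℂ] Z}
    (hT : DifferentiableOn ℂ T {z | 0 < z.re}) (x : Y) {t : ℝ} (ht : 0 < t) :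
    HasDerivAt (fun t : ℝ => T t x) (deriv T t x) t := by
  have h1 := (ContinuousLinearMap.restrictScalarsL ℂ Y Z ℝ ℝ).hasFDerivAt.comp_hasDerivAt t
    (hasDerivAt_ofReal_of_differentiableOn hT ht)
  exact (h1.clm_apply (hasDerivAt_const t x)).congr_deriv (by simp)

/-- The function is given the value `a` at `0`; a function continuous up to the endpoint whose
derivative has a limit there is one-sidedly differentiable with that limit. -/
theorem tendsto_slope_of_tendsto_deriv {G : Type*} [NormedAddCommGroup G] [NormedSpace ℝ G]
    {f f' : ℝ → G} {a b : G} (hf : ∀ t, 0 < t → HasDerivAt f (f' t) t)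
    (h0 : Tendsto f (𝓝[>] 0) (𝓝 a)) (h1 : Tendsto f' (𝓝[>] 0) (𝓝 b)) :
    Tendsto (fun t : ℝ => (t⁻¹ : ℝ) • (f t - a)) (𝓝[>] 0) (𝓝 b) := by
  classical
  have hev : ∀ t : ℝ, 0 < t → Function.update f 0 a =ᶠ[𝓝 t] f := fun t ht => by
    filter_upwards [Ioi_mem_nhds ht] with s hs
    exact Function.update_of_ne (ne_of_gt hs) _ _
  have hd : ∀ t : ℝ, 0 < t → HasDerivAt (Function.update f 0 a) (f' t) t := fun t ht =>
    (hf t ht).congr_of_eventuallyEq (hev t ht)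
  have hw := hasDerivWithinAt_Ici_of_tendsto_deriv (s := Ioi 0) (a := 0) (e := b)
    (f := Function.update f 0 a)
    (fun t ht => (hd t ht).differentiableAt.differentiableWithinAt) ?_ self_mem_nhdsWithin ?_
  · rw [hasDerivWithinAt_iff_tendsto_slope, Ici_sdiff_left] at hw
    refine hw.congr' ?_
    filter_upwards [self_mem_nhdsWithin] with t ht
    rw [slope_def_module, Function.update_self, Function.update_of_ne (ne_of_gt ht), sub_zero]
  · rw [ContinuousWithinAt, Function.update_self]
    refine h0.congr' ?_
    filter_upwards [self_mem_nhdsWithin] with t ht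
    exact (Function.update_of_ne (ne_of_gt ht) _ _).symm
  · refine h1.congr' ?_
    filter_upwards [self_mem_nhdsWithin] with t ht
    exact (hd t ht).deriv.symm

variable {V X : Type*} [NormedAddCommGroup V] [NormedSpace ℂ V]
  [NormedAddCommGroup X] [NormedSpace ℂ X] {ι : V →L[ℂ] X} {C : X →ₗ.[ℂ] X}
  {E : ℂ → X →L[ℂ] X} {Y : ℂ → X →L[ℂ] V}

theorem IsHeatPair.tendsto_zero (h : IsHeatPair ι C E Y) (x : X) :
    Tendsto (fun t : ℝ => E t x) (𝓝[>] 0) (𝓝 x) :=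
  (h.strongCont 1 one_pos x).comp tendsto_ofReal_cone

/-- Both sides are the value of `C` at `E z x`: the left by smoothing, the right because `E z`
commutes with `C` on its domain. -/
theorem IsHeatPair.deriv_apply (h : IsHeatPair ι C E Y) {x y : X} (hxy : (x, y) ∈ C.graph)
    {z : ℂ} (hz : 0 < z.re) : deriv E z x = E z y :=
  C.mem_graph_snd_inj' (h.mem_graph z hz x) (h.map_mem x y hxy z hz) rfl

theorem IsHeatPair.map_add (h : IsHeatPair ι C E Y) {s t : ℝ} (hs : 0 < s) (ht : 0 < t) :
    E ((s + t : ℝ) : ℂ) = E s * E t := by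
  ext x
  have h1 := apply_eq_of_deriv_apply_eq (T := E) (U := fun r : ℝ => E r x)
    (U' := fun r : ℝ => deriv E r x) (τ := s + t) (s := t) h.diff
    (fun r hr => hasDerivAt_apply_ofReal h.diff x hr.1)
    (fun r hr => h.deriv_apply (h.mem_graph r (by simpa using hr.1) x) (by
      rw [Complex.ofReal_re]
      linarith [hr.2])) (h.tendsto_zero x) ⟨ht, by linarith⟩
  rw [← h1, add_sub_cancel_right]
  rfl

/-- For the converse, `E ε` smooths: `E ε x` lies in `D(C)`, and `C` maps it to the derivative of
the orbit at `ε`, which is `E ε y` by the semigroup law. Letting `ε → 0` uses closedness of `C`. -/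
theorem IsHeatPair.mem_graph_iff (h : IsHeatPair ι C E Y)
    (hcl : IsClosed (C.graph : Set (X × X))) {x y : X} : (x, y) ∈ C.graph ↔
      Tendsto (fun t : ℝ => (t⁻¹ : ℝ) • (E t x - x)) (𝓝[>] 0) (𝓝 y) := by
  constructor
  · intro hxy
    refine tendsto_slope_of_tendsto_deriv (fun t ht => hasDerivAt_apply_ofReal h.diff x ht)
      (h.tendsto_zero x) ((h.tendsto_zero y).congr' ?_)
    filter_upwards [self_mem_nhdsWithin] with t ht
    exact (h.deriv_apply hxy (by simpa using ht)).symm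
  · intro hlim
    have hmem : ∀ ε : ℝ, 0 < ε → (E ε x, E ε y) ∈ C.graph := by
      intro ε hε
      have h1 : Tendsto (fun t : ℝ => (t⁻¹ : ℝ) • (E ((ε + t : ℝ) : ℂ) x - E ε x)) (𝓝[>] 0)
          (𝓝 (deriv E ε x)) := by
        have hd := (hasDerivAt_apply_ofReal h.diff x hε).tendsto_slope_zero
        exact hd.mono_left (nhdsWithin_mono _ fun t ht => ne_of_gt ht)
      have h2 : Tendsto (fun t : ℝ => (t⁻¹ : ℝ) • (E ((ε + t : ℝ) : ℂ) x - E ε x)) (𝓝[>] 0)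
          (𝓝 (E ε y)) := by
        refine (((E ε).continuous.tendsto y).comp hlim).congr' ?_
        filter_upwards [self_mem_nhdsWithin] with t ht
        rw [mem_Ioi] at ht
        simp only [Function.comp, h.map_add hε ht]
        rw [ContinuousLinearMap.map_smul_of_tower, map_sub]
        rfl
      rw [← tendsto_nhds_unique h1 h2]
      exact h.mem_graph ε (by simpa using hε) x
    refine hcl.mem_of_tendsto ((h.tendsto_zero x).prodMk_nhds (h.tendsto_zero y)) ?_
    filter_upwards [self_mem_nhdsWithin] with ε hε
    exact hmem ε hε

theorem IsHeatPair.lift_add (h : IsHeatPair ι C E Y) (hι : Function.Injective ι) {s t : ℝ}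
    (hs : 0 < s) (ht : 0 < t) : Y ((s + t : ℝ) : ℂ) = Y s ∘L E t := by
  ext x
  apply hι
  rw [h.lift _ (by rw [Complex.ofReal_re]; positivity), h.map_add hs ht,
    ContinuousLinearMap.comp_apply, h.lift _ (by simpa using hs)]
  rfl

/-- On `D(C)` the orbit converges in the graph norm, which controls the norm of `V`. For general
vectors only the bound of order `t^(-1/2)` is at hand. -/
theorem IsHeatPair.tendsto_lift (h : IsHeatPair ι C E Y) {K : ℝ}
    (hK : ∀ v y, (ι v, y) ∈ C.graph → ‖v‖ ≤ K * (‖ι v‖ + ‖y‖)) {v : V} {y : X}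
    (hvy : (ι v, y) ∈ C.graph) : Tendsto (fun t : ℝ => Y t (ι v)) (𝓝[>] 0) (𝓝 v) := by
  have hlim := (((h.tendsto_zero (ι v)).sub_const (ι v)).norm.add
    ((h.tendsto_zero y).sub_const y).norm).const_mul K
  simp only [sub_self, norm_zero, add_zero, mul_zero] at hlim
  refine tendsto_iff_norm_sub_tendsto_zero.2 (squeeze_zero' (Eventually.of_forall fun _ =>
    norm_nonneg _) ?_ hlim)
  filter_upwards [self_mem_nhdsWithin] with t ht
  have ht' : 0 < (t : ℂ).re := by simpa using ht
  have e1 : ι (Y t (ι v) - v) = E t (ι v) - ι v := by rw [map_sub, h.lift _ ht']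
  have h1 := hK (Y t (ι v) - v) (E t y - y) (by
    rw [e1]
    exact C.graph.sub_mem (h.map_mem _ _ hvy _ ht') hvy)
  rwa [e1] at h1

/-- The integral of `Y` along the segment from `0` to `z`. -/
noncomputable def liftPrimitive (Y : ℂ → X →L[ℂ] V) (z : ℂ) : X →L[ℂ] V :=
  z • ∫ r in Ioo (0 : ℝ) 1, Y ((r : ℂ) * z)

theorem integrableOn_rpow_neg_half :
    IntegrableOn (fun r : ℝ => r ^ (-(1 / 2) : ℝ)) (Ioo 0 1) := by
  rw [← intervalIntegrable_iff_integrableOn_Ioo_of_le zero_le_one]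
  exact intervalIntegral.intervalIntegrable_rpow' (by norm_num)

theorem div_sqrt_norm_mul {M r : ℝ} (hr : 0 < r) (z : ℂ) :
    M / √‖(r : ℂ) * z‖ = M / √‖z‖ * r ^ (-(1 / 2) : ℝ) := by
  rw [norm_mul, Complex.norm_real, Real.norm_of_nonneg hr.le, Real.sqrt_mul hr.le,
    Real.rpow_neg hr.le, ← Real.sqrt_eq_rpow, mul_comm √r, ← div_div, div_eq_mul_inv _ √r]

theorem IsHeatPair.aestronglyMeasurable_lift (h : IsHeatPair ι C E Y) {z : ℂ} (hz : 0 < z.re) :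
    AEStronglyMeasurable (fun r : ℝ => Y ((r : ℂ) * z)) (volume.restrict (Ioo 0 1)) := by
  refine ContinuousOn.aestronglyMeasurable (h.diff_lift.continuousOn.comp (by fun_prop)
    fun r hr => ?_) measurableSet_Ioo
  simp only [mem_ofPred_eq, Complex.re_ofReal_mul]
  exact mul_pos hr.1 hz

theorem IsHeatPair.differentiableOn_liftPrimitive (h : IsHeatPair ι C E Y) :
    DifferentiableOn ℂ (liftPrimitive Y) {z | 0 < z.re} := by
  intro z₀ hz₀
  obtain ⟨ε, c, R, r₀, hε, hc, hR, hr₀, hball⟩ := exists_ball_subset_cone hz₀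
  obtain ⟨M, hM0, hM⟩ := h.bound_lift c R hc
  have key := hasDerivAt_integral_of_differentiableOn (μ := volume.restrict (Ioo (0 : ℝ) 1))
    (F := fun z (r : ℝ) => Y ((r : ℂ) * z)) (z₀ := z₀) hε
    (bound := fun r => M / √r₀ * r ^ (-(1 / 2) : ℝ))
    (fun z hz => h.aestronglyMeasurable_lift (hball z hz).1.1) ?_ ?_
    (integrableOn_rpow_neg_half.const_mul _)
  · exact (differentiableAt_id.smul key.differentiableAt).differentiableWithinAt
  · refine (ae_restrict_iff' measurableSet_Ioo).2 (Eventually.of_forall fun r hr => ?_)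
    refine h.diff_lift.comp (by fun_prop) fun z hz => ?_
    simp only [mem_ofPred_eq, Complex.re_ofReal_mul]
    exact mul_pos hr.1 (hball z hz).1.1
  · refine (ae_restrict_iff' measurableSet_Ioo).2 (Eventually.of_forall fun r hr z hz => ?_)
    obtain ⟨hz, hzR, hrz⟩ := hball z hz
    refine (hM _ (mul_mem_cone hz hr.1) ((norm_ofReal_mul_le hr.1.le hr.2.le z).trans hzR)).trans ?_
    rw [div_sqrt_norm_mul hr.1]
    have := hr.1
    gcongr

/-- The singularity of `Y` is an inverse square root along the segment, hence integrable, and the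
prefactor `z` leaves a total of order `√‖z‖`. So the primitive stays bounded and tends to zero at
the vertex of each cone. -/
theorem IsHeatPair.norm_liftPrimitive_le (h : IsHeatPair ι C E Y) {c R : ℝ} (hc : 0 < c) :
    ∃ M, 0 ≤ M ∧ ∀ z ∈ cone c, ‖z‖ ≤ R → ‖liftPrimitive Y z‖ ≤ M * √‖z‖ := by
  obtain ⟨M, hM0, hM⟩ := h.bound_lift c R hc
  have hJ : 0 ≤ ∫ r in Ioo (0 : ℝ) 1, r ^ (-(1 / 2) : ℝ) :=
    setIntegral_nonneg measurableSet_Ioo fun r hr => Real.rpow_nonneg hr.1.le _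
  refine ⟨M * ∫ r in Ioo (0 : ℝ) 1, r ^ (-(1 / 2) : ℝ), by positivity, fun z hz hzR => ?_⟩
  have hz0 : 0 < ‖z‖ := hz.1.trans_le (Complex.re_le_norm z)
  have hsq : 0 < √‖z‖ := Real.sqrt_pos.2 hz0
  have h1 : ‖∫ r in Ioo (0 : ℝ) 1, Y ((r : ℂ) * z)‖ ≤
      ∫ r in Ioo (0 : ℝ) 1, M / √‖z‖ * r ^ (-(1 / 2) : ℝ) := by
    refine norm_integral_le_of_norm_le (integrableOn_rpow_neg_half.const_mul _)
      ((ae_restrict_iff' measurableSet_Ioo).2 (Eventually.of_forall fun r hr => ?_))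
    rw [← div_sqrt_norm_mul hr.1]
    exact hM _ (mul_mem_cone hz hr.1) ((norm_ofReal_mul_le hr.1.le hr.2.le z).trans hzR)
  rw [integral_const_mul] at h1
  rw [liftPrimitive, norm_smul]
  refine (mul_le_mul_of_nonneg_left h1 (norm_nonneg z)).trans (le_of_eq ?_)
  nth_rewrite 1 [← Real.mul_self_sqrt hz0.le]
  field_simp

theorem IsHeatPair.intervalIntegrable_lift (h : IsHeatPair ι C E Y) {t : ℝ} (ht : 0 ≤ t) :
    IntervalIntegrable (fun s : ℝ => Y s) volume 0 t := by
  obtain ⟨M, hM0, hM⟩ := h.bound_lift 1 t one_pos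
  have h1 : IntervalIntegrable (fun s : ℝ => M * s ^ (-(1 / 2) : ℝ)) volume 0 t :=
    (intervalIntegral.intervalIntegrable_rpow' (by norm_num)).const_mul M
  refine h1.mono_fun ?_ ?_
  · rw [uIoc_of_le ht]
    exact ((continuousOn_ofReal_pos h.diff_lift).mono fun s hs => hs.1).aestronglyMeasurable
      measurableSet_Ioc
  · rw [uIoc_of_le ht]
    refine (ae_restrict_iff' measurableSet_Ioc).2 (Eventually.of_forall fun s hs => ?_)
    have h2 := hM s (ofReal_mem_cone hs.1) (by
      rw [Complex.norm_real, Real.norm_of_nonneg hs.1.le]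
      exact hs.2)
    have h3 := div_sqrt_norm_mul (M := M) hs.1 1
    rw [mul_one] at h3
    rw [h3] at h2
    refine h2.trans (le_trans (le_of_eq ?_) (le_abs_self _))
    simp

theorem liftPrimitive_ofReal (t : ℝ) :
    liftPrimitive Y t = ∫ s in (0 : ℝ)..t, Y s := by
  have h1 := intervalIntegral.smul_integral_comp_mul_left (a := 0) (b := 1)
    (fun s : ℝ => Y s) t
  rw [mul_zero, mul_one] at h1
  rw [← h1, intervalIntegral.integral_of_le zero_le_one, integral_Ioc_eq_integral_Ioo,
    ← Complex.coe_smul, liftPrimitive]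
  congr 2
  funext r
  rw [mul_comm (r : ℂ)]
  push_cast
  rfl

theorem IsHeatPair.tendsto_liftPrimitive (h : IsHeatPair ι C E Y) {c : ℝ} (hc : 0 < c) (x : X) :
    Tendsto (fun z => liftPrimitive Y z x) (𝓝[cone c] 0) (𝓝 0) := by
  obtain ⟨M, hM0, hM⟩ := h.norm_liftPrimitive_le (R := 1) hc
  have hlim : Tendsto (fun z : ℂ => M * √‖z‖ * ‖x‖) (𝓝[cone c] 0) (𝓝 0) := by
    have : Continuous fun z : ℂ => M * √‖z‖ * ‖x‖ := by fun_prop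
    simpa using (this.tendsto 0).mono_left (nhdsWithin_le_nhds (s := cone c))
  have hev : ∀ᶠ z : ℂ in 𝓝[cone c] 0, z ∈ closedBall (0 : ℂ) 1 :=
    mem_nhdsWithin_of_mem_nhds (closedBall_mem_nhds _ one_pos)
  refine squeeze_zero_norm' ?_ hlim
  filter_upwards [hev, self_mem_nhdsWithin] with z hz1 hz
  rw [mem_closedBall_zero_iff] at hz1
  exact ContinuousLinearMap.le_of_opNorm_le _ (hM z hz hz1) x

variable [CompleteSpace V]

/-- Splitting the integral at `t` and using `Y (r + t) = Y r ∘ E t` gives the upper right entry of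
the semigroup law for the block matrix. -/
theorem IsHeatPair.liftPrimitive_add (h : IsHeatPair ι C E Y) (hι : Function.Injective ι)
    {s t : ℝ} (hs : 0 < s) (ht : 0 < t) :
    liftPrimitive Y ((s + t : ℝ) : ℂ) = liftPrimitive Y t + liftPrimitive Y s ∘L E t := by
  have hst : 0 < s + t := by positivity
  have i0 := h.intervalIntegrable_lift hst.le
  have i1 := h.intervalIntegrable_lift ht.le
  have i2 : IntervalIntegrable (fun s : ℝ => Y s) volume t (s + t) := i1.symm.trans i0
  rw [liftPrimitive_ofReal, liftPrimitive_ofReal, liftPrimitive_ofReal,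
    ← intervalIntegral.integral_add_adjacent_intervals i1 i2]
  congr 1
  have e1 := intervalIntegral.integral_comp_add_right (a := 0) (b := s) (fun r : ℝ => Y r) t
  rw [zero_add] at e1
  rw [← e1]
  have e2 := (((ContinuousLinearMap.compL ℂ X X V).flip (E t))).intervalIntegral_comp_comm
    (h.intervalIntegrable_lift hs.le)
  simp only [ContinuousLinearMap.flip_apply, ContinuousLinearMap.compL_apply] at e2
  rw [← e2, intervalIntegral.integral_of_le hs.le, intervalIntegral.integral_of_le hs.le]
  refine setIntegral_congr_fun measurableSet_Ioc fun r hr => ?_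
  exact h.lift_add hι hr.1 ht

theorem IsHeatPair.hasDerivAt_liftPrimitive (h : IsHeatPair ι C E Y) (x : X) {t : ℝ}
    (ht : 0 < t) : HasDerivAt (fun t : ℝ => liftPrimitive Y t x) (Y t x) t := by
  have hc := (continuousOn_ofReal_pos h.diff_lift).continuousAt (Ioi_mem_nhds ht)
  have h1 : HasDerivAt (fun t : ℝ => ∫ s in (0 : ℝ)..t, Y s) (Y t) t :=
    intervalIntegral.integral_hasDerivAt_right (h.intervalIntegrable_lift ht.le)
      ((continuousOn_ofReal_pos h.diff_lift).stronglyMeasurableAtFilter isOpen_Ioi t ht) hc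
  simp only [liftPrimitive_ofReal]
  have h3 := (ContinuousLinearMap.restrictScalarsL ℂ X V ℝ ℝ).hasFDerivAt.comp_hasDerivAt t h1
  exact (h3.clm_apply (hasDerivAt_const t x)).congr_deriv (by simp)

/-- For `x` in `D(C)` the slope converges in `V` to the lift of `x`, because the derivative `Y t x`
does. This identifies the first coordinate of the generator of the block semigroup. -/
theorem IsHeatPair.tendsto_slope_liftPrimitive_iff (h : IsHeatPair ι C E Y)
    (hι : Function.Injective ι) {K : ℝ}
    (hK : ∀ v y, (ι v, y) ∈ C.graph → ‖v‖ ≤ K * (‖ι v‖ + ‖y‖)) {x y : X}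
    (hxy : (x, y) ∈ C.graph) (hx : ∃ v, ι v = x) (v : V) :
    Tendsto (fun t : ℝ => (t⁻¹ : ℝ) • liftPrimitive Y t x) (𝓝[>] 0) (𝓝 v) ↔ x = ι v := by
  obtain ⟨w, rfl⟩ := hx
  have h0 := (h.tendsto_liftPrimitive one_pos (ι w)).comp tendsto_ofReal_cone
  have h1 := tendsto_slope_of_tendsto_deriv
    (fun t ht => h.hasDerivAt_liftPrimitive (ι w) ht) h0 (h.tendsto_lift hK hxy)
  simp only [sub_zero] at h1
  constructor
  · intro h2
    rw [tendsto_nhds_unique h1 h2]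
  · intro h2
    rwa [← hι h2]

end HeatSemigroup

/-! ### The semigroup of the reduction matrix -/

section Reduction

open Metric

variable {V X : Type*} [NormedAddCommGroup V] [NormedSpace ℂ V]
  [NormedAddCommGroup X] [NormedSpace ℂ X] {ι : V →L[ℂ] X} {C : X →ₗ.[ℂ] X}
  {E : ℂ → X →L[ℂ] X} {Y : ℂ → X →L[ℂ] V}

open Classical in
/-- The semigroup `(f, g) ↦ (f + ∫ Y g, E g)` on `V × X`. -/
noncomputable def heatBlock (E : ℂ → X →L[ℂ] X) (Y : ℂ → X →L[ℂ] V) (z : ℂ) :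
    (V × X) →L[ℂ] (V × X) :=
  if z = 0 then 1 else
    (ContinuousLinearMap.inl ℂ V X) ∘L (ContinuousLinearMap.fst ℂ V X) +
      (ContinuousLinearMap.inl ℂ V X) ∘L (liftPrimitive Y z) ∘L (ContinuousLinearMap.snd ℂ V X) +
      (ContinuousLinearMap.inr ℂ V X) ∘L (E z) ∘L (ContinuousLinearMap.snd ℂ V X)

theorem heatBlock_apply {z : ℂ} (hz : z ≠ 0) (p : V × X) :
    heatBlock E Y z p = (p.1 + liftPrimitive Y z p.2, E z p.2) := by
  simp [heatBlock, hz]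

theorem IsHeatPair.isHolomorphicSemigroup [CompleteSpace V] (h : IsHeatPair ι C E Y)
    (hι : Function.Injective ι) :
    IsHolomorphicSemigroup (heatBlock E Y) := by
  have hne : ∀ z : ℂ, 0 < z.re → z ≠ 0 := fun z hz h0 => by simp [h0] at hz
  refine ⟨?_, by simp [heatBlock], fun s t hs ht => ?_, fun c R hc => ?_, fun c hc p => ?_⟩
  · have hd : DifferentiableOn ℂ (fun z =>
        (ContinuousLinearMap.inl ℂ V X) ∘L (ContinuousLinearMap.fst ℂ V X) +
        (ContinuousLinearMap.inl ℂ V X) ∘L (liftPrimitive Y z) ∘L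
          (ContinuousLinearMap.snd ℂ V X) +
        (ContinuousLinearMap.inr ℂ V X) ∘L (E z) ∘L (ContinuousLinearMap.snd ℂ V X))
        {z | 0 < z.re} :=
      ((differentiableOn_const _).add ((differentiableOn_const _).clm_comp
        (h.differentiableOn_liftPrimitive.clm_comp (differentiableOn_const _)))).add
        ((differentiableOn_const _).clm_comp (h.diff.clm_comp (differentiableOn_const _)))
    refine hd.congr fun z hz => ?_
    simp [heatBlock, hne z hz]
  · have hs0 : (s : ℂ) ≠ 0 := by exact_mod_cast hs.ne'
    have ht0 : (t : ℂ) ≠ 0 := by exact_mod_cast ht.ne'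
    have hst0 : ((s + t : ℝ) : ℂ) ≠ 0 := by exact_mod_cast (add_pos hs ht).ne'
    refine ContinuousLinearMap.ext fun p => ?_
    rw [mul_apply_eq_comp, heatBlock_apply hst0, heatBlock_apply ht0, heatBlock_apply hs0,
      h.liftPrimitive_add hι hs ht, h.map_add hs ht]
    simp [add_assoc]
  · obtain ⟨M, hM0, hM⟩ := h.bound c R hc
    obtain ⟨N, hN0, hN⟩ := h.norm_liftPrimitive_le (R := R) hc
    refine ⟨1 + N * √R + M, by positivity, fun z hz hzR => ?_⟩
    refine ContinuousLinearMap.opNorm_le_bound _ (by positivity) fun p => ?_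
    rw [heatBlock_apply (hne z hz.1)]
    have h1 : ‖liftPrimitive Y z p.2‖ ≤ N * √R * ‖p‖ := by
      refine ((liftPrimitive Y z).le_of_opNorm_le ((hN z hz hzR).trans ?_) p.2).trans
        (mul_le_mul_of_nonneg_left (norm_snd_le p) (by positivity))
      gcongr
    have h2 : ‖E z p.2‖ ≤ M * ‖p‖ := ((E z).le_of_opNorm_le (hM z hz hzR) p.2).trans
      (mul_le_mul_of_nonneg_left (norm_snd_le p) hM0)
    refine max_le ?_ ?_
    · refine (norm_add_le _ _).trans ?_
      have := norm_fst_le p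
      nlinarith [norm_nonneg p]
    · refine h2.trans (mul_le_mul_of_nonneg_right ?_ (norm_nonneg p))
      nlinarith [mul_nonneg hN0 (Real.sqrt_nonneg R)]
  · have h1 := ((h.tendsto_liftPrimitive hc p.2).const_add p.1).prodMk_nhds
      (h.strongCont c hc p.2)
    rw [add_zero] at h1
    refine h1.congr' ?_
    filter_upwards [self_mem_nhdsWithin] with z hz
    exact (heatBlock_apply (hne z hz.1) p).symm

/-- The block semigroup for `A = 0` is perturbed by the bounded operator `(f, g) ↦ (0, A f)`.
Difference quotients at `0` of the two semigroups differ in the limit by exactly this operator, so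
the generator is the unperturbed one plus the perturbation. -/
theorem GeneratesCOFWithPhaseSpace.exists_holomorphicSemigroup [CompleteSpace V]
    [CompleteSpace X]
    (hC : GeneratesCOFWithPhaseSpace ι C) (A : V →L[ℂ] X) :
    ∃ T : ℂ → (V × X) →L[ℂ] (V × X), IsHolomorphicSemigroup T ∧
      IsSemigroupGenerator (reductionMatrix ι hC.injective A C hC.domain_le)
        (fun t : ℝ => T t) := by
  obtain ⟨M, ω, c, S, hcS⟩ := hC.exists_cosineSinePair
  obtain ⟨E, Y, h⟩ := hcS.exists_heatPair
  obtain ⟨K, -, hK⟩ := hC.exists_norm_le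
  obtain ⟨T, hT, hTP⟩ := (h.isHolomorphicSemigroup hC.injective).exists_perturbation
    ((ContinuousLinearMap.inr ℂ V X) ∘L A ∘L (ContinuousLinearMap.fst ℂ V X))
  refine ⟨T, hT, ?_⟩
  rintro ⟨f, g⟩ ⟨v, y⟩
  have hgen : ((f, g), (v, y)) ∈ (reductionMatrix ι hC.injective A C hC.domain_le).graph ↔
      g = ι v ∧ (g, y - A f) ∈ C.graph := by
    rw [mem_graph_reductionMatrix_iff, LinearPMap.mem_graph_iff]
    refine and_congr_right fun _ => ⟨?_, ?_⟩
    · rintro ⟨hg, rfl⟩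
      exact ⟨⟨g, hg⟩, rfl, by simp⟩
    · rintro ⟨⟨g', hg'⟩, h1, h2⟩
      obtain rfl : g' = g := h1
      exact ⟨hg', by rw [show C ⟨g', hg'⟩ = y - A f from h2, add_sub_cancel]⟩
  have hslope : Tendsto (fun t : ℝ => (t⁻¹ : ℝ) • (T t (f, g) - (f, g))) (𝓝[>] 0) (𝓝 (v, y)) ↔
      Tendsto (fun t : ℝ => (t⁻¹ : ℝ) • (heatBlock E Y t (f, g) - (f, g))) (𝓝[>] 0)
        (𝓝 (v, y - A f)) := by
    have hP := hTP (f, g)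
    simp only [ContinuousLinearMap.comp_apply, ContinuousLinearMap.coe_fst',
      ContinuousLinearMap.inr_apply] at hP
    constructor
    · intro h1
      have := h1.sub hP
      simp only [← smul_sub, Prod.mk_sub_mk, sub_zero, sub_sub_sub_cancel_left] at this
      refine this.congr fun t => ?_
      congr 1
    · intro h1
      have := h1.add hP
      simp only [← smul_add, Prod.mk_add_mk, add_zero, sub_add_cancel] at this
      refine this.congr fun t => ?_
      congr 1
      abel
  have hcomp : ∀ᶠ t : ℝ in 𝓝[>] 0,
      (t⁻¹ : ℝ) • (heatBlock E Y t (f, g) - (f, g)) =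
        ((t⁻¹ : ℝ) • liftPrimitive Y t g, (t⁻¹ : ℝ) • (E t g - g)) := by
    filter_upwards [self_mem_nhdsWithin] with t ht
    have ht0 : (t : ℂ) ≠ 0 := by exact_mod_cast (ne_of_gt ht)
    rw [heatBlock_apply ht0]
    simp
  rw [hgen, hslope, tendsto_congr' hcomp, Prod.tendsto_iff, ← h.mem_graph_iff hC.isClosed_graph]
  constructor
  · rintro ⟨h1, h2⟩
    exact ⟨(h.tendsto_slope_liftPrimitive_iff hC.injective hK h2 (hC.exists_eq h2) v).2 h1, h2⟩
  · rintro ⟨h1, h2⟩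
    exact ⟨(h.tendsto_slope_liftPrimitive_iff hC.injective hK h2 (hC.exists_eq h2) v).1 h1, h2⟩

end Reduction

/-! ### Smoothing and uniqueness for the first order problem -/

section Cauchy

open MeasureTheory

variable {E : Type*} [NormedAddCommGroup E] [NormedSpace ℂ E] {T : ℂ → E →L[ℂ] E}
  {B : E →ₗ.[ℂ] E}

theorem IsHolomorphicSemigroup.mem_graph (hT : IsHolomorphicSemigroup T)
    (hB : IsSemigroupGenerator B (fun t : ℝ => T t)) (x : E) {t : ℝ} (ht : 0 < t) :
    (T t x, deriv T t x) ∈ B.graph := by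
  rw [hB]
  have hd := ((hasDerivAt_apply_ofReal hT.diff x ht).tendsto_slope_zero).mono_left
    (nhdsWithin_mono _ fun s (hs : s ∈ Ioi (0 : ℝ)) => ne_of_gt hs)
  refine hd.congr' ?_
  filter_upwards [self_mem_nhdsWithin] with s hs
  rw [add_comm t s, hT.map_add s t hs ht]
  rfl

theorem IsHolomorphicSemigroup.deriv_apply (hT : IsHolomorphicSemigroup T)
    (hB : IsSemigroupGenerator B (fun t : ℝ => T t)) {x y : E} (h : (x, y) ∈ B.graph) {t : ℝ}
    (ht : 0 < t) : deriv T t x = T t y :=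
  B.mem_graph_snd_inj' (hT.mem_graph hB x ht) (hB.map_mem_graph hT.isC0Semigroup h ht.le) rfl

/-- `T (t - s) (U s)` equals `T t (U 0)` for all `s` in `(0, t)`, and it tends to `U t` as `s → t`.
-/
theorem IsHolomorphicSemigroup.eq_of_solution (hT : IsHolomorphicSemigroup T)
    (hB : IsSemigroupGenerator B (fun t : ℝ => T t)) {U U' : ℝ → E}
    (hc : ContinuousOn U (Ici 0)) (hU : ∀ t, 0 < t → HasDerivAt U (U' t) t)
    (hmem : ∀ t, 0 < t → (U t, U' t) ∈ B.graph) {t : ℝ} (ht : 0 ≤ t) : U t = T t (U 0) := by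
  rcases ht.eq_or_lt with rfl | ht
  · simp [hT.map_zero]
  have h0 : Tendsto U (𝓝[>] 0) (𝓝 (U 0)) := (hc 0 self_mem_Ici).mono Ioi_subset_Ici_self
  have hconst : ∀ s ∈ Ioo 0 t, T ((t - s : ℝ) : ℂ) (U s) = T t (U 0) := fun s hs =>
    apply_eq_of_deriv_apply_eq hT.diff (fun r hr => hU r hr.1)
      (fun r hr => hT.deriv_apply hB (hmem r hr.1) (by linarith [hr.2])) h0 hs
  have hsub : Tendsto (fun s : ℝ => t - s) (𝓝[<] t) (𝓝[>] 0) := by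
    refine tendsto_nhdsWithin_iff.2 ⟨?_, ?_⟩
    · have : Continuous fun s : ℝ => t - s := by fun_prop
      simpa using (this.tendsto t).mono_left (nhdsWithin_le_nhds (s := Iio t))
    · filter_upwards [self_mem_nhdsWithin] with s hs
      simpa using hs
  have h1 : Tendsto (fun s : ℝ => T ((t - s : ℝ) : ℂ) (U t)) (𝓝[<] t) (𝓝 (U t)) :=
    (hT.tendsto_zero (U t)).comp hsub
  -- The semigroup is only strongly continuous at `0`, so `U s` is exchanged for the fixed vector `U
  -- t` by means of the uniform bound on bounded times.
  have h2 : Tendsto (fun s : ℝ => T ((t - s : ℝ) : ℂ) (U s - U t)) (𝓝[<] t) (𝓝 0) := by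
    obtain ⟨K, hK0, hK⟩ := hT.bound 1 t one_pos
    have h3 : Tendsto (fun s => K * ‖U s - U t‖) (𝓝[<] t) (𝓝 0) := by
      have := ((((hU t ht).continuousAt.tendsto.mono_left
        (nhdsWithin_le_nhds (s := Iio t))).sub_const (U t)).norm).const_mul K
      simpa using this
    refine squeeze_zero_norm' ?_ h3
    filter_upwards [Ioo_mem_nhdsLT ht] with s hs
    refine ContinuousLinearMap.le_of_opNorm_le _ (hK _ (ofReal_mem_cone (by linarith [hs.2])) ?_) _
    rw [Complex.norm_real, Real.norm_of_nonneg (by linarith [hs.2])]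
    linarith [hs.1]
  have h4 := h2.add h1
  rw [zero_add] at h4
  refine tendsto_nhds_unique h4 (tendsto_const_nhds.congr' ?_)
  filter_upwards [Ioo_mem_nhdsLT ht] with s hs
  rw [← hconst s hs, map_sub, sub_add_cancel]

theorem hasDerivWithinAt_Ici_zero {G : Type*} [NormedAddCommGroup G] [NormedSpace ℝ G]
    {f : ℝ → G} {b : G} (h : Tendsto (fun t : ℝ => (t⁻¹ : ℝ) • (f t - f 0)) (𝓝[>] 0) (𝓝 b)) :
    HasDerivWithinAt f b (Ici 0) 0 := by
  rw [hasDerivWithinAt_iff_tendsto_slope, Ici_sdiff_left]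
  exact h.congr fun t => by rw [slope_def_module, sub_zero]

end Cauchy

/-! ### Classical and strict solutions, and well-posedness -/

section WellPosed

open MeasureTheory

variable {V X : Type*} [NormedAddCommGroup V] [NormedSpace ℂ V]
  [NormedAddCommGroup X] [NormedSpace ℂ X] {ι : V →L[ℂ] X} {C : X →ₗ.[ℂ] X} {A : V →L[ℂ] X}

theorem IsSolutionOn.mono {J J' : Set ℝ} {f : V} {g : X} {u : ℝ → V} {u₁ : ℝ → X}
    (h : IsSolutionOn ι A C J f g u u₁) (hJ : J' ⊆ J) : IsSolutionOn ι A C J' f g u u₁ := by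
  obtain ⟨h1, h2, h3, h4, h5, u₂, h6, h7⟩ := h
  exact ⟨h1, h2, h3, h4, h5, u₂, h6.mono hJ, fun t ht => h7 t (hJ ht)⟩

variable {T : ℂ → (V × X) →L[ℂ] (V × X)} [CompleteSpace V]

/-- A classical solution is differentiable in `V` on `(0, ∞)` and solves the first order
problem of the reduction matrix. -/
theorem IsClassicalSolution.exists_deriv [CompleteSpace X]
    (hC : GeneratesCOFWithPhaseSpace ι C) {f : V} {g : X}
    {u : ℝ → V} {u₁ : ℝ → X} (h : IsClassicalSolution ι A C f g u u₁) :
    ∃ U' : ℝ → V × X, ∀ t, 0 < t → HasDerivAt (fun t => (u t, u₁ t)) (U' t) t ∧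
      ((u t, u₁ t), U' t) ∈ (reductionMatrix ι hC.injective A C hC.domain_le).graph := by
  obtain ⟨-, -, hu, hu₁, hd, u₂, hu₂, heq⟩ := h
  obtain ⟨K, hK0, hK⟩ := hC.exists_norm_le
  have hgr : ∀ t, 0 < t → (u₁ t, u₂ t - A (u t)) ∈ C.graph := by
    intro t ht
    obtain ⟨-, hdom, h2⟩ := heq t ht
    rw [LinearPMap.mem_graph_iff]
    exact ⟨⟨u₁ t, hdom⟩, rfl, by simp only [h2, add_sub_cancel_left]⟩
  have hex : ∀ t : ℝ, ∃ v, 0 < t → ι v = u₁ t := by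
    intro t
    by_cases ht : 0 < t
    · obtain ⟨v, hv⟩ := hC.exists_eq (hgr t ht)
      exact ⟨v, fun _ => hv⟩
    · exact ⟨0, fun h => absurd h ht⟩
  choose v hv using hex
  -- The lift `v` of the velocity is continuous into `V`: both `u₁` and `C u₁ = u₂ - A u` are
  -- continuous in `X`, and the graph norm dominates the norm of `V`.
  have hvc : ContinuousOn v (Ioi 0) := by
    intro t ht
    have hlim1 := ((hu₁.mono Ioi_subset_Ici_self) t ht).sub_const (u₁ t)
    have hc2 : ContinuousOn (fun s => u₂ s - A (u s)) (Ioi 0) :=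
      hu₂.sub (A.continuous.comp_continuousOn (hu.mono Ioi_subset_Ici_self))
    have hlim2 := (hc2 t ht).sub_const (u₂ t - A (u t))
    have hlim := (hlim1.norm.add hlim2.norm).const_mul K
    simp only [sub_self, norm_zero, add_zero, mul_zero] at hlim
    refine tendsto_iff_norm_sub_tendsto_zero.2 (squeeze_zero' (Eventually.of_forall fun _ =>
      norm_nonneg _) ?_ hlim)
    filter_upwards [self_mem_nhdsWithin] with s hs
    have h1 := hK (v s - v t) ((u₂ s - A (u s)) - (u₂ t - A (u t))) (by
      rw [map_sub, hv s hs, hv t ht]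
      exact C.graph.sub_mem (hgr s hs) (hgr t ht))
    rwa [map_sub, hv s hs, hv t ht] at h1
  refine ⟨fun t => (v t, u₂ t), fun t ht => ⟨HasDerivAt.prodMk ?_
    ((heq t ht).1.hasDerivAt (Ici_mem_nhds ht)), ?_⟩⟩
  · have ha : 0 < t / 2 := by positivity
    have hint : ∀ s, 0 < s → IntervalIntegrable v volume (t / 2) s := fun s hs =>
      (hvc.mono fun r hr => (lt_min ha hs).trans_le hr.1).intervalIntegrable
    -- The formula is checked in `X` and pulled back by injectivity of `ι`, which upgrades
    -- differentiability from `X` to `V`. The base point `t / 2` is used because `v` is controlled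
    -- only on the open half-line.
    have hprim : ∀ s, 0 < s → u s = u (t / 2) + ∫ r in (t / 2)..s, v r := by
      intro s hs
      apply hC.injective
      have e1 : ∫ r in (t / 2)..s, ι (v r) = ι (u s) - ι (u (t / 2)) := by
        refine intervalIntegral.integral_eq_sub_of_hasDerivAt (f := fun s => ι (u s))
          (fun r hr => ?_) ?_
        · have hr0 : 0 < r := (lt_min ha hs).trans_le hr.1
          rw [hv r hr0]
          exact (hd r hr0.le).hasDerivAt (Ici_mem_nhds hr0)
        · exact ((ι.continuous.comp_continuousOn hvc).mono
            fun r hr => (lt_min ha hs).trans_le hr.1).intervalIntegrable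
      rw [map_add, ← ContinuousLinearMap.intervalIntegral_comp_comm _ (hint s hs), e1]
      abel
    have h1 : HasDerivAt (fun s => ∫ r in (t / 2)..s, v r) (v t) t :=
      intervalIntegral.integral_hasDerivAt_right (hint t ht)
        (hvc.stronglyMeasurableAtFilter isOpen_Ioi t ht) (hvc.continuousAt (Ioi_mem_nhds ht))
    refine (h1.const_add (u (t / 2))).congr_of_eventuallyEq ?_
    filter_upwards [Ioi_mem_nhds ht] with s hs
    exact hprim s hs
  · rw [mem_graph_reductionMatrix_iff]
    exact ⟨(hv t ht).symm, (heq t ht).2⟩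

variable [CompleteSpace X]

theorem IsClassicalSolution.eq_semigroup (hC : GeneratesCOFWithPhaseSpace ι C)
    (hT : IsHolomorphicSemigroup T) (hgen : IsSemigroupGenerator
      (reductionMatrix ι hC.injective A C hC.domain_le) (fun t : ℝ => T t))
    {f : V} {g : X} {u : ℝ → V} {u₁ : ℝ → X} (h : IsClassicalSolution ι A C f g u u₁)
    {t : ℝ} (ht : 0 ≤ t) : (u t, u₁ t) = T t (f, g) := by
  obtain ⟨U', hU'⟩ := h.exists_deriv hC
  obtain ⟨rfl, rfl, hu, hu₁, -⟩ := h
  exact hT.eq_of_solution hgen (U := fun t => (u t, u₁ t)) (hu.prodMk hu₁)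
    (fun t ht => (hU' t ht).1) (fun t ht => (hU' t ht).2) ht

/-- At `t = 0` the data need not lie in the domain of the generator. The derivative there is
obtained as the limit of the velocity, the second coordinate, which is continuous up to `0`. -/
theorem hasDerivWithinAt_semigroup_fst (hC : GeneratesCOFWithPhaseSpace ι C)
    (hT : IsHolomorphicSemigroup T) (hgen : IsSemigroupGenerator
      (reductionMatrix ι hC.injective A C hC.domain_le) (fun t : ℝ => T t)) (p : V × X)
    {t : ℝ} (ht : 0 ≤ t) :
    HasDerivWithinAt (fun s : ℝ => ι (T s p).1) (T t p).2 (Ici 0) t := by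
  have hc := hT.isC0Semigroup.continuousOn p
  have hpos : ∀ s : ℝ, 0 < s → HasDerivAt (fun s : ℝ => ι (T s p).1) (T s p).2 s := by
    intro s hs
    have h1 := (mem_graph_reductionMatrix_iff ι hC.injective A C hC.domain_le
      (T s p).1 (deriv T s p).1 (T s p).2 (deriv T s p).2).1 (hT.mem_graph hgen p hs)
    rw [h1.1]
    exact ((ι ∘L ContinuousLinearMap.fst ℂ V X).restrictScalars ℝ).hasFDerivAt.comp_hasDerivAt s
      (hasDerivAt_apply_ofReal hT.diff p hs)
  rcases ht.eq_or_lt with rfl | ht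
  · refine hasDerivWithinAt_Ici_zero (tendsto_slope_of_tendsto_deriv hpos ?_ ?_)
    · exact ((ι.continuous.comp continuous_fst).comp_continuousOn hc 0 self_mem_Ici).mono
        Ioi_subset_Ici_self
    · exact (continuous_snd.comp_continuousOn hc 0 self_mem_Ici).mono Ioi_subset_Ici_self
  · exact (hpos t ht).hasDerivWithinAt

theorem isClassicalSolution_semigroup (hC : GeneratesCOFWithPhaseSpace ι C)
    (hT : IsHolomorphicSemigroup T) (hgen : IsSemigroupGenerator
      (reductionMatrix ι hC.injective A C hC.domain_le) (fun t : ℝ => T t)) (f : V) (g : X) :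
    IsClassicalSolution ι A C f g (fun t => (T t (f, g)).1) (fun t => (T t (f, g)).2) := by
  have hc := hT.isC0Semigroup.continuousOn (f, g)
  refine ⟨by simp [hT.map_zero], by simp [hT.map_zero], continuous_fst.comp_continuousOn hc,
    continuous_snd.comp_continuousOn hc, fun t ht => hasDerivWithinAt_semigroup_fst hC hT hgen _ ht,
    fun t => (deriv T t (f, g)).2, ?_, fun t ht => ⟨?_, ?_⟩⟩
  · have h1 := continuousOn_ofReal_pos (hT.diff.deriv isOpen_re_pos)
    exact continuous_snd.comp_continuousOn
      ((ContinuousLinearMap.apply ℂ (V × X) (f, g)).continuous.comp_continuousOn h1)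
  · exact (((ContinuousLinearMap.snd ℂ V X).restrictScalars ℝ).hasFDerivAt.comp_hasDerivAt t
      (hasDerivAt_apply_ofReal hT.diff (f, g) ht)).hasDerivWithinAt
  · exact ((mem_graph_reductionMatrix_iff ι hC.injective A C hC.domain_le (T t (f, g)).1
      (deriv T t (f, g)).1 (T t (f, g)).2 (deriv T t (f, g)).2).1
      (hT.mem_graph hgen (f, g) ht)).2

/-- When `g` lies in `D(C)`, the data lie in the domain of the matrix. With `q` their image, the
orbit has derivative `T t q`, which is continuous up to `t = 0`. -/
theorem isStrictSolution_semigroup (hC : GeneratesCOFWithPhaseSpace ι C)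
    (hT : IsHolomorphicSemigroup T) (hgen : IsSemigroupGenerator
      (reductionMatrix ι hC.injective A C hC.domain_le) (fun t : ℝ => T t)) (f : V) {g : X}
    (hg : g ∈ C.domain) :
    IsStrictSolution ι A C f g (fun t => (T t (f, g)).1) (fun t => (T t (f, g)).2) := by
  obtain ⟨v, rfl⟩ := hC.domain_le hg
  obtain ⟨q, hq⟩ : ∃ q, ((f, ι v), q) ∈
      (reductionMatrix ι hC.injective A C hC.domain_le).graph :=
    ⟨(v, A f + C ⟨ι v, hg⟩), by
      rw [mem_graph_reductionMatrix_iff]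
      exact ⟨rfl, hg, rfl⟩⟩
  have hc := hT.isC0Semigroup.continuousOn (f, ι v)
  refine ⟨by simp [hT.map_zero], by simp [hT.map_zero], continuous_fst.comp_continuousOn hc,
    continuous_snd.comp_continuousOn hc, fun t ht => hasDerivWithinAt_semigroup_fst hC hT hgen _ ht,
    fun t => (T t q).2, continuous_snd.comp_continuousOn (hT.isC0Semigroup.continuousOn q),
    fun t ht => ⟨?_, ?_⟩⟩
  · rcases (mem_Ici.1 ht).eq_or_lt with rfl | ht
    · refine hasDerivWithinAt_Ici_zero ?_
      have h1 := (continuous_snd.tendsto q).comp ((hgen _ _).1 hq)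
      simpa [Function.comp_def, hT.map_zero] using h1
    · simp only [← hT.deriv_apply hgen hq ht]
      exact (((ContinuousLinearMap.snd ℂ V X).restrictScalars ℝ).hasFDerivAt.comp_hasDerivAt t
        (hasDerivAt_apply_ofReal hT.diff (f, ι v) ht)).hasDerivWithinAt
  · exact ((mem_graph_reductionMatrix_iff ι hC.injective A C hC.domain_le (T t (f, ι v)).1
      (T t q).1 (T t (f, ι v)).2 (T t q).2).1
      (hgen.map_mem_graph hT.isC0Semigroup hq ht)).2

theorem isWellPosed_of_semigroup (hC : GeneratesCOFWithPhaseSpace ι C)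
    (hT : IsHolomorphicSemigroup T) (hgen : IsSemigroupGenerator
      (reductionMatrix ι hC.injective A C hC.domain_le) (fun t : ℝ => T t)) :
    IsWellPosed ι A C where
  -- Smoothing gives density: the velocity of the orbit of `(0, x)` lies in `D(C)` for `t > 0` and
  -- tends to `x`.
  dense := by
    intro x
    have h1 : Tendsto (fun t : ℝ => (T t ((0 : V), x)).2) (𝓝[>] 0) (𝓝 x) :=
      (continuous_snd.tendsto _).comp (hT.tendsto_zero (0, x))
    refine mem_closure_of_tendsto h1 ?_
    filter_upwards [self_mem_nhdsWithin] with t ht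
    obtain ⟨-, -, -, -, -, u₂, -, h2⟩ := isClassicalSolution_semigroup hC hT hgen 0 x
    exact (h2 t ht).2.1
  exists_unique := by
    intro f g hg
    refine ⟨_, _, isStrictSolution_semigroup hC hT hgen f hg, fun v v₁ h => ?_⟩
    have h1 : IsClassicalSolution ι A C f g v v₁ := IsSolutionOn.mono h Ioi_subset_Ici_self
    exact ⟨fun t ht => congrArg Prod.fst (h1.eq_semigroup hC hT hgen ht),
      fun t ht => congrArg Prod.snd (h1.eq_semigroup hC hT hgen ht)⟩
  dependence := by
    intro τ _
    obtain ⟨K, hK0, hK⟩ := hT.isC0Semigroup.exists_bound_Icc τ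
    -- The product carries the maximum norm, so each of the two coordinates contributes one `K`.
    refine ⟨2 * K, fun f g u u₁ h t ht => ?_⟩
    have h1 := h.eq_semigroup hC hT hgen ht.1
    have h2 := (T t).le_of_opNorm_le (hK t ht.1 ht.2) (f, g)
    rw [← h1] at h2
    have h3 : ‖((f, g) : V × X)‖ ≤ ‖f‖ + ‖g‖ := max_le
      (le_add_of_nonneg_right (norm_nonneg _)) (le_add_of_nonneg_left (norm_nonneg _))
    have h4 : ‖u t‖ ≤ ‖(u t, u₁ t)‖ := le_max_left _ _
    have h5 : ‖u₁ t‖ ≤ ‖(u t, u₁ t)‖ := le_max_right _ _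
    nlinarith

end WellPosed

end CosineGeneration

theorem theorem6p2 {V X : Type*} [NormedAddCommGroup V] [NormedSpace ℂ V] [CompleteSpace V]
    [NormedAddCommGroup X] [NormedSpace ℂ X] [CompleteSpace X]
    (ι : V →L[ℂ] X) (C : X →ₗ.[ℂ] X)
    (hC : CosineGeneration.GeneratesCOFWithPhaseSpace ι C) (A : V →L[ℂ] X) :
    CosineGeneration.GeneratesAnalyticSemigroup
      (CosineGeneration.reductionMatrix ι hC.injective A C hC.domain_le) (Real.pi / 2) ∧
    CosineGeneration.IsWellPosed ι A C ∧
    ∀ (f : V) (g : X), ∃ (u : ℝ → V) (u₁ : ℝ → X),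
      CosineGeneration.IsClassicalSolution ι A C f g u u₁ ∧
      ∀ (v : ℝ → V) (v₁ : ℝ → X), CosineGeneration.IsClassicalSolution ι A C f g v v₁ →
        Set.EqOn v u (Set.Ici 0) ∧ Set.EqOn v₁ u₁ (Set.Ici 0) := by
  obtain ⟨T, hT, hgen⟩ := hC.exists_holomorphicSemigroup A
  refine ⟨⟨T, hT.isAnalyticSemigroup, hgen⟩,
    CosineGeneration.isWellPosed_of_semigroup hC hT hgen, fun f g => ?_⟩
  refine ⟨_, _, CosineGeneration.isClassicalSolution_semigroup hC hT hgen f g, fun v v₁ h => ?_⟩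
  exact ⟨fun t ht => congrArg Prod.fst (h.eq_semigroup hC hT hgen ht),
    fun t ht => congrArg Prod.snd (h.eq_semigroup hC hT hgen ht)⟩
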